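/- Let $p\ge 1$, let $\mu$ be Lebesgue measure on $(0,\infty)$, and let $H=\mathbb C^p\otimes L^2(0,\infty)$, viewed as $\mathbb C^p$-valued functions; inner products are linear in the second variable, and $e_1,\dots,e_p$ is the standard basis of $\mathbb C^p$. For $A\in B(\mathbb C^p)$ let $(\Lambda(A)F)(x)=e^{-x}AF(x)$, and write $\Lambda$ also for $\Lambda(I)$. Let $\mathfrak A=\{(I-\Lambda)^{1/2}B(I-\Lambda)^{1/2}: B\in B(H)\}$, and let $L^2_+(0,\infty)$ be the space of measurable $f$ with $\int_0^\infty(1-e^{-x})|f(x)|^2\,dx<\infty$. For $F,G\in\mathbb C^p\otimes L^2_+(0,\infty)$ and $A=(I-\Lambda)^{1/2}B(I-\Lambda)^{1/2}\in\mathfrak A$ put $(F,AG)=((I-\Lambda)^{1/2}F,\,B(I-\Lambda)^{1/2}G)$. For $t>0$ let $E(t,\infty)$ be the projection of $H$ onto functions supported in $[t,\infty)$, and $A|_t=E(t,\infty)AE(t,\infty)\in\mathfrak A$ for $A\in B(H)$. A $b$-weight map is a linear map $\omega:\mathfrak A\to B(\mathbb C^p)$ such that $B\mapsto (f,\omega((I-\Lambda)^{1/2}B(I-\Lambda)^{1/2})g)$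 is $\sigma$-weakly continuous on $B(H)$ for all $f,g\in\mathbb C^p$; put $\omega|_t(A)=\omega(A|_t)$. A $q$-weight map over $\mathbb C^p$ is a completely positive $b$-weight map $\omega$ such that for every $t>0$ the map $\iota+\omega|_t\Lambda$ of $B(\mathbb C^p)$ into itself is invertible ($\iota$ being the identity map) and $\pi_t^\#=(\iota+\omega|_t\Lambda)^{-1}\omega|_t$ is a completely positive, contractive, normal map $B(H)\to B(\mathbb C^p)$. It is unital if $\omega(I-\Lambda)=I$. Its normal spine is the normal completely positive map $\pi_o^\#:B(H)\to B(\mathbb C^p)$ with $\pi_t^\#(A|_s)\to\pi_o^\#(A|_s)$ as $t\to0+$ for all $s>0$ and $A\in B(H)$, and $\omega$ is of index zero if $\pi_o^\#=0$. For $q$-weight maps $\omega,\omega'$ with representations $\pi_t^\#,\pi_t'^\#$, $\omega'$ is a $q$-subordinate of $\omega$ if $\pi_t^\#-\pi_t'^\#$ is completely positive for all $t>0$. A linear map $\phi$ of $B(\mathbb C^p)$ into itself is conditionally negative if it is hermitian ($\phi(A^*)=\phi(A)^*$) and $\sum_{i,j}(f_i,\phi(A_i^*A_j)f_j)\le0$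 for all finite families $A_i\in B(\mathbb C^p)$, $f_i\in\mathbb C^p$ with $\sum_iA_if_i=0$. For linear maps $\psi,\psi'$ of $B(\mathbb C^p)$ into itself, $\psi\le\psi'$ means that $\psi'-\psi$ is completely positive. Consider the following conditions on linear maps $\vartheta:\mathfrak A\to B(\mathbb C^p)$, $\rho: B(H)\to B(\mathbb C^p)$ and $\psi:B(\mathbb C^p)\to B(\mathbb C^p)$. (a) There are a countable set $J$, functions $g_k\in L^2_+(0,\infty)$ and vectors $h_{ik}\in\mathbb C^p\otimes L^2(0,\infty)$ ($k\in J$, $1\le i\le p$) such that, with $g_{ik}(x)=g_k(x)e_i$, $$\vartheta_{ij}(A)=\sum_{k\in J}(g_{ik}+h_{ik},A(g_{jk}+h_{jk}))\ (A\in\mathfrak A),\qquad \rho_{ij}(A)=\sum_{k\in J}(h_{ik},Ah_{jk})\ (A\in B(H)),$$ $\sum_{i=1}^p(h_{ik})_i(x)=0$ for all $k$ and a.e. $x$, $\rho$ is bounded, $\sum_k\|h_{ik}\|^2<\infty$ for each $i$, $\sum_k\int_0^\infty(1-e^{-x})|g_k(x)|^2dx<\infty$, and $w_t=\sum_k\int_t^\infty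 e^{-x}|g_k(x)|^2dx\to\infty$ as $t\to0+$. (b) $\psi$ is invertible and conditionally negative, $\psi^{-1}$ is completely positive, $\psi(I)\ge\vartheta(I-\Lambda)$, and $\psi+\rho\Lambda$ is conditionally negative. **Theorem 4.7.** (1) If $\omega$ is a $q$-weight map over $\mathbb C^p$ of index zero with range $B(\mathbb C^p)$, then $\omega=\psi^{-1}\vartheta$ for some $\vartheta,\rho,\psi$ satisfying (a) and (b); furthermore $\omega$ is unital if and only if $\psi(I)=\vartheta(I-\Lambda)$. (2) Conversely, if $\vartheta,\rho,\psi$ satisfy (a) and (b), then $\omega=\psi^{-1}\vartheta$ is a $q$-weight map over $\mathbb C^p$ of index zero with range $B(\mathbb C^p)$, and $\omega$ is unital if and only if $\psi(I)=\vartheta(I-\Lambda)$. If moreover $\psi'$ also satisfies (b) with the same $\vartheta,\rho$, and $\omega'=\psi'^{-1}\vartheta$, then $\omega'$ is a $q$-subordinate of $\omega$ if and only if $\psi\le\psi'$. -/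

import Mathlib

open MeasureTheory Filter Topology
open scoped ENNReal ComplexOrder InnerProductSpace

noncomputable section

namespace QWeight

/-! ### Spaces and basic operators -/

/-- The Hilbert space `ℂ^p`. -/
abbrev K (p : ℕ) : Type := EuclideanSpace ℂ (Fin p)

/-- Lebesgue measure on the half line `(0, ∞)`. -/
abbrev halfLine : Measure ℝ := volume.restrict (Set.Ioi (0 : ℝ))

/-- `H = ℂ^p ⊗ L²(0, ∞)`, realized as `ℂ^p`-valued square integrable functions. -/
abbrev H (p : ℕ) : Type := Lp (K p) 2 halfLine

/-- `B(ℂ^p)`. -/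
abbrev BK (p : ℕ) : Type := K p →L[ℂ] K p

/-- `B(H)`, where `H = ℂ^p ⊗ L²(0, ∞)`. -/
abbrev BH (p : ℕ) : Type := H p →L[ℂ] H p

/-- Multiplication by an essentially bounded scalar function on `(0, ∞)`. -/
def mulOp (p : ℕ) (m : Lp ℂ ∞ halfLine) : BH p :=
  (ContinuousLinearMap.lsmul ℂ ℂ).holderL halfLine ∞ 2 2 m

theorem mulOp_coeFn (p : ℕ) (m : Lp ℂ ∞ halfLine) (F : H p) :
    mulOp p m F =ᵐ[halfLine] fun x => m x • F x := by
  simpa [mulOp] using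
    (ContinuousLinearMap.lsmul ℂ ℂ : ℂ →L[ℂ] K p →L[ℂ] K p).coeFn_holder
      (r := 2) (p := ∞) (q := 2) m F

theorem mulOp_comp (p : ℕ) (m₁ m₂ m₃ : Lp ℂ ∞ halfLine)
    (h : ∀ᵐ x ∂halfLine, m₁ x * m₂ x = m₃ x) :
    mulOp p m₁ ∘L mulOp p m₂ = mulOp p m₃ := by
  ext1 F
  apply Lp.ext
  rw [ContinuousLinearMap.comp_apply]
  filter_upwards [mulOp_coeFn p m₁ (mulOp p m₂ F), mulOp_coeFn p m₂ F, mulOp_coeFn p m₃ F, h]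
    with x h1 h2 h3 h4
  rw [h1, h2, h3, smul_smul, h4]

theorem expFun_memLp : MemLp (fun x : ℝ => ((Real.exp (-x) : ℝ) : ℂ)) ∞ halfLine := by
  refine memLp_top_of_bound (by fun_prop) 1 ?_
  filter_upwards [ae_restrict_mem measurableSet_Ioi] with x hx
  have hx' : (0 : ℝ) < x := hx
  rw [Complex.norm_real, Real.norm_eq_abs, abs_of_pos (Real.exp_pos _)]
  exact Real.exp_le_one_iff.2 (by linarith)

theorem sqrtFun_memLp :
    MemLp (fun x : ℝ => ((Real.sqrt (1 - Real.exp (-x)) : ℝ) : ℂ)) ∞ halfLine := by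
  refine memLp_top_of_bound (by fun_prop) 1 ?_
  filter_upwards [ae_restrict_mem measurableSet_Ioi] with x hx
  rw [Complex.norm_real, Real.norm_eq_abs, abs_of_nonneg (Real.sqrt_nonneg _)]
  refine Real.sqrt_le_one.2 ?_
  have := Real.exp_pos (-x)
  linarith

theorem indicatorFun_memLp (t : ℝ) :
    MemLp ((Set.Ici t).indicator (fun _ : ℝ => (1 : ℂ))) ∞ halfLine := by
  refine memLp_top_of_bound
    ((stronglyMeasurable_const.indicator measurableSet_Ici).aestronglyMeasurable) 1 ?_
  refine Eventually.of_forall fun x => ?_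
  by_cases hx : x ∈ Set.Ici t <;> simp [hx]

/-- The operator `F(x) ↦ e^{-x} F(x)`. -/
def expOp (p : ℕ) : BH p := mulOp p expFun_memLp.toLp

/-- The mapping `Λ : B(ℂ^p) → B(H)`, `(Λ(A)F)(x) = e^{-x} A F(x)`. -/
def Lam (p : ℕ) : BK p →ₗ[ℂ] BH p where
  toFun A := expOp p ∘L A.compLpL 2 halfLine
  map_add' A B := by rw [ContinuousLinearMap.add_compLpL, ContinuousLinearMap.comp_add]
  map_smul' c A := by
    rw [ContinuousLinearMap.smul_compLpL, ContinuousLinearMap.comp_smul, RingHom.id_apply]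

/-- The operator `(I - Λ)^{1/2}`, that is `F(x) ↦ (1 - e^{-x})^{1/2} F(x)`. -/
def sqrtOp (p : ℕ) : BH p := mulOp p sqrtFun_memLp.toLp

/-- The projection `E(t, ∞)` onto the functions supported in `[t, ∞)`. -/
def E (p : ℕ) (t : ℝ) : BH p := mulOp p (indicatorFun_memLp t).toLp

/-- The linear map `A ↦ S A S` on `B(H)`. -/
def sandwich {p : ℕ} (S : BH p) : BH p →ₗ[ℂ] BH p where
  toFun A := S ∘L A ∘L S
  map_add' A B := by rw [ContinuousLinearMap.add_comp, ContinuousLinearMap.comp_add]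
  map_smul' c A := by
    rw [ContinuousLinearMap.smul_comp, ContinuousLinearMap.comp_smul, RingHom.id_apply]

theorem sandwich_factor {p : ℕ} {S T R : BH p} (h1 : S ∘L T = R) (h2 : T ∘L S = R) (A : BH p) :
    sandwich S (T ∘L A ∘L T) = sandwich R A := by
  ext1 x
  have h1' : ∀ y, S (T y) = R y := fun y => by rw [← h1, ContinuousLinearMap.comp_apply]
  have h2' : ∀ y, T (S y) = R y := fun y => by rw [← h2, ContinuousLinearMap.comp_apply]
  simp only [sandwich, LinearMap.coe_mk, AddHom.coe_mk, ContinuousLinearMap.comp_apply, h1', h2']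

/-- `𝔄(ℂ^p)`: the operators of the form `(I - Λ)^{1/2} B (I - Λ)^{1/2}` with `B ∈ B(H)`. -/
def Alg (p : ℕ) : Submodule ℂ (BH p) := LinearMap.range (sandwich (sqrtOp p))

/-- The surjection `B ↦ (I - Λ)^{1/2} B (I - Λ)^{1/2}` of `B(H)` onto `𝔄(ℂ^p)`. -/
def toAlg (p : ℕ) : BH p →ₗ[ℂ] Alg p := (sandwich (sqrtOp p)).rangeRestrict

theorem Lam_one (p : ℕ) : Lam p 1 = expOp p := by
  ext1 F
  have : (1 : BK p).compLpL 2 halfLine F = F := by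
    apply Lp.ext
    filter_upwards [ContinuousLinearMap.coeFn_compLpL (p := 2) (μ := halfLine) (1 : BK p) F]
      with x hx
    simpa using hx
  simp only [Lam, LinearMap.coe_mk, AddHom.coe_mk, ContinuousLinearMap.comp_apply]
  rw [this]

theorem one_sub_Lam_eq (p : ℕ) : sqrtOp p ∘L sqrtOp p = 1 - Lam p 1 := by
  rw [Lam_one]
  ext1 F
  apply Lp.ext
  rw [ContinuousLinearMap.comp_apply, sub_apply, one_apply_eq_self]
  filter_upwards [mulOp_coeFn p sqrtFun_memLp.toLp (sqrtOp p F),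
    mulOp_coeFn p sqrtFun_memLp.toLp F, mulOp_coeFn p expFun_memLp.toLp F,
    sqrtFun_memLp.coeFn_toLp, expFun_memLp.coeFn_toLp, Lp.coeFn_sub F (expOp p F),
    ae_restrict_mem measurableSet_Ioi] with x h1 h2 h3 h4 h5 h6 hx
  have hx' : (0 : ℝ) < x := hx
  have hle : Real.exp (-x) ≤ 1 := Real.exp_le_one_iff.2 (by linarith)
  rw [h6, Pi.sub_apply]
  unfold sqrtOp expOp at *
  rw [h1, h2, h3, h4, h5, smul_smul, ← Complex.ofReal_mul,
    Real.mul_self_sqrt (by linarith), Complex.ofReal_sub, Complex.ofReal_one, sub_smul, one_smul]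

/-- The element `I - Λ` of `𝔄(ℂ^p)`. -/
def oneSubLam (p : ℕ) : Alg p :=
  ⟨1 - Lam p 1, 1, by
    rw [← one_sub_Lam_eq]
    rfl⟩

theorem invSqrtFun_memLp {t : ℝ} (ht : 0 < t) :
    MemLp ((Set.Ici t).indicator
      (fun x : ℝ => (((Real.sqrt (1 - Real.exp (-x)))⁻¹ : ℝ) : ℂ))) ∞ halfLine := by
  have hpos : 0 < 1 - Real.exp (-t) := by
    have : Real.exp (-t) < 1 := Real.exp_zero ▸ Real.exp_lt_exp.2 (by linarith)
    linarith
  refine memLp_top_of_bound (AEStronglyMeasurable.indicator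
    (Measurable.aestronglyMeasurable (by fun_prop)) measurableSet_Ici)
    (Real.sqrt (1 - Real.exp (-t)))⁻¹ (Eventually.of_forall fun x => ?_)
  by_cases hx : x ∈ Set.Ici t
  · have hx' : t ≤ x := hx
    rw [Set.indicator_of_mem hx, Complex.norm_real, Real.norm_eq_abs,
      abs_of_nonneg (inv_nonneg.2 (Real.sqrt_nonneg _))]
    refine inv_anti₀ (Real.sqrt_pos.2 hpos) (Real.sqrt_le_sqrt ?_)
    have : Real.exp (-x) ≤ Real.exp (-t) := Real.exp_le_exp.2 (by linarith)
    linarith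
  · rw [Set.indicator_of_notMem hx, norm_zero]
    exact inv_nonneg.2 (Real.sqrt_nonneg _)

/-- Cut off operators `E(t, ∞) A E(t, ∞)` lie in `𝔄(ℂ^p)` when `t > 0`. -/
theorem sandwich_E_mem (p : ℕ) {t : ℝ} (ht : 0 < t) (A : BH p) : sandwich (E p t) A ∈ Alg p := by
  have key : ∀ᵐ x ∂halfLine, (sqrtFun_memLp.toLp _ : Lp ℂ ∞ halfLine) x *
      ((invSqrtFun_memLp ht).toLp _ : Lp ℂ ∞ halfLine) x =
      ((indicatorFun_memLp t).toLp _ : Lp ℂ ∞ halfLine) x := by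
    filter_upwards [sqrtFun_memLp.coeFn_toLp, (invSqrtFun_memLp ht).coeFn_toLp,
      (indicatorFun_memLp t).coeFn_toLp] with x h1 h2 h3
    rw [h1, h2, h3]
    by_cases hx : x ∈ Set.Ici t
    · have hx' : t ≤ x := hx
      have : 0 < 1 - Real.exp (-x) := by
        have : Real.exp (-x) < 1 := Real.exp_zero ▸ Real.exp_lt_exp.2 (by linarith)
        linarith
      rw [Set.indicator_of_mem hx, Set.indicator_of_mem hx, ← Complex.ofReal_mul,
        mul_inv_cancel₀ (Real.sqrt_pos.2 this).ne', Complex.ofReal_one]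
    · rw [Set.indicator_of_notMem hx, Set.indicator_of_notMem hx, mul_zero]
  let T : BH p := mulOp p ((invSqrtFun_memLp ht).toLp _)
  have e1 : sqrtOp p ∘L T = E p t := mulOp_comp p _ _ _ key
  have e2 : T ∘L sqrtOp p = E p t := mulOp_comp p _ _ _ (by
    filter_upwards [key] with x hx
    rw [mul_comm, hx])
  exact ⟨T ∘L A ∘L T, sandwich_factor e1 e2 A⟩

open Classical in
/-- `A ↦ A|_t = E(t, ∞) A E(t, ∞)`, as a linear map from `B(H)` to `𝔄(ℂ^p)`, for `t > 0`
(only used for `t > 0`; set to be zero otherwise). -/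
def cutoff (p : ℕ) (t : ℝ) : BH p →ₗ[ℂ] Alg p :=
  if ht : 0 < t then (sandwich (E p t)).codRestrict (Alg p) (sandwich_E_mem p ht) else 0

/-! ### Positivity notions -/

/-- A linear map `φ : B(E) → B(F)` is completely positive if
`∑ (f_i, φ(A_i^* A_j) f_j) ≥ 0` for all finite families. -/
def IsCP {E F : Type} [NormedAddCommGroup E] [InnerProductSpace ℂ E] [CompleteSpace E]
    [NormedAddCommGroup F] [InnerProductSpace ℂ F]
    (φ : (E →L[ℂ] E) →ₗ[ℂ] (F →L[ℂ] F)) : Prop :=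
  ∀ (n : ℕ) (A : Fin n → (E →L[ℂ] E)) (f : Fin n → F),
    0 ≤ ∑ i, ∑ j, ⟪f i, φ (star (A i) * A j) (f j)⟫_ℂ

/-- A linear map `φ` of `B(ℂ^p)` into itself is conditionally positive if it is hermitian and
`∑ (f_i, φ(A_i^* A_j) f_j) ≥ 0` for all finite families with `∑ A_i f_i = 0`. -/
def IsCondPos {p : ℕ} (φ : BK p →ₗ[ℂ] BK p) : Prop :=
  (∀ A, φ (star A) = star (φ A)) ∧
  ∀ (n : ℕ) (A : Fin n → BK p) (f : Fin n → K p), ∑ i, A i (f i) = 0 →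
    0 ≤ ∑ i, ∑ j, ⟪f i, φ (star (A i) * A j) (f j)⟫_ℂ

/-- `φ` is conditionally negative if `-φ` is conditionally positive. -/
def IsCondNeg {p : ℕ} (φ : BK p →ₗ[ℂ] BK p) : Prop := IsCondPos (-φ)

/-- Complete positivity of a linear map from `𝔄(ℂ^p)` to `B(ℂ^p)`: for every `n`, a matrix
`[A_ij]` over `𝔄(ℂ^p)` which is positive as an operator on `H ⊕ ⋯ ⊕ H` is mapped to a matrix
`[ω(A_ij)]` which is positive as an operator on `ℂ^p ⊕ ⋯ ⊕ ℂ^p`. -/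
def IsCPWeight {p : ℕ} (ω : Alg p →ₗ[ℂ] BK p) : Prop :=
  ∀ (n : ℕ) (A : Fin n → Fin n → Alg p),
    (∀ x : Fin n → H p, 0 ≤ ∑ i, ∑ j, ⟪x i, (A i j : BH p) (x j)⟫_ℂ) →
    ∀ f : Fin n → K p, 0 ≤ ∑ i, ∑ j, ⟪f i, ω (A i j) (f j)⟫_ℂ

/-- A linear functional on `B(H)` is σ-weakly continuous (normal) if and only if it is of the form
`A ↦ ∑ (F_k, A G_k)` with `∑ ‖F_k‖² < ∞` and `∑ ‖G_k‖² < ∞`. -/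
def IsNormalFunctional {p : ℕ} (η : BH p →ₗ[ℂ] ℂ) : Prop :=
  ∃ F G : ℕ → H p, Summable (fun k => ‖F k‖ ^ 2) ∧ Summable (fun k => ‖G k‖ ^ 2) ∧
    ∀ A : BH p, HasSum (fun k => ⟪F k, A (G k)⟫_ℂ) (η A)

/-- The linear functional `A ↦ (f, A g)` on `B(ℂ^p)`. -/
def coeffFunctional {p : ℕ} (f g : K p) : BK p →ₗ[ℂ] ℂ where
  toFun A := ⟪f, A g⟫_ℂ
  map_add' A B := by simp
  map_smul' c A := by simp

/-- A linear map `B(H) → B(ℂ^p)` is normal if all functionals `A ↦ (f, φ(A) g)` are. -/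
def IsNormalMap {p : ℕ} (φ : BH p →ₗ[ℂ] BK p) : Prop :=
  ∀ f g : K p, IsNormalFunctional (coeffFunctional f g ∘ₗ φ)

/-- `ω ∈ B(ℂ^p) ⊗ 𝔄(ℂ^p)_*`: for all `f, g`, the functional `η = (f, ω(·) g)` on `𝔄(ℂ^p)` is a
`b`-weight, i.e. `B ↦ η((I - Λ)^{1/2} B (I - Λ)^{1/2})` is σ-weakly continuous on `B(H)`. -/
def IsBWeightMap {p : ℕ} (ω : Alg p →ₗ[ℂ] BK p) : Prop := IsNormalMap (ω ∘ₗ toAlg p)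

/-! ### `q`-weight maps -/

/-- `ω|_t : B(H) → B(ℂ^p)`, `ω|_t(A) = ω(E(t, ∞) A E(t, ∞))`. -/
def restr {p : ℕ} (ω : Alg p →ₗ[ℂ] BK p) (t : ℝ) : BH p →ₗ[ℂ] BK p := ω ∘ₗ cutoff p t

/-- The map `ι + ω|_t Λ` of `B(ℂ^p)` into itself. -/
def onePlus {p : ℕ} (ω : Alg p →ₗ[ℂ] BK p) (t : ℝ) : Module.End ℂ (BK p) :=
  1 + restr ω t ∘ₗ Lam p

/-- The generalized boundary representation `π_t^# = (ι + ω|_t Λ)⁻¹ ω|_t`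
(meaningful when `ι + ω|_t Λ` is invertible). -/
def bdryRep {p : ℕ} (ω : Alg p →ₗ[ℂ] BK p) (t : ℝ) : BH p →ₗ[ℂ] BK p :=
  Ring.inverse (onePlus ω t) ∘ₗ restr ω t

/-- `ω` is a `q`-weight map over `ℂ^p`. -/
structure IsQWeightMap {p : ℕ} (ω : Alg p →ₗ[ℂ] BK p) : Prop where
  bWeight : IsBWeightMap ω
  cp : IsCPWeight ω
  invertible : ∀ t : ℝ, 0 < t → IsUnit (onePlus ω t)
  rep_cp : ∀ t : ℝ, 0 < t → IsCP (bdryRep ω t)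
  rep_contractive : ∀ t : ℝ, 0 < t → ∀ A : BH p, ‖bdryRep ω t A‖ ≤ ‖A‖
  rep_normal : ∀ t : ℝ, 0 < t → IsNormalMap (bdryRep ω t)

/-- `ω` is unital: `ω(I - Λ) = I`. -/
def IsUnital {p : ℕ} (ω : Alg p →ₗ[ℂ] BK p) : Prop := ω (oneSubLam p) = 1

/-- `π₀` is the normal spine of `ω`: the normal completely positive map with
`π_t^#|_s(A) → π₀|_s(A)` as `t → 0+` for each `s > 0` and `A ∈ B(H)`. The target `B(ℂ^p)` is finite
dimensional, so that σ-strong convergence is convergence in norm. -/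
structure IsNormalSpine {p : ℕ} (ω : Alg p →ₗ[ℂ] BK p) (π₀ : BH p →ₗ[ℂ] BK p) : Prop where
  cp : IsCP π₀
  normal : IsNormalMap π₀
  tendsto : ∀ s : ℝ, 0 < s → ∀ A : BH p,
    Tendsto (fun t => bdryRep ω t (sandwich (E p s) A)) (𝓝[>] 0) (𝓝 (π₀ (sandwich (E p s) A)))

/-- `ω` is of index zero: its normal spine is zero. -/
def IsIndexZero {p : ℕ} (ω : Alg p →ₗ[ℂ] BK p) : Prop := IsNormalSpine ω 0

/-- `ω ≥_q η`: the `q`-weight map `η` is a `q`-subordinate of the `q`-weight map `ω`. -/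
structure IsQSubordinate {p : ℕ} (η ω : Alg p →ₗ[ℂ] BK p) : Prop where
  left : IsQWeightMap η
  right : IsQWeightMap ω
  cp : ∀ t : ℝ, 0 < t → IsCP (bdryRep ω t - bdryRep η t)

/-! ### The decomposition of `ϑ` -/

open Classical in
/-- The class in `H` of a square integrable function (zero if it is not square integrable). -/
def toH (p : ℕ) (F : ℝ → K p) : H p := if hF : MemLp F 2 halfLine then hF.toLp else 0

/-- The vector `(I - Λ)^{1/2} (g_i + h_i)` of `H`, where `g_i(x) = g(x) e_i`, so that
`(g_i)_j = δ_ij g`, for the scalar function `g ∈ L²_+(0, ∞)` and `h_i ∈ H`. -/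
def weightedVec {p : ℕ} (g : ℝ → ℂ) (h : Fin p → H p) (i : Fin p) : H p :=
  toH p (fun x => EuclideanSpace.single i (((Real.sqrt (1 - Real.exp (-x)) : ℝ) : ℂ) * g x)) +
    sqrtOp p (h i)

/-- `w_t = ∑_k (g_k, Λ|_t g_k)`. -/
def wt {J : Type} (g : J → ℝ → ℂ) (t : ℝ) : ℝ :=
  ∑' k, ∫ x in Set.Ici t, Real.exp (-x) * ‖g k x‖ ^ 2

/-- The pair `(ϑ, ρ)` is given by families `g_k ∈ L²_+(0, ∞)`, `h_ik ∈ ℂ^p ⊗ L²(0, ∞)` through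
`ϑ_ij(A) = ∑_k (g_ik + h_ik, A (g_jk + h_jk))` and `ρ_ij(A) = ∑_k (h_ik, A h_jk)`.

For `F, G ∈ ℂ^p ⊗ L²_+(0, ∞)` and `A = (I - Λ)^{1/2} B (I - Λ)^{1/2}` in `𝔄(ℂ^p)`, the pairing
`(F, A G)` is `((I - Λ)^{1/2} F, B (I - Λ)^{1/2} G)`. As `ρ` is bounded, it is viewed as a map on
all of `B(H)`. -/
structure IsLimitingForm {p : ℕ} {J : Type} (g : J → ℝ → ℂ) (h : J → Fin p → H p)
    (ϑ : Alg p →ₗ[ℂ] BK p) (ρ : BH p →ₗ[ℂ] BK p) : Prop where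
  /-- each `g_k` is in `L²_+(0, ∞)` -/
  g_mem : ∀ k, AEStronglyMeasurable (g k) halfLine ∧
    Integrable (fun x => (1 - Real.exp (-x)) * ‖g k x‖ ^ 2) halfLine
  /-- `∑_i (h_ik)_i(x) = 0` -/
  h_trace : ∀ k, ∀ᵐ x ∂halfLine, ∑ i, h k i x i = 0
  /-- `ϑ_ij(A) = ∑_k (g_ik + h_ik, A (g_jk + h_jk))` -/
  theta_eq : ∀ (B : BH p) (i j : Fin p),
    HasSum (fun k => ⟪weightedVec (g k) (h k) i, B (weightedVec (g k) (h k) j)⟫_ℂ)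
      (ϑ (toAlg p B) (EuclideanSpace.single j 1) i)
  /-- `ρ_ij(A) = ∑_k (h_ik, A h_jk)` -/
  rho_eq : ∀ (A : BH p) (i j : Fin p),
    HasSum (fun k => ⟪h k i, A (h k j)⟫_ℂ) (ρ A (EuclideanSpace.single j 1) i)
  /-- `ρ` is bounded -/
  rho_bdd : ∃ C : ℝ, ∀ A, ‖ρ A‖ ≤ C * ‖A‖
  /-- `∑_k ‖h_ik‖² < ∞` -/
  h_summable : ∀ i, Summable fun k => ‖h k i‖ ^ 2
  /-- `∑_k (g_k, (I - Λ) g_k) < ∞` -/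
  g_summable : Summable fun k => ∫ x, (1 - Real.exp (-x)) * ‖g k x‖ ^ 2 ∂halfLine
  /-- `1 / w_t → 0` as `t → 0+` -/
  wt_tendsto : Tendsto (wt g) (𝓝[>] 0) atTop

/-- The conditions on the coefficient map `ψ` relative to `ϑ` and `ρ`. -/
structure IsCoefficientMap {p : ℕ} (ϑ : Alg p →ₗ[ℂ] BK p) (ρ : BH p →ₗ[ℂ] BK p)
    (ψ : BK p ≃ₗ[ℂ] BK p) : Prop where
  condNeg : IsCondNeg (ψ : BK p →ₗ[ℂ] BK p)
  inv_cp : IsCP (ψ.symm : BK p →ₗ[ℂ] BK p)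
  /-- `ψ(I) ≥ ϑ(I - Λ)` -/
  le_one : ϑ (oneSubLam p) ≤ ψ 1
  /-- `ψ + ρΛ` is conditionally negative -/
  condNeg_add : IsCondNeg ((ψ : BK p →ₗ[ℂ] BK p) + ρ ∘ₗ Lam p)

/-- `ψ⁻¹ϑ` -/
def invComp {p : ℕ} (ψ : BK p ≃ₗ[ℂ] BK p) (ϑ : Alg p →ₗ[ℂ] BK p) : Alg p →ₗ[ℂ] BK p :=
  (ψ.symm : BK p →ₗ[ℂ] BK p) ∘ₗ ϑ

end QWeight

end

/-! Everything rests on one expansion, `IsPreLimitingForm.restr_Lam`. The operator f ↦ f ⊗ g_k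
intertwines each A in B(ℂ^p) with A ⊗ I, so ϑ|_tΛ(A) = w_t A + A Y_t + Y_t^* A + ρ|_tΛ(A). The part
A ↦ aA + AY + Y^*A is neutral for conditional negativity (`condNeg_affineMul`), and Y_t = o(w_t)
because the h_ik are square summable (`IsPreLimitingForm.norm_crossOp_le`).

For part (2), π_t^# = (ψ + ϑ|_tΛ)⁻¹ ϑ|_t, and the expansion shows that ψ + ϑ|_tΛ is conditionally
negative. A minimum principle (`CondNeg.blockForm_nonneg`, `CondNeg.exists_equiv`) says that such a
map has a completely positive inverse as soon as it is strictly positive at one strictly positive X;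
here X = ψ⁻¹(I). The inequality ψ(I) ≥ ϑ(I - Λ) gives contractivity. Since w_t⁻¹(ψ + ϑ|_tΛ) → ι,
also w_t(ψ + ϑ|_tΛ)⁻¹ → ι. This yields index zero, and it identifies ψ' - ψ as the limit of
w_t(π_t^# - π_t'^#)Λ, which decides subordination. Full range follows in the same way from
w_t⁻¹ϑ|_tΛ → ι.

For part (1), T_t = (ι + ω|_tΛ)⁻¹ = ι - π_t^#Λ is conditionally negative, and T_t → 0 by index zero
and full range. By compactness of the unit sphere, normalized operators c_t T_t converge along an
ultrafilter to some ψ ≠ 0; put ϑ = ψω. As T_t ω|_s(A) = π_t^#(A|_s) for t ≤ s, positivity properties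
of π_t^# pass to ϑ and ψ.

The shape (a) of ϑ comes from its Kraus vectors. The operator matrix p⁻¹[e_ij] is a projection whose
range consists of families (g e_i)_i. The functional `defect` measures the complementary part: it
vanishes on ι and is nonnegative on completely positive maps. A bound uniform in s for the defect of
ϑ|_s (`IsCP.defect_cutoff_le`, `IsNormalizedLimit.defect_le`) forces the complementary parts of the
Kraus vectors to be (I - Λ)^{1/2}h_ik with h_ik square summable. Finally w_t → ∞: otherwise ψ(ι +
ω|_tΛ) would be uniformly bounded, and applying it to T_t x → 0 would give ψ = 0. Divergence of w_t
in turn makes ψ onto. -/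

noncomputable section

namespace QWeight

/-! ### Operator matrices and completely positive maps. -/

section Block

set_option linter.unusedSectionVars false

variable {E F G : Type} [NormedAddCommGroup E] [InnerProductSpace ℂ E] [CompleteSpace E]
  [NormedAddCommGroup F] [InnerProductSpace ℂ F] [CompleteSpace F]
  [NormedAddCommGroup G] [InnerProductSpace ℂ G] [CompleteSpace G]

/-- The quadratic form of an operator matrix. -/
def blockForm {n : ℕ} (m : Fin n → Fin n → E →L[ℂ] E) (x : Fin n → E) : ℂ :=
  ∑ i, ∑ j, ⟪x i, m i j (x j)⟫_ℂ

/-- The operator on `E ⊕ ⋯ ⊕ E` with a given matrix. -/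
def blockOp {n : ℕ} (m : Fin n → Fin n → E →L[ℂ] E) :
    PiLp 2 (fun _ : Fin n => E) →L[ℂ] PiLp 2 (fun _ : Fin n => E) :=
  ∑ i, ∑ j, ContinuousLinearMap.adjoint (PiLp.proj 2 (fun _ : Fin n => E) i : _ →L[ℂ] E) ∘L
    m i j ∘L (PiLp.proj 2 (fun _ : Fin n => E) j : _ →L[ℂ] E)

theorem inner_blockOp {n : ℕ} (m : Fin n → Fin n → E →L[ℂ] E)
    (x y : PiLp 2 (fun _ : Fin n => E)) :
    ⟪x, blockOp m y⟫_ℂ = ∑ i, ∑ j, ⟪x i, m i j (y j)⟫_ℂ := by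
  simp only [blockOp, sum_apply, inner_sum, ContinuousLinearMap.comp_apply,
    ContinuousLinearMap.adjoint_inner_right]
  rfl

theorem nonneg_of_inner_nonneg {T : E →L[ℂ] E} (h : ∀ x, 0 ≤ ⟪x, T x⟫_ℂ) : 0 ≤ T := by
  rw [ContinuousLinearMap.nonneg_iff_isPositive, ContinuousLinearMap.isPositive_iff_complex]
  intro x
  have hx := h x
  rw [← inner_conj_symm, Complex.nonneg_iff] at hx
  simp only [Complex.conj_re, Complex.conj_im] at hx
  refine ⟨?_, hx.1⟩
  apply Complex.ext
  · simp
  · simp only [RCLike.re_to_complex, Complex.ofReal_im]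
    linarith [hx.2]

theorem inner_nonneg_of_nonneg {T : E →L[ℂ] E} (h : 0 ≤ T) (x : E) : 0 ≤ ⟪x, T x⟫_ℂ :=
  ((ContinuousLinearMap.nonneg_iff_isPositive T).1 h).inner_nonneg_right x

theorem exists_star_mul_self_of_form {T : E →L[ℂ] E} (h : ∀ x, 0 ≤ ⟪x, T x⟫_ℂ) :
    ∃ b : E →L[ℂ] E, T = star b * b :=
  CStarAlgebra.nonneg_iff_eq_star_mul_self.1 (nonneg_of_inner_nonneg h)

theorem inner_star_mul (A B : E →L[ℂ] E) (x y : E) :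
    ⟪x, (star A * B) y⟫_ℂ = ⟪A x, B y⟫_ℂ := by
  rw [mul_apply_eq_comp, ContinuousLinearMap.star_eq_adjoint,
    ContinuousLinearMap.adjoint_inner_right]

theorem blockForm_star_mul {n : ℕ} (A : Fin n → E →L[ℂ] E) (x : Fin n → E) :
    blockForm (fun i j => star (A i) * A j) x = ⟪∑ i, A i (x i), ∑ i, A i (x i)⟫_ℂ := by
  simp only [blockForm, inner_star_mul, sum_inner, inner_sum]
  rw [Finset.sum_comm]

theorem inner_self_eq_ofReal (x : E) : ⟪x, x⟫_ℂ = ((‖x‖ ^ 2 : ℝ) : ℂ) := by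
  rw [inner_self_eq_norm_sq_to_K, Complex.ofReal_pow]
  rfl

theorem blockForm_star_mul_nonneg {n : ℕ} (A : Fin n → E →L[ℂ] E) (x : Fin n → E) :
    0 ≤ blockForm (fun i j => star (A i) * A j) x := by
  rw [blockForm_star_mul, inner_self_eq_ofReal, Complex.zero_le_real]
  positivity

/-- A positive operator matrix is a sum of matrices of the form `[A_i^* A_j]`. -/
theorem exists_block_factor {n : ℕ} {m : Fin n → Fin n → E →L[ℂ] E}
    (h : ∀ x, 0 ≤ blockForm m x) :
    ∃ R : Fin n → Fin n → E →L[ℂ] E, ∀ i j, m i j = ∑ k, star (R k i) * R k j := by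
  obtain ⟨b, hb⟩ := exists_star_mul_self_of_form (T := blockOp m) fun x => by
    rw [inner_blockOp]
    exact h fun i => x i
  let ι : Fin n → E → PiLp 2 (fun _ : Fin n => E) := fun i x => WithLp.toLp 2 (Pi.single i x)
  let J : Fin n → E →L[ℂ] PiLp 2 (fun _ : Fin n => E) := fun i =>
    ContinuousLinearMap.adjoint (PiLp.proj 2 (fun _ : Fin n => E) i : _ →L[ℂ] E)
  have hJ : ∀ i x k, (J i x) k = (Pi.single i x : Fin n → E) k := by
    intro i x k
    refine congrArg (fun z : PiLp 2 (fun _ : Fin n => E) => z k) (?_ : J i x = ι i x)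
    refine ext_inner_left ℂ fun w => ?_
    rw [ContinuousLinearMap.adjoint_inner_right, PiLp.inner_apply, Finset.sum_eq_single i]
    · simp [ι]
    · intro l _ hl
      simp [ι, Pi.single_eq_of_ne hl]
    · simp
  refine ⟨fun k i => (PiLp.proj 2 (fun _ : Fin n => E) k : _ →L[ℂ] E) ∘L b ∘L J i,
    fun i j => ?_⟩
  ext y
  refine ext_inner_left ℂ fun x => ?_
  have h1 : ⟪J i x, blockOp m (J j y)⟫_ℂ = ⟪x, m i j y⟫_ℂ := by
    rw [inner_blockOp, Finset.sum_eq_single i, Finset.sum_eq_single j]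
    · simp [hJ]
    · intro l _ hl
      simp [hJ, Pi.single_eq_of_ne hl]
    · simp
    · intro l _ hl
      simp [hJ, Pi.single_eq_of_ne hl]
    · simp
  rw [← h1, hb, inner_star_mul, PiLp.inner_apply, sum_apply, inner_sum]
  refine Finset.sum_congr rfl fun k _ => ?_
  rw [inner_star_mul]
  rfl

/-- `IsCP` tests only matrices [A_i^* A_j]. Writing a positive matrix as R^*R and splitting R into
rows reduces the general case to those, which is what makes composition of completely positive maps
work. -/
theorem IsCP.blockForm_nonneg {φ : (E →L[ℂ] E) →ₗ[ℂ] (F →L[ℂ] F)} (hφ : IsCP φ) {n : ℕ}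
    {m : Fin n → Fin n → E →L[ℂ] E} (h : ∀ x, 0 ≤ blockForm m x) (f : Fin n → F) :
    0 ≤ blockForm (fun i j => φ (m i j)) f := by
  obtain ⟨R, hR⟩ := exists_block_factor h
  have : blockForm (fun i j => φ (m i j)) f =
      ∑ k, ∑ i, ∑ j, ⟪f i, φ (star (R k i) * R k j) (f j)⟫_ℂ := by
    rw [Finset.sum_comm]
    refine Finset.sum_congr rfl fun i _ => ?_
    rw [Finset.sum_comm]
    refine Finset.sum_congr rfl fun j _ => ?_
    beta_reduce
    rw [hR, map_sum, sum_apply, inner_sum]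
  rw [this]
  exact Finset.sum_nonneg fun k _ => hφ n (R k) f

theorem IsCP.nonneg {φ : (E →L[ℂ] E) →ₗ[ℂ] (F →L[ℂ] F)} (hφ : IsCP φ) {A : E →L[ℂ] E}
    (hA : 0 ≤ A) : 0 ≤ φ A := by
  refine nonneg_of_inner_nonneg fun x => ?_
  obtain ⟨b, rfl⟩ := CStarAlgebra.nonneg_iff_eq_star_mul_self.1 hA
  simpa using hφ 1 (fun _ => b) (fun _ => x)

theorem IsCP.mono {φ : (E →L[ℂ] E) →ₗ[ℂ] (F →L[ℂ] F)} (hφ : IsCP φ) {A B : E →L[ℂ] E}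
    (hA : A ≤ B) : φ A ≤ φ B := by
  rw [← sub_nonneg, ← map_sub]
  exact hφ.nonneg (sub_nonneg.2 hA)

/-- For the family (1, A) the form is real and its diagonal terms are real, so the sum of the two
cross terms is real. Replacing g by ig gives the remaining half of the identity. -/
theorem IsCP.map_star {φ : (E →L[ℂ] E) →ₗ[ℂ] (F →L[ℂ] F)} (hφ : IsCP φ) (A : E →L[ℂ] E) :
    φ (star A) = star (φ A) := by
  have key : ∀ f g : F, (⟪f, φ A g⟫_ℂ + ⟪g, φ (star A) f⟫_ℂ).im = 0 := by
    intro f g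
    have h := (Complex.nonneg_iff.1 (hφ 2 ![1, A] ![f, g])).2
    have h1 := (Complex.nonneg_iff.1 (inner_nonneg_of_nonneg
      (hφ.nonneg (A := 1) zero_le_one) f)).2
    have h2 := (Complex.nonneg_iff.1 (inner_nonneg_of_nonneg
      (hφ.nonneg (star_mul_self_nonneg A)) g)).2
    simp only [Fin.sum_univ_two, Matrix.cons_val_zero, Matrix.cons_val_one, star_one, one_mul,
      mul_one, Complex.add_im] at h
    rw [Complex.add_im]
    linarith
  ext g
  refine ext_inner_left ℂ fun f => ?_
  rw [ContinuousLinearMap.star_eq_adjoint (φ A), ContinuousLinearMap.adjoint_inner_right,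
    ← inner_conj_symm (φ A f)]
  have h1 := key g f
  have h2 := key (Complex.I • g) f
  simp only [inner_smul_left, inner_smul_right, map_smul, Complex.conj_I, Complex.add_im,
    Complex.mul_im, Complex.neg_re, Complex.neg_im, Complex.I_re, Complex.I_im] at h1 h2
  apply Complex.ext
  · rw [Complex.conj_re]
    linarith
  · rw [Complex.conj_im]
    linarith

/-- For ‖A‖ ≤ 1, positivity on the family (1, A) at the vectors (-f, g), with φ(1) ≤ 1 and φ(A^*A) ≤
1, gives Re⟨f, φ(A)g⟩ ≤ (‖f‖² + ‖g‖²)/2. -/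
theorem IsCP.norm_le {φ : (E →L[ℂ] E) →ₗ[ℂ] (F →L[ℂ] F)} (hφ : IsCP φ) (h1 : φ 1 ≤ 1)
    (A : E →L[ℂ] E) : ‖φ A‖ ≤ ‖A‖ := by
  have unit : ∀ A : E →L[ℂ] E, ‖A‖ ≤ 1 → ‖φ A‖ ≤ 1 := by
    intro A hA
    have hAA : star A * A ≤ 1 := by
      rw [← sub_nonneg]
      refine nonneg_of_inner_nonneg fun x => ?_
      rw [sub_apply, inner_sub_right, inner_star_mul, one_apply_eq_self,
        inner_self_eq_ofReal, inner_self_eq_ofReal, sub_nonneg, Complex.real_le_real]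
      have := A.le_of_opNorm_le hA x
      rw [one_mul] at this
      gcongr
    have re_le : ∀ f g : F, (⟪f, φ A g⟫_ℂ).re ≤ (‖f‖ ^ 2 + ‖g‖ ^ 2) / 2 := by
      intro f g
      have h := (Complex.nonneg_iff.1 (hφ 2 ![1, A] ![-f, g])).1
      have hf := (Complex.le_def.1 (inner_nonneg_of_nonneg (sub_nonneg.2 h1) f)).1
      have hg := (Complex.le_def.1 (inner_nonneg_of_nonneg
        (sub_nonneg.2 ((hφ.mono hAA).trans h1)) g)).1
      simp only [sub_apply, inner_sub_right, one_apply_eq_self, inner_self_eq_ofReal,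
        Complex.sub_re, Complex.ofReal_re, Complex.zero_re] at hf hg
      have hs : (⟪g, φ (star A) f⟫_ℂ).re = (⟪f, φ A g⟫_ℂ).re := by
        rw [hφ.map_star, ContinuousLinearMap.star_eq_adjoint,
          ContinuousLinearMap.adjoint_inner_right, ← inner_conj_symm, Complex.conj_re]
      simp only [Fin.sum_univ_two, Matrix.cons_val_zero, Matrix.cons_val_one, star_one, one_mul,
        mul_one, Complex.add_re, inner_neg_left, inner_neg_right, map_neg, neg_neg,
        Complex.neg_re, hs] at h
      linarith
    refine ContinuousLinearMap.opNorm_le_bound _ zero_le_one fun g => ?_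
    rw [one_mul]
    by_cases hz : φ A g = 0
    · rw [hz, norm_zero]
      exact norm_nonneg g
    · have hpos : 0 < ‖φ A g‖ := norm_pos_iff.2 hz
      by_contra! hlt
      -- The vector f is φ(A)g rescaled to the norm of g, which is the optimal choice.
      have := re_le (((‖g‖ / ‖φ A g‖ : ℝ) : ℂ) • φ A g) g
      rw [inner_smul_left, Complex.conj_ofReal, inner_self_eq_ofReal, norm_smul,
        Complex.norm_real, Real.norm_eq_abs, abs_of_nonneg (by positivity),
        div_mul_cancel₀ _ hpos.ne'] at this
      rw [← Complex.ofReal_mul, Complex.ofReal_re] at this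
      have e : ‖g‖ / ‖φ A g‖ * ‖φ A g‖ ^ 2 = ‖g‖ * ‖φ A g‖ := by field_simp
      rw [e] at this
      rcases (norm_nonneg g).eq_or_lt with h0 | h0
      · have : g = 0 := norm_eq_zero.1 h0.symm
        simp [this] at hz
      · nlinarith
  by_cases hA : A = 0
  · simp [hA]
  · have hpos : 0 < ‖A‖ := norm_pos_iff.2 hA
    have h := unit (((‖A‖⁻¹ : ℝ) : ℂ) • A) (by
      rw [norm_smul, Complex.norm_real, norm_inv, norm_norm, inv_mul_cancel₀ hpos.ne'])
    rwa [map_smul, norm_smul, Complex.norm_real, norm_inv, norm_norm, inv_mul_le_iff₀ hpos,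
      mul_one] at h

theorem IsCP.add {φ ψ : (E →L[ℂ] E) →ₗ[ℂ] (F →L[ℂ] F)} (hφ : IsCP φ) (hψ : IsCP ψ) :
    IsCP (φ + ψ) := by
  intro n A f
  simpa [inner_add_right, Finset.sum_add_distrib] using add_nonneg (hφ n A f) (hψ n A f)

theorem IsCP.smul {φ : (E →L[ℂ] E) →ₗ[ℂ] (F →L[ℂ] F)} (hφ : IsCP φ) {c : ℝ} (hc : 0 ≤ c) :
    IsCP ((c : ℂ) • φ) := by
  intro n A f
  have := mul_nonneg (Complex.zero_le_real.2 hc) (hφ n A f)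
  simpa [inner_smul_right, Finset.mul_sum] using this

theorem IsCP.comp {ψ : (F →L[ℂ] F) →ₗ[ℂ] (G →L[ℂ] G)} {φ : (E →L[ℂ] E) →ₗ[ℂ] (F →L[ℂ] F)}
    (hψ : IsCP ψ) (hφ : IsCP φ) : IsCP (ψ ∘ₗ φ) := by
  intro n A f
  exact hψ.blockForm_nonneg (m := fun i j => φ (star (A i) * A j)) (fun x => hφ n A x) f

theorem isCP_zero : IsCP (0 : (E →L[ℂ] E) →ₗ[ℂ] (F →L[ℂ] F)) := by
  intro n A f
  simp

theorem isCP_one : IsCP (LinearMap.id : (E →L[ℂ] E) →ₗ[ℂ] (E →L[ℂ] E)) := by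
  intro n A f
  exact blockForm_star_mul_nonneg A f

theorem isCP_of_factor {φ : (E →L[ℂ] E) →ₗ[ℂ] (F →L[ℂ] F)} (C : (E →L[ℂ] E) → (F →L[ℂ] F))
    (h : ∀ A B, φ (star A * B) = star (C A) * C B) : IsCP φ := by
  intro n A f
  simp only [h]
  exact blockForm_star_mul_nonneg (fun i => C (A i)) f

theorem isCP_of_tendsto {α : Type*} {l : Filter α} [l.NeBot]
    {φ : α → (E →L[ℂ] E) →ₗ[ℂ] (F →L[ℂ] F)} {φ₀ : (E →L[ℂ] E) →ₗ[ℂ] (F →L[ℂ] F)}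
    (hφ : ∀ᶠ a in l, IsCP (φ a)) (h : ∀ A, Tendsto (fun a => φ a A) l (𝓝 (φ₀ A))) : IsCP φ₀ := by
  intro n A f
  have : Tendsto (fun a => ∑ i, ∑ j, ⟪f i, φ a (star (A i) * A j) (f j)⟫_ℂ) l
      (𝓝 (∑ i, ∑ j, ⟪f i, φ₀ (star (A i) * A j) (f j)⟫_ℂ)) := by
    refine tendsto_finsetSum _ fun i _ => tendsto_finsetSum _ fun j _ => ?_
    exact tendsto_const_nhds.inner  (((ContinuousLinearMap.apply ℂ F (f j)).continuous.tendsto _).comp (h _))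
  have : OrderClosedTopology ℂ := Complex.orderClosedTopology
  refine ge_of_tendsto ‹Tendsto _ _ _› ?_
  filter_upwards [hφ] with a ha
  exact ha n A f

end Block

/-! ### Conditionally negative maps and the minimum principle. -/

section CondNeg

set_option linter.unusedSectionVars false

variable {V : Type} [NormedAddCommGroup V] [InnerProductSpace ℂ V] [CompleteSpace V]

/-- Conditional negativity of a linear map on the bounded operators of a Hilbert space. -/
def CondNeg (φ : (V →L[ℂ] V) →ₗ[ℂ] (V →L[ℂ] V)) : Prop :=
  (∀ A, φ (star A) = star (φ A)) ∧
  ∀ (n : ℕ) (A : Fin n → (V →L[ℂ] V)) (f : Fin n → V), ∑ i, A i (f i) = 0 →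
    0 ≤ -∑ i, ∑ j, ⟪f i, φ (star (A i) * A j) (f j)⟫_ℂ

theorem CondNeg.add {φ ψ : (V →L[ℂ] V) →ₗ[ℂ] (V →L[ℂ] V)} (hφ : CondNeg φ) (hψ : CondNeg ψ) :
    CondNeg (φ + ψ) := by
  refine ⟨fun A => ?_, fun n A f h => ?_⟩
  · rw [LinearMap.add_apply, LinearMap.add_apply, star_add, hφ.1, hψ.1]
  · have := add_nonneg (hφ.2 n A f h) (hψ.2 n A f h)
    rw [← neg_add] at this
    simpa only [LinearMap.add_apply, add_apply, inner_add_right, Finset.sum_add_distrib] using this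

theorem CondNeg.sub_isCP {φ ψ : (V →L[ℂ] V) →ₗ[ℂ] (V →L[ℂ] V)} (hφ : CondNeg φ)
    (hψ : IsCP ψ) : CondNeg (φ - ψ) := by
  refine ⟨fun A => ?_, fun n A f h => ?_⟩
  · rw [LinearMap.sub_apply, LinearMap.sub_apply, star_sub, hφ.1, hψ.map_star]
  · have := add_nonneg (hφ.2 n A f h) (hψ n A f)
    rw [neg_add_eq_sub, ← neg_sub] at this
    simpa only [LinearMap.sub_apply, sub_apply, inner_sub_right, Finset.sum_sub_distrib] using this

theorem CondNeg.smul {φ : (V →L[ℂ] V) →ₗ[ℂ] (V →L[ℂ] V)} (hφ : CondNeg φ) {c : ℝ}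
    (hc : 0 ≤ c) : CondNeg ((c : ℂ) • φ) := by
  refine ⟨fun A => ?_, fun n A f h => ?_⟩
  · rw [LinearMap.smul_apply, LinearMap.smul_apply, hφ.1, star_smul, Complex.star_def,
      Complex.conj_ofReal]
  · have := mul_nonneg (Complex.zero_le_real.2 hc) (hφ.2 n A f h)
    simpa [inner_smul_right, Finset.mul_sum] using this

theorem condNeg_of_tendsto {α : Type*} {l : Filter α} [l.NeBot]
    {φ : α → (V →L[ℂ] V) →ₗ[ℂ] (V →L[ℂ] V)} {φ₀ : (V →L[ℂ] V) →ₗ[ℂ] (V →L[ℂ] V)}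
    (hφ : ∀ᶠ a in l, CondNeg (φ a)) (h : ∀ A, Tendsto (fun a => φ a A) l (𝓝 (φ₀ A))) :
    CondNeg φ₀ := by
  refine ⟨fun A => ?_, fun n A f hA => ?_⟩
  · refine tendsto_nhds_unique_of_eventuallyEq (h (star A)) (h A).star ?_
    filter_upwards [hφ] with a ha
    exact ha.1 A
  · have : Tendsto (fun a => -∑ i, ∑ j, ⟪f i, φ a (star (A i) * A j) (f j)⟫_ℂ) l
        (𝓝 (-∑ i, ∑ j, ⟪f i, φ₀ (star (A i) * A j) (f j)⟫_ℂ)) := by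
      refine (tendsto_finsetSum _ fun i _ => tendsto_finsetSum _ fun j _ => ?_).neg
      exact tendsto_const_nhds.inner
        (((ContinuousLinearMap.apply ℂ V (f j)).continuous.tendsto _).comp (h _))
    have : OrderClosedTopology ℂ := Complex.orderClosedTopology
    refine ge_of_tendsto ‹Tendsto _ _ _› ?_
    filter_upwards [hφ] with a ha
    exact ha.2 n A f hA

/-- The map `A ↦ a A + A Y + Y^* A`. -/
def affineMul (a : ℝ) (Y : (V →L[ℂ] V)) : (V →L[ℂ] V) →ₗ[ℂ] (V →L[ℂ] V) where
  toFun A := (a : ℂ) • A + A * Y + star Y * A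
  map_add' A B := by
    rw [smul_add, add_mul, mul_add]
    abel
  map_smul' c A := by
    rw [smul_add, smul_add, RingHom.id_apply, smul_comm, smul_mul_assoc, mul_smul_comm]

theorem affineMul_apply (a : ℝ) (Y A : (V →L[ℂ] V)) :
    affineMul a Y A = (a : ℂ) • A + A * Y + star Y * A := rfl

/-- Each of the three terms of the form contains a factor ∑ A_i f_i = 0, so the form vanishes. Such
maps can therefore be added to or subtracted from a conditionally negative map. -/
theorem condNeg_affineMul (a : ℝ) (Y : (V →L[ℂ] V)) : CondNeg (affineMul a Y) := by
  refine ⟨fun A => ?_, fun n A f hA => le_of_eq ?_⟩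
  · simp only [affineMul_apply, star_add, star_mul, star_smul, star_star, Complex.star_def,
      Complex.conj_ofReal]
    abel
  · have h1 : ∀ i j, ⟪f i, affineMul a Y (star (A i) * A j) (f j)⟫_ℂ =
        (a : ℂ) * ⟪A i (f i), A j (f j)⟫_ℂ + ⟪A i (f i), A j (Y (f j))⟫_ℂ +
          ⟪A i (Y (f i)), A j (f j)⟫_ℂ := by
      intro i j
      have e : star Y * (star (A i) * A j) = star (A i * Y) * A j := by
        rw [star_mul, mul_assoc]
      have e' : star (A i) * A j * Y = star (A i) * (A j * Y) := mul_assoc _ _ _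
      rw [affineMul_apply, e, e', add_apply, add_apply,
        smul_apply, inner_add_right, inner_add_right, inner_smul_right,
        inner_star_mul, inner_star_mul, inner_star_mul]
      rfl
    simp only [h1, Finset.sum_add_distrib, ← Finset.mul_sum,
      ← inner_sum, ← sum_inner, hA, inner_zero_left, inner_zero_right, Finset.sum_const_zero]
    simp

theorem condNeg_one : CondNeg (LinearMap.id : (V →L[ℂ] V) →ₗ[ℂ] (V →L[ℂ] V)) := by
  have : (LinearMap.id : (V →L[ℂ] V) →ₗ[ℂ] (V →L[ℂ] V)) = affineMul 1 0 := by
    ext1 A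
    simp [affineMul_apply]
  rw [this]
  exact condNeg_affineMul 1 0

theorem blockForm_sub {n : ℕ} (m m' : Fin n → Fin n → (V →L[ℂ] V)) (x : Fin n → V) :
    blockForm (fun i j => m i j - m' i j) x = blockForm m x - blockForm m' x := by
  simp [blockForm]

theorem blockForm_diag {n : ℕ} (X : (V →L[ℂ] V)) (x : Fin n → V) :
    blockForm (fun i j => if i = j then X else 0) x = ∑ i, ⟪x i, X (x i)⟫_ℂ := by
  refine Finset.sum_congr rfl fun i _ => ?_
  rw [Finset.sum_eq_single i]
  · simp
  · intro j _ hj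
    simp [hj.symm]
  · simp

theorem blockForm_smul {n : ℕ} (m : Fin n → Fin n → (V →L[ℂ] V)) (c : ℝ) (x : Fin n → V) :
    blockForm m (fun i => (c : ℂ) • x i) = ((c ^ 2 : ℝ) : ℂ) * blockForm m x := by
  simp only [blockForm, map_smul, inner_smul_left, inner_smul_right, Complex.conj_ofReal,
    Finset.mul_sum]
  refine Finset.sum_congr rfl fun i _ => Finset.sum_congr rfl fun j _ => ?_
  push_cast
  ring

theorem blockForm_im_eq_zero {n : ℕ} {m : Fin n → Fin n → (V →L[ℂ] V)}
    (hm : ∀ i j, star (m i j) = m j i) (x : Fin n → V) : (blockForm m x).im = 0 := by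
  rw [← Complex.conj_eq_iff_im, blockForm, map_sum]
  simp only [map_sum]
  rw [Finset.sum_comm]
  refine Finset.sum_congr rfl fun i _ => Finset.sum_congr rfl fun j _ => ?_
  rw [← hm i j, inner_conj_symm, ContinuousLinearMap.star_eq_adjoint,
    ContinuousLinearMap.adjoint_inner_left]

/-- A minimum principle for conditionally negative maps. -/
theorem CondNeg.blockForm_nonneg [FiniteDimensional ℂ V] {Φ : (V →L[ℂ] V) →ₗ[ℂ] (V →L[ℂ] V)} (hΦ : CondNeg Φ) {X : (V →L[ℂ] V)}
    (hX : ∀ x, x ≠ 0 → 0 < ⟪x, X x⟫_ℂ) (hΦX : ∀ x, x ≠ 0 → 0 < ⟪x, Φ X x⟫_ℂ) {n : ℕ}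
    {m : Fin n → Fin n → (V →L[ℂ] V)} (hm : ∀ i j, star (m i j) = m j i)
    (h : ∀ f, 0 ≤ blockForm (fun i j => Φ (m i j)) f) (f : Fin n → V) :
    0 ≤ blockForm m f := by
  by_contra hf
  have : ProperSpace V := FiniteDimensional.proper ℂ V
  have sum_pos : ∀ {Z : (V →L[ℂ] V)}, (∀ x, x ≠ 0 → 0 < ⟪x, Z x⟫_ℂ) → ∀ x : Fin n → V, x ≠ 0 →
      0 < ∑ i, ⟪x i, Z (x i)⟫_ℂ := by
    intro Z hZ x hx
    obtain ⟨i, hi⟩ := Function.ne_iff.1 hx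
    refine Finset.sum_pos' (fun j _ => ?_) ⟨i, Finset.mem_univ i, hZ _ hi⟩
    by_cases hj : x j = 0
    · simp [hj]
    · exact (hZ _ hj).le
  let q : (Fin n → V) → ℝ := fun x => (blockForm m x).re
  let r : (Fin n → V) → ℝ := fun x => (∑ i, ⟪x i, X (x i)⟫_ℂ).re
  have hr : ∀ x, x ≠ 0 → 0 < r x := fun x hx => (Complex.pos_iff.1 (sum_pos hX x hx)).1
  have him := blockForm_im_eq_zero hm
  have hqf : q f < 0 := by
    by_contra! hq
    exact hf (Complex.nonneg_iff.2 ⟨hq, (him f).symm⟩)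
  have hf0 : f ≠ 0 := by
    rintro rfl
    simp [q, blockForm] at hqf
  have hqc : Continuous q := by
    refine Complex.continuous_re.comp ?_
    unfold blockForm
    fun_prop
  have hrc : Continuous r := by
    refine Complex.continuous_re.comp ?_
    fun_prop
  have hq2 : ∀ (c : ℝ) x, q (fun i => (c : ℂ) • x i) = c ^ 2 * q x := by
    intro c x
    simp only [q]
    rw [blockForm_smul, Complex.re_ofReal_mul]
  have hr2 : ∀ (c : ℝ) x, r (fun i => (c : ℂ) • x i) = c ^ 2 * r x := by
    intro c x
    simp only [r]
    rw [← blockForm_diag, ← blockForm_diag, blockForm_smul, Complex.re_ofReal_mul]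
  have hunit : ∀ x : Fin n → V, x ≠ 0 →
      (fun i => ((‖x‖⁻¹ : ℝ) : ℂ) • x i) ∈ Metric.sphere (0 : Fin n → V) 1 := by
    intro x hx
    have e : (fun i => ((‖x‖⁻¹ : ℝ) : ℂ) • x i) = ((‖x‖⁻¹ : ℝ) : ℂ) • x := rfl
    rw [mem_sphere_zero_iff_norm, e, norm_smul, Complex.norm_real, norm_inv, norm_norm,
      inv_mul_cancel₀ (norm_ne_zero_iff.2 hx)]
  have hS0 : ∀ x ∈ Metric.sphere (0 : Fin n → V) 1, x ≠ 0 := by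
    rintro x hx rfl
    simp at hx
  -- The form of m is minimized relative to the strictly positive form of X ⊗ I; the minimum l is
  -- negative if m is not positive.
  obtain ⟨x₀, hx₀, hmin⟩ := (isCompact_sphere (0 : Fin n → V) 1).exists_isMinOn
    ⟨_, hunit f hf0⟩ (f := fun x => q x / r x)
    (hqc.continuousOn.div hrc.continuousOn fun x hx => (hr x (hS0 x hx)).ne')
  set l : ℝ := q x₀ / r x₀ with hl
  have hx₀0 := hS0 x₀ hx₀
  have hle : ∀ x, x ≠ 0 → l * r x ≤ q x := by
    intro x hx
    have h1 : l ≤ _ := hmin (hunit x hx)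
    have hn : 0 < ‖x‖⁻¹ ^ 2 := by
      have := norm_pos_iff.2 hx
      positivity
    simp only [hq2, hr2] at h1
    rw [mul_div_mul_left _ _ hn.ne', le_div_iff₀ (hr x hx)] at h1
    exact h1
  have hl0 : l < 0 := by
    have h1 := hle f hf0
    by_contra! h2
    have := mul_nonneg h2 (hr f hf0).le
    linarith
  -- Subtracting l X on the diagonal makes the matrix positive, with x₀ a null vector. Its factors
  -- R_k then satisfy ∑ R_kj x₀_j = 0, exactly the constraint in conditional negativity.
  let D : Fin n → Fin n → (V →L[ℂ] V) := fun i j => if i = j then (l : ℂ) • X else 0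
  have hD : ∀ x, blockForm D x = (l : ℂ) * ∑ i, ⟪x i, X (x i)⟫_ℂ := by
    intro x
    rw [blockForm_diag, Finset.mul_sum]
    simp
  have him' : ∀ x : Fin n → V, (∑ i, ⟪x i, X (x i)⟫_ℂ).im = 0 := by
    intro x
    by_cases hx : x = 0
    · simp [hx]
    · exact (Complex.pos_iff.1 (sum_pos hX x hx)).2.symm
  have hpos : ∀ x, 0 ≤ blockForm (fun i j => m i j - D i j) x := by
    intro x
    rw [blockForm_sub, hD, Complex.nonneg_iff, Complex.sub_re, Complex.sub_im,
      Complex.re_ofReal_mul, Complex.im_ofReal_mul, him, him']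
    refine ⟨?_, by simp⟩
    by_cases hx : x = 0
    · simp [hx, blockForm]
    · exact sub_nonneg.2 (hle x hx)
  have hzero : blockForm (fun i j => m i j - D i j) x₀ = 0 := by
    rw [blockForm_sub, hD]
    apply Complex.ext
    · rw [Complex.sub_re, Complex.re_ofReal_mul, hl]
      exact sub_eq_zero.2 (div_mul_cancel₀ (q x₀) (hr x₀ hx₀0).ne').symm
    · rw [Complex.sub_im, Complex.im_ofReal_mul, him, him']
      simp
  obtain ⟨R, hR⟩ := exists_block_factor hpos
  have hsum : ∀ k, ∑ j, R k j (x₀ j) = 0 := by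
    have e : blockForm (fun i j => m i j - D i j) x₀ =
        ∑ k, blockForm (fun i j => star (R k i) * R k j) x₀ := by
      simp only [blockForm, hR, sum_apply, inner_sum]
      rw [Finset.sum_comm (γ := Fin n) (s := Finset.univ) (t := Finset.univ)
        (f := fun k i => ∑ j, ⟪x₀ i, (star (R k i) * R k j) (x₀ j)⟫_ℂ)]
      exact Finset.sum_congr rfl fun i _ => Finset.sum_comm
    rw [hzero, eq_comm,
      Finset.sum_eq_zero_iff_of_nonneg fun k _ => blockForm_star_mul_nonneg (R k) x₀] at e
    intro k
    have := e k (Finset.mem_univ k)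
    rwa [blockForm_star_mul, inner_self_eq_zero] at this
  -- This contradicts the expansion by linearity: the form of Φ(m) is nonnegative at x₀, and -l
  -- times the form of Φ(X) is strictly positive.
  have hneg : 0 ≤ -blockForm (fun i j => Φ (m i j - D i j)) x₀ := by
    have e : -blockForm (fun i j => Φ (m i j - D i j)) x₀ =
        ∑ k, -∑ i, ∑ j, ⟪x₀ i, Φ (star (R k i) * R k j) (x₀ j)⟫_ℂ := by
      rw [Finset.sum_neg_distrib, neg_inj]
      rw [Finset.sum_comm, blockForm]
      refine Finset.sum_congr rfl fun i _ => ?_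
      rw [Finset.sum_comm]
      refine Finset.sum_congr rfl fun j _ => ?_
      rw [hR, ← inner_sum, ← sum_apply, ← map_sum]
    rw [e]
    exact Finset.sum_nonneg fun k _ => hΦ.2 n (R k) x₀ (hsum k)
  have e : blockForm (fun i j => Φ (m i j - D i j)) x₀ =
      blockForm (fun i j => Φ (m i j)) x₀ - (l : ℂ) * ∑ i, ⟪x₀ i, Φ X (x₀ i)⟫_ℂ := by
    simp only [map_sub]
    rw [blockForm_sub]
    congr 1
    have : (fun i j => Φ (D i j)) = fun i j => if i = j then (l : ℂ) • Φ X else 0 := by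
      funext i j
      by_cases hij : i = j <;> simp [D, hij]
    rw [this, blockForm_diag, Finset.mul_sum]
    simp
  rw [e] at hneg
  have h1 := (Complex.nonneg_iff.1 hneg).1
  have h2 := (Complex.nonneg_iff.1 (h x₀)).1
  have h3 := (Complex.pos_iff.1 (sum_pos hΦX x₀ hx₀0)).1
  rw [Complex.neg_re, Complex.sub_re, Complex.re_ofReal_mul] at h1
  nlinarith

theorem CondNeg.map_star {Φ : (V →L[ℂ] V) →ₗ[ℂ] (V →L[ℂ] V)} (hΦ : CondNeg Φ) (A : (V →L[ℂ] V)) :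
    Φ (star A) = star (Φ A) := hΦ.1 A

/-- For a selfadjoint A in the kernel the minimum principle applies to both A and -A, so its
quadratic form vanishes. The general case follows by taking real and imaginary parts. -/
theorem CondNeg.injective [FiniteDimensional ℂ V] {Φ : (V →L[ℂ] V) →ₗ[ℂ] (V →L[ℂ] V)} (hΦ : CondNeg Φ) {X : (V →L[ℂ] V)}
    (hX : ∀ x, x ≠ 0 → 0 < ⟪x, X x⟫_ℂ) (hΦX : ∀ x, x ≠ 0 → 0 < ⟪x, Φ X x⟫_ℂ) :
    Function.Injective Φ := by
  have nonneg : ∀ A, star A = A → Φ A = 0 → ∀ x, 0 ≤ ⟪x, A x⟫_ℂ := by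
    intro A hA h0 x
    have := hΦ.blockForm_nonneg hX hΦX (n := 1) (m := fun _ _ => A) (fun _ _ => hA)
      (fun f => by simp [blockForm, h0]) (fun _ => x)
    simpa [blockForm] using this
  have sa : ∀ A, star A = A → Φ A = 0 → A = 0 := by
    intro A hA h0
    ext1 x
    refine LinearMap.congr_fun ((inner_map_self_eq_zero (A : V →ₗ[ℂ] V)).1 fun x => ?_) x
    have h1 := nonneg A hA h0 x
    have h2 := nonneg (-A) (by rw [star_neg, hA]) (by rw [map_neg, h0, neg_zero]) x
    rw [neg_apply, inner_neg_right, Left.nonneg_neg_iff] at h2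
    rw [← inner_conj_symm]
    exact (map_eq_zero _).2 (le_antisymm h2 h1)
  rw [injective_iff_map_eq_zero]
  intro A hA
  have hA' : Φ (star A) = 0 := by rw [hΦ.map_star, hA, star_zero]
  have h1 := sa (A + star A) (by rw [star_add, star_star, add_comm])
    (by rw [map_add, hA, hA', add_zero])
  have h2 := sa (Complex.I • (A - star A))
    (by rw [star_smul, star_sub, star_star, Complex.star_def, Complex.conj_I, neg_smul,
      ← smul_neg, neg_sub])
    (by rw [map_smul, map_sub, hA, hA', sub_zero, smul_zero])
  rw [smul_eq_zero, or_iff_right Complex.I_ne_zero, sub_eq_zero] at h2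
  rw [← h2, ← two_smul ℂ, smul_eq_zero, or_iff_right two_ne_zero] at h1
  exact h1

/-- A conditionally negative map which is strictly positive at some strictly positive `X` is
invertible with completely positive inverse. -/
theorem CondNeg.exists_equiv [FiniteDimensional ℂ V] {Φ : (V →L[ℂ] V) →ₗ[ℂ] (V →L[ℂ] V)} (hΦ : CondNeg Φ) {X : (V →L[ℂ] V)}
    (hX : ∀ x, x ≠ 0 → 0 < ⟪x, X x⟫_ℂ) (hΦX : ∀ x, x ≠ 0 → 0 < ⟪x, Φ X x⟫_ℂ) :
    ∃ e : (V →L[ℂ] V) ≃ₗ[ℂ] (V →L[ℂ] V), (e : (V →L[ℂ] V) →ₗ[ℂ] (V →L[ℂ] V)) = Φ ∧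
      IsCP (e.symm : (V →L[ℂ] V) →ₗ[ℂ] (V →L[ℂ] V)) := by
  have hinj := hΦ.injective hX hΦX
  let e := LinearEquiv.ofInjectiveEndo Φ hinj
  have he : ∀ A, Φ (e.symm A) = A := fun A => e.apply_symm_apply A
  refine ⟨e, rfl, fun n A f => ?_⟩
  refine hΦ.blockForm_nonneg hX hΦX (m := fun i j => e.symm (star (A i) * A j)) (fun i j => ?_)
    (fun f => ?_) f
  · apply hinj
    rw [hΦ.map_star, he, he, star_mul, star_star]
  · simp only [he]
    exact blockForm_star_mul_nonneg A f

end CondNeg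

theorem isCondNeg_iff {p : ℕ} {φ : BK p →ₗ[ℂ] BK p} : IsCondNeg φ ↔ CondNeg φ := by
  have h : ∀ (n : ℕ) (A : Fin n → BK p) (f : Fin n → K p),
      ∑ i, ∑ j, ⟪f i, (-φ) (star (A i) * A j) (f j)⟫_ℂ =
        -∑ i, ∑ j, ⟪f i, φ (star (A i) * A j) (f j)⟫_ℂ := by
    intro n A f
    simp only [LinearMap.neg_apply, neg_apply, inner_neg_right, Finset.sum_neg_distrib]
  have hs : ∀ A : BK p, (-φ) (star A) = star ((-φ) A) ↔ φ (star A) = star (φ A) := by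
    intro A
    rw [LinearMap.neg_apply, LinearMap.neg_apply, (star_neg (φ A) : star (-φ A) = -star (φ A)),
      neg_inj]
  simp only [IsCondNeg, IsCondPos, CondNeg, h, hs]

/-! ### Normal functionals and the Kraus decomposition. -/

section Normal

variable {E F : Type} [NormedAddCommGroup E] [InnerProductSpace ℂ E] [CompleteSpace E]
  [NormedAddCommGroup F] [InnerProductSpace ℂ F] [CompleteSpace F]

set_option linter.unusedSectionVars false

/-- A normal functional on the bounded operators of a Hilbert space, with an arbitrary index
type. -/
def NormalFun (η : (E →L[ℂ] E) →ₗ[ℂ] ℂ) : Prop :=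
  ∃ (J : Type) (F G : J → E), Summable (fun k => ‖F k‖ ^ 2) ∧ Summable (fun k => ‖G k‖ ^ 2) ∧
    ∀ A : E →L[ℂ] E, HasSum (fun k => ⟪F k, A (G k)⟫_ℂ) (η A)

theorem summable_norm_mul_norm {J : Type} {F G : J → E} (hF : Summable fun k => ‖F k‖ ^ 2)
    (hG : Summable fun k => ‖G k‖ ^ 2) : Summable fun k => ‖F k‖ * ‖G k‖ := by
  refine Summable.of_nonneg_of_le (fun k => by positivity) (fun k => ?_) (hF.add hG)
  nlinarith [sq_nonneg (‖F k‖ - ‖G k‖), sq_nonneg (‖F k‖), sq_nonneg ‖G k‖]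

theorem norm_inner_apply_le (A : E →L[ℂ] E) (x y : E) :
    ‖⟪x, A y⟫_ℂ‖ ≤ ‖A‖ * (‖x‖ * ‖y‖) := by
  calc ‖⟪x, A y⟫_ℂ‖ ≤ ‖x‖ * ‖A y‖ := norm_inner_le_norm _ _
    _ ≤ ‖x‖ * (‖A‖ * ‖y‖) := by gcongr; exact A.le_opNorm y
    _ = _ := by ring

theorem NormalFun.add {η ζ : (E →L[ℂ] E) →ₗ[ℂ] ℂ} (hη : NormalFun η) (hζ : NormalFun ζ) :
    NormalFun (η + ζ) := by
  obtain ⟨J, F, G, hF, hG, h⟩ := hη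
  obtain ⟨J', F', G', hF', hG', h'⟩ := hζ
  refine ⟨J ⊕ J', Sum.elim F F', Sum.elim G G', ?_, ?_, fun A => ?_⟩
  · exact (HasSum.sum (f := fun k => ‖Sum.elim F F' k‖ ^ 2) hF.hasSum hF'.hasSum).summable
  · exact (HasSum.sum (f := fun k => ‖Sum.elim G G' k‖ ^ 2) hG.hasSum hG'.hasSum).summable
  · exact HasSum.sum (f := fun k => ⟪Sum.elim F F' k, A (Sum.elim G G' k)⟫_ℂ) (h A) (h' A)

theorem normalFun_zero : NormalFun (0 : (E →L[ℂ] E) →ₗ[ℂ] ℂ) :=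
  ⟨Empty, fun _ => 0, fun _ => 0, summable_empty, summable_empty, fun _ => by
    simp⟩

theorem NormalFun.smul {η : (E →L[ℂ] E) →ₗ[ℂ] ℂ} (hη : NormalFun η) (c : ℂ) :
    NormalFun (c • η) := by
  obtain ⟨J, F, G, hF, hG, h⟩ := hη
  refine ⟨J, F, fun k => c • G k, hF, ?_, fun A => ?_⟩
  · simpa only [norm_smul, mul_pow] using hG.mul_left (‖c‖ ^ 2)
  · simpa [inner_smul_right] using (h A).mul_left c

theorem normalFun_sum {ι : Type*} (s : Finset ι) {η : ι → (E →L[ℂ] E) →ₗ[ℂ] ℂ}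
    (h : ∀ i ∈ s, NormalFun (η i)) : NormalFun (∑ i ∈ s, η i) :=
  Finset.sum_induction η NormalFun (fun _ _ => NormalFun.add) normalFun_zero h

theorem NormalFun.compress {η : (E →L[ℂ] E) →ₗ[ℂ] ℂ} (hη : NormalFun η)
    {ζ : (F →L[ℂ] F) →ₗ[ℂ] ℂ} (X : F →L[ℂ] E) (Y : E →L[ℂ] F)
    (h : ∀ A, ζ A = η (X ∘L A ∘L Y)) : NormalFun ζ := by
  obtain ⟨J, F, G, hF, hG, hsum⟩ := hη
  refine ⟨J, fun k => ContinuousLinearMap.adjoint X (F k), fun k => Y (G k), ?_, ?_, fun A => ?_⟩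
  · refine Summable.of_nonneg_of_le (fun k => by positivity) (fun k => ?_)
      (hF.mul_left (‖ContinuousLinearMap.adjoint X‖ ^ 2))
    rw [← mul_pow]
    gcongr
    exact ContinuousLinearMap.le_opNorm _ _
  · refine Summable.of_nonneg_of_le (fun k => by positivity) (fun k => ?_)
      (hG.mul_left (‖Y‖ ^ 2))
    rw [← mul_pow]
    gcongr
    exact ContinuousLinearMap.le_opNorm _ _
  · rw [h]
    simpa only [ContinuousLinearMap.adjoint_inner_left, ContinuousLinearMap.comp_apply] using
      hsum (X ∘L A ∘L Y)

theorem NormalFun.tendsto {η : (E →L[ℂ] E) →ₗ[ℂ] ℂ} (hη : NormalFun η) {α : Type*}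
    {l : Filter α} {A : α → E →L[ℂ] E} {A₀ : E →L[ℂ] E} {C : ℝ} (hC : ∀ᶠ a in l, ‖A a‖ ≤ C)
    (h : ∀ x, Tendsto (fun a => A a x) l (𝓝 (A₀ x))) :
    Tendsto (fun a => η (A a)) l (𝓝 (η A₀)) := by
  obtain ⟨J, F, G, hF, hG, hsum⟩ := hη
  simp only [← (hsum _).tsum_eq]
  refine tendsto_tsum_of_dominated_convergence
    ((summable_norm_mul_norm hF hG).mul_left C) (fun k => tendsto_const_nhds.inner (h _)) ?_
  filter_upwards [hC] with a ha k
  refine (norm_inner_apply_le _ _ _).trans ?_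
  gcongr

theorem NormalFun.exists_bound {η : (E →L[ℂ] E) →ₗ[ℂ] ℂ} (hη : NormalFun η) :
    ∃ C, ∀ A, ‖η A‖ ≤ C * ‖A‖ := by
  obtain ⟨J, F, G, hF, hG, hsum⟩ := hη
  refine ⟨∑' k, ‖F k‖ * ‖G k‖, fun A => ?_⟩
  rw [← (hsum A).tsum_eq, mul_comm, ← tsum_mul_left]
  exact tsum_of_norm_bounded ((summable_norm_mul_norm hF hG).mul_left ‖A‖).hasSum
    fun k => norm_inner_apply_le A _ _

/-- The finite sums of the one dimensional projections given by a Hilbert basis. -/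
def basisProj {ι : Type*} (b : HilbertBasis ι ℂ E) (s : Finset ι) : E →L[ℂ] E :=
  ∑ i ∈ s, InnerProductSpace.rankOne ℂ (b i) (b i)

theorem basisProj_apply {ι : Type*} (b : HilbertBasis ι ℂ E) (s : Finset ι) (x : E) :
    basisProj b s x = ∑ i ∈ s, ⟪b i, x⟫_ℂ • b i := by
  simp [basisProj]

theorem tendsto_basisProj {ι : Type*} (b : HilbertBasis ι ℂ E) (x : E) :
    Tendsto (fun s => basisProj b s x) atTop (𝓝 x) := by
  simp only [basisProj_apply, ← b.repr_apply_apply]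
  exact b.hasSum_repr x

theorem norm_basisProj_le {ι : Type*} (b : HilbertBasis ι ℂ E) (s : Finset ι) :
    ‖basisProj b s‖ ≤ 1 := by
  refine ContinuousLinearMap.opNorm_le_bound _ zero_le_one fun x => ?_
  rw [one_mul]
  refine le_of_sq_le_sq ?_ (norm_nonneg x)
  have h := b.orthonormal.sum_inner_products_le (s := s) x
  refine le_trans (le_of_eq ?_) h
  have h2 := b.orthonormal.inner_sum (fun i => ⟪b i, x⟫_ℂ) (fun i => ⟪b i, x⟫_ℂ) s
  rw [← basisProj_apply, inner_self_eq_ofReal] at h2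
  have h3 : ((‖basisProj b s x‖ ^ 2 : ℝ) : ℂ) = ((∑ i ∈ s, ‖⟪b i, x⟫_ℂ‖ ^ 2 : ℝ) : ℂ) := by
    rw [h2]
    push_cast
    refine Finset.sum_congr rfl fun i _ => ?_
    exact RCLike.conj_mul _
  exact_mod_cast h3

/-- Normal functionals are determined by their values on operators of rank one. -/
theorem NormalFun.ext_rankOne {η ζ : (E →L[ℂ] E) →ₗ[ℂ] ℂ} (hη : NormalFun η)
    (hζ : NormalFun ζ) (h : ∀ x y : E, η (InnerProductSpace.rankOne ℂ x y) =
      ζ (InnerProductSpace.rankOne ℂ x y)) : η = ζ := by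
  obtain ⟨w, b, -⟩ := exists_hilbertBasis ℂ E
  ext A
  -- The operators A P_s have finite rank, are bounded by ‖A‖ and converge strongly to A, which
  -- suffices for normal functionals.
  have e : ∀ s, A ∘L basisProj b s = ∑ i ∈ s, InnerProductSpace.rankOne ℂ (A (b i)) (b i) := by
    intro s
    ext x
    simp [basisProj_apply]
  have hlim : ∀ {ξ : (E →L[ℂ] E) →ₗ[ℂ] ℂ}, NormalFun ξ →
      Tendsto (fun s => ξ (A ∘L basisProj b s)) atTop (𝓝 (ξ A)) := by
    intro ξ hξ
    refine hξ.tendsto (C := ‖A‖) (Eventually.of_forall fun s => ?_) fun x => ?_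
    · calc _ ≤ ‖A‖ * ‖basisProj b s‖ := ContinuousLinearMap.opNorm_comp_le _ _
        _ ≤ ‖A‖ * 1 := by gcongr; exact norm_basisProj_le b s
        _ = _ := mul_one _
    · exact (A.continuous.tendsto x).comp (tendsto_basisProj b x)
  refine tendsto_nhds_unique (hlim hη) ((hlim hζ).congr fun s => ?_)
  rw [e, map_sum, map_sum]
  exact Finset.sum_congr rfl fun i _ => (h _ _).symm

/-- A positive normal functional is a sum of vector functionals. -/
theorem NormalFun.exists_vectors {η : (E →L[ℂ] E) →ₗ[ℂ] ℂ} (hη : NormalFun η)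
    (hpos : ∀ x : E, 0 ≤ η (InnerProductSpace.rankOne ℂ x x)) :
    ∃ (J : Type) (_ : Countable J) (V : J → E), Summable (fun k => ‖V k‖ ^ 2) ∧
      ∀ A, HasSum (fun k => ⟪V k, A (V k)⟫_ℂ) (η A) := by
  obtain ⟨C, hC⟩ := hη.exists_bound
  obtain ⟨J, F, G, hF, hG, hsum⟩ := id hη
  have hsR : Summable fun k => (InnerProductSpace.rankOne ℂ (G k) (F k) : E →L[ℂ] E) := by
    refine Summable.of_norm_bounded (summable_norm_mul_norm hG hF) fun k => ?_
    exact (InnerProductSpace.norm_rankOne _ _).le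
  -- R is the density operator of η. The vectors sought are the images of a Hilbert basis under its
  -- square root.
  set R : E →L[ℂ] E := ∑' k, InnerProductSpace.rankOne ℂ (G k) (F k) with hR
  have hRi : ∀ x y, ⟪x, R y⟫_ℂ = η (InnerProductSpace.rankOne ℂ y x) := by
    intro x y
    have h1 := (hsR.hasSum.mapL (ContinuousLinearMap.apply ℂ E y)).mapL (innerSL ℂ x)
    have h2 := hsum (InnerProductSpace.rankOne ℂ y x)
    rw [show (fun k => ⟪F k, InnerProductSpace.rankOne ℂ y x (G k)⟫_ℂ) = fun k => innerSL ℂ x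
      (ContinuousLinearMap.apply ℂ E y (InnerProductSpace.rankOne ℂ (G k) (F k))) from
      funext fun k => by
        rw [ContinuousLinearMap.apply_apply, innerSL_apply_apply, InnerProductSpace.rankOne_apply,
          InnerProductSpace.rankOne_apply, inner_smul_right, inner_smul_right, mul_comm]] at h2
    exact h1.unique h2
  have hRpos : 0 ≤ R := nonneg_of_inner_nonneg fun x => by
    rw [hRi]
    exact hpos x
  set b : E →L[ℂ] E := CFC.sqrt R with hb
  have hbb : b * b = R := CFC.sqrt_mul_sqrt_self R hRpos
  have hbs : star b = b := (IsSelfAdjoint.of_nonneg (CFC.sqrt_nonneg R)).star_eq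
  have hbi : ∀ x y, ⟪b x, b y⟫_ℂ = η (InnerProductSpace.rankOne ℂ y x) := by
    intro x y
    rw [← inner_star_mul, hbs, hbb, hRi]
  obtain ⟨w, e, -⟩ := exists_hilbertBasis ℂ E
  -- A partial sum is η evaluated at a finite rank projection of norm at most one, hence bounded.
  have hV : Summable fun k => ‖b (e k)‖ ^ 2 := by
    refine summable_of_sum_le (c := |C| * 1) (fun k => by positivity) fun s => ?_
    have h1 : ((∑ k ∈ s, ‖b (e k)‖ ^ 2 : ℝ) : ℂ) = η (basisProj e s) := by
      rw [basisProj, map_sum]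
      push_cast
      refine Finset.sum_congr rfl fun k _ => ?_
      rw [← hbi, inner_self_eq_ofReal]
      push_cast
      rfl
    have h2 := hC (basisProj e s)
    rw [← h1, Complex.norm_real, Real.norm_of_nonneg (Finset.sum_nonneg fun k _ => by positivity)]
      at h2
    refine h2.trans ?_
    gcongr
    · exact le_abs_self C
    · exact norm_basisProj_le e s
  have hζ : ∀ A : E →L[ℂ] E, Summable fun k => ⟪b (e k), A (b (e k))⟫_ℂ := by
    intro A
    exact Summable.of_norm_bounded ((summable_norm_mul_norm hV hV).mul_left ‖A‖)
      fun k => norm_inner_apply_le _ _ _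
  let ζ : (E →L[ℂ] E) →ₗ[ℂ] ℂ :=
    { toFun := fun A => ∑' k, ⟪b (e k), A (b (e k))⟫_ℂ
      map_add' := fun A B => by
        rw [← (hζ A).tsum_add (hζ B)]
        simp only [add_apply, inner_add_right]
      map_smul' := fun c A => by
        simp only [smul_apply, inner_smul_right, tsum_mul_left, RingHom.id_apply, smul_eq_mul] }
  have hζn : NormalFun ζ := ⟨w, fun k => b (e k), fun k => b (e k), hV, hV, fun A =>
    (hζ A).hasSum⟩
  -- On rank one operators the equality is Parseval's identity for ⟨b y, b x⟩.
  have hηζ : η = ζ := by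
    refine hη.ext_rankOne hζn fun x y => ?_
    have h1 := e.hasSum_inner_mul_inner (b y) (b x)
    rw [hbi] at h1
    have hsw : ∀ u v, ⟪b u, v⟫_ℂ = ⟪u, b v⟫_ℂ := by
      intro u v
      nth_rw 2 [← hbs]
      rw [ContinuousLinearMap.star_eq_adjoint, ContinuousLinearMap.adjoint_inner_right]
    rw [show (fun k => ⟪b y, e k⟫_ℂ * ⟪e k, b x⟫_ℂ) = fun k => ⟪b (e k),
      InnerProductSpace.rankOne ℂ x y (b (e k))⟫_ℂ from funext fun k => by
        rw [InnerProductSpace.rankOne_apply, inner_smul_right, hsw, hsw, mul_comm]] at h1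
    exact h1.unique (hζ (InnerProductSpace.rankOne ℂ x y)).hasSum
  -- The Hilbert basis may be uncountable, but a summable family has countable support.
  have hcount : (Function.support fun k => ‖b (e k)‖ ^ 2).Countable := hV.countable_support
  set S := Function.support fun k => ‖b (e k)‖ ^ 2 with hS
  have hS0 : ∀ k, k ∉ S → b (e k) = 0 := by
    intro k hk
    simpa [hS] using hk
  refine ⟨S, hcount.to_subtype, fun k => b (e k), hV.subtype S, fun A => ?_⟩
  rw [hηζ]
  refine (hasSum_subtype_iff_of_support_subset ?_).2 (hζ A).hasSum
  intro k hk
  by_contra hk'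
  simp [hS0 k hk'] at hk

/-- Only countably many F_k are nonzero, so the nonzero terms can be enumerated in ℕ and extended by
zero. -/
theorem NormalFun.isNormalFunctional {p : ℕ} {η : BH p →ₗ[ℂ] ℂ} (hη : NormalFun η) :
    IsNormalFunctional η := by
  obtain ⟨J, F, G, hF, hG, hsum⟩ := hη
  have hcount : (Function.support fun k => ‖F k‖ ^ 2).Countable := hF.countable_support
  set S := Function.support fun k => ‖F k‖ ^ 2 with hS
  have hS0 : ∀ k, k ∉ S → F k = 0 := by
    intro k hk
    simpa [hS] using hk
  have := hcount.to_subtype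
  have := Encodable.ofCountable S
  have hi : Function.Injective (Encodable.encode : S → ℕ) := Encodable.encode_injective
  have hext : ∀ (X : Type) [AddCommMonoid X] [TopologicalSpace X] (f : H p → H p → X) (hf : f 0 0 = 0),
      (fun n => f (Function.extend Encodable.encode (fun k : S => F k) 0 n)
        (Function.extend Encodable.encode (fun k : S => G k) 0 n)) =
      Function.extend Encodable.encode (fun k : S => f (F k) (G k)) 0 := by
    intro X _ _ f hf
    funext n
    by_cases hn : ∃ k : S, Encodable.encode k = n
    · obtain ⟨k, rfl⟩ := hn
      rw [hi.extend_apply, hi.extend_apply, hi.extend_apply]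
    · rw [Function.extend_apply' _ _ _ hn, Function.extend_apply' _ _ _ hn,
        Function.extend_apply' _ _ _ hn]
      exact hf
  refine ⟨Function.extend Encodable.encode (fun k : S => F k) 0,
    Function.extend Encodable.encode (fun k : S => G k) 0, ?_, ?_, fun A => ?_⟩
  · rw [hext ℝ (fun x _ => ‖x‖ ^ 2) (by simp)]
    exact ((hasSum_extend_zero hi).2 (hF.subtype S).hasSum).summable
  · rw [hext ℝ (fun _ x => ‖x‖ ^ 2) (by simp)]
    exact ((hasSum_extend_zero hi).2 (hG.subtype S).hasSum).summable
  · rw [hext ℂ (fun x y => ⟪x, A y⟫_ℂ) (by simp)]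
    refine (hasSum_extend_zero hi).2 ((hasSum_subtype_iff_of_support_subset
      (f := fun k => ⟪F k, A (G k)⟫_ℂ) ?_).2 (hsum A))
    intro k hk
    by_contra hk'
    simp [hS0 k hk'] at hk

theorem IsNormalFunctional.normalFun {p : ℕ} {η : BH p →ₗ[ℂ] ℂ} (hη : IsNormalFunctional η) :
    NormalFun η := by
  obtain ⟨F, G, hF, hG, hsum⟩ := hη
  exact ⟨ℕ, F, G, hF, hG, hsum⟩

theorem isNormalFunctional_iff {p : ℕ} {η : BH p →ₗ[ℂ] ℂ} :
    IsNormalFunctional η ↔ NormalFun η :=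
  ⟨IsNormalFunctional.normalFun, NormalFun.isNormalFunctional⟩

/-- The Kraus decomposition of a normal completely positive map into `B(ℂ^p)`, in coordinates. -/
theorem IsCP.exists_kraus {p : ℕ} {φ : (E →L[ℂ] E) →ₗ[ℂ] BK p} (hφ : IsCP φ)
    (hn : ∀ i j : Fin p, NormalFun
      (coeffFunctional (EuclideanSpace.single i 1) (EuclideanSpace.single j 1) ∘ₗ φ)) :
    ∃ (J : Type) (_ : Countable J) (V : J → Fin p → E),
      (∀ i, Summable (fun k => ‖V k i‖ ^ 2)) ∧
      ∀ (A : E →L[ℂ] E) (i j : Fin p), HasSum (fun k => ⟪V k i, A (V k j)⟫_ℂ)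
        ⟪EuclideanSpace.single i 1, φ A (EuclideanSpace.single j 1)⟫_ℂ := by
  let P : Fin p → PiLp 2 (fun _ : Fin p => E) →L[ℂ] E := fun i => PiLp.proj 2 (fun _ => E) i
  let Q : Fin p → E →L[ℂ] PiLp 2 (fun _ : Fin p => E) := fun i => ContinuousLinearMap.adjoint (P i)
  have hPQ : ∀ i x k, P k (Q i x) = (Pi.single i x : Fin p → E) k := by
    intro i x k
    refine congrArg (fun z : PiLp 2 (fun _ : Fin p => E) => z k)
      (?_ : Q i x = WithLp.toLp 2 (Pi.single i x))
    refine ext_inner_left ℂ fun w => ?_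
    rw [ContinuousLinearMap.adjoint_inner_right, PiLp.inner_apply, Finset.sum_eq_single i]
    · simp [P]
    · intro l _ hl
      simp [Pi.single_eq_of_ne hl]
    · simp
  let c : Fin p → Fin p → (PiLp 2 (fun _ : Fin p => E) →L[ℂ] PiLp 2 (fun _ : Fin p => E)) →ₗ[ℂ]
      E →L[ℂ] E := fun i j =>
    { toFun := fun A => P i ∘L A ∘L Q j
      map_add' := fun A B => by rw [ContinuousLinearMap.add_comp, ContinuousLinearMap.comp_add]
      map_smul' := fun a A => by
        rw [ContinuousLinearMap.smul_comp, ContinuousLinearMap.comp_smul, RingHom.id_apply] }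
  let e : Fin p → K p := fun i => EuclideanSpace.single i 1
  -- The functional A ↦ ∑ ⟨e_i, φ(A_ij) e_j⟩ on B(E^p) is normal and positive and encodes all
  -- entries of φ: an operator with a single nonzero block recovers one entry. The components of its
  -- vectors are the Kraus vectors.
  let η : (PiLp 2 (fun _ : Fin p => E) →L[ℂ] PiLp 2 (fun _ : Fin p => E)) →ₗ[ℂ] ℂ :=
    ∑ i, ∑ j, coeffFunctional (e i) (e j) ∘ₗ φ ∘ₗ c i j
  have hηa : ∀ A, η A = ∑ i, ∑ j, ⟪e i, φ (P i ∘L A ∘L Q j) (e j)⟫_ℂ := by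
    intro A
    simp only [η, LinearMap.sum_apply]
    rfl
  have hη : NormalFun η := normalFun_sum _ fun i _ => normalFun_sum _ fun j _ =>
    (hn i j).compress (P i) (Q j) fun A => rfl
  obtain ⟨J, hJ, V, hV, hsum⟩ := hη.exists_vectors fun x => by
    rw [hηa]
    refine hφ.blockForm_nonneg (m := fun i j => P i ∘L InnerProductSpace.rankOne ℂ x x ∘L Q j)
      (fun y => ?_) e
    have h1 : ∀ i j, ⟪y i, (P i ∘L InnerProductSpace.rankOne ℂ x x ∘L Q j) (y j)⟫_ℂ =
        ⟪Q i (y i), x⟫_ℂ * ⟪x, Q j (y j)⟫_ℂ := by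
      intro i j
      rw [ContinuousLinearMap.comp_apply, ContinuousLinearMap.comp_apply,
        InnerProductSpace.rankOne_apply, map_smul, inner_smul_right, mul_comm,
        ContinuousLinearMap.adjoint_inner_left]
    simp only [blockForm, h1]
    simp only [← Finset.mul_sum, ← Finset.sum_mul]
    rw [← inner_sum, ← sum_inner, ← inner_conj_symm]
    exact star_mul_self_nonneg _
  refine ⟨J, hJ, fun k i => V k i, fun i => ?_, fun A i j => ?_⟩
  · refine Summable.of_nonneg_of_le (fun k => by positivity) (fun k => ?_) hV
    gcongr
    exact PiLp.norm_apply_le (V k) i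
  · have h1 := hsum (Q i ∘L A ∘L P j)
    have h2 : η (Q i ∘L A ∘L P j) = ⟪e i, φ A (e j)⟫_ℂ := by
      have h3 : ∀ k l, P k ∘L (Q i ∘L A ∘L P j) ∘L Q l = if k = i then if l = j then A else 0
          else 0 := by
        intro k l
        ext x
        simp only [ContinuousLinearMap.comp_apply, hPQ]
        by_cases hk : k = i <;> by_cases hl : l = j
        · subst hk; subst hl; simp
        · subst hk; simp [hl]
        · simp [hk]
        · simp [hk]
      rw [hηa, Finset.sum_eq_single i, Finset.sum_eq_single j]
      · rw [h3, if_pos rfl, if_pos rfl]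
      · intro l _ hl
        rw [h3, if_pos rfl, if_neg hl]
        simp
      · simp
      · intro l _ hl
        simp only [h3, if_neg hl]
        simp
      · simp
    rw [h2] at h1
    convert h1 using 2 with k
    rw [ContinuousLinearMap.comp_apply, ContinuousLinearMap.comp_apply,
      ContinuousLinearMap.adjoint_inner_right]
    rfl

end Normal

/-! ### Multiplication operators, amplifications and cutoffs on H. -/

section Operators

variable {p : ℕ}

theorem mulOp_toLp_coeFn {m : ℝ → ℂ} (hm : MemLp m ∞ halfLine) (F : H p) :
    mulOp p hm.toLp F =ᵐ[halfLine] fun x => m x • F x := by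
  filter_upwards [mulOp_coeFn p hm.toLp F, hm.coeFn_toLp] with x h1 h2
  rw [h1, h2]

theorem mulOp_mul_mulOp {m₁ m₂ m₃ : ℝ → ℂ} (h₁ : MemLp m₁ ∞ halfLine) (h₂ : MemLp m₂ ∞ halfLine)
    (h₃ : MemLp m₃ ∞ halfLine) (h : ∀ x, 0 < x → m₁ x * m₂ x = m₃ x) :
    mulOp p h₁.toLp * mulOp p h₂.toLp = mulOp p h₃.toLp := by
  refine mulOp_comp p _ _ _ ?_
  filter_upwards [h₁.coeFn_toLp, h₂.coeFn_toLp, h₃.coeFn_toLp, ae_restrict_mem measurableSet_Ioi]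
    with x e1 e2 e3 hx
  rw [e1, e2, e3, h x hx]

theorem star_mulOp {m : ℝ → ℂ} (hm : MemLp m ∞ halfLine)
    (hr : ∀ x, starRingEnd ℂ (m x) = m x) : star (mulOp p hm.toLp) = mulOp p hm.toLp := by
  rw [ContinuousLinearMap.star_eq_adjoint, eq_comm, ContinuousLinearMap.eq_adjoint_iff]
  intro F G
  rw [L2.inner_def, L2.inner_def]
  refine integral_congr_ae ?_
  filter_upwards [mulOp_toLp_coeFn hm F, mulOp_toLp_coeFn hm G] with x h1 h2
  rw [h1, h2, inner_smul_left, inner_smul_right, hr]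

/-- `A ⊗ I`, acting on `ℂ^p`-valued functions. -/
def amp (A : BK p) : BH p := A.compLpL 2 halfLine

theorem amp_coeFn (A : BK p) (F : H p) : amp A F =ᵐ[halfLine] fun x => A (F x) :=
  ContinuousLinearMap.coeFn_compLpL A F

theorem amp_mul (A B : BK p) : amp (A * B) = amp A * amp B := by
  ext1 F
  apply Lp.ext
  filter_upwards [amp_coeFn (A * B) F, amp_coeFn A (amp B F), amp_coeFn B F] with x h1 h2 h3
  rw [h1, mul_apply_eq_comp, mul_apply_eq_comp, h2, h3]

theorem amp_one : amp (1 : BK p) = 1 := by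
  ext1 F
  apply Lp.ext
  filter_upwards [amp_coeFn 1 F] with x h1
  rw [h1, one_apply_eq_self, one_apply_eq_self]

theorem star_amp (A : BK p) : star (amp A) = amp (star A) := by
  rw [ContinuousLinearMap.star_eq_adjoint, eq_comm, ContinuousLinearMap.eq_adjoint_iff]
  intro F G
  rw [L2.inner_def, L2.inner_def]
  refine integral_congr_ae ?_
  filter_upwards [amp_coeFn (star A) F, amp_coeFn A G] with x h1 h2
  rw [h1, h2, ContinuousLinearMap.star_eq_adjoint, ContinuousLinearMap.adjoint_inner_left]

theorem amp_mul_mulOp (A : BK p) {m : ℝ → ℂ} (hm : MemLp m ∞ halfLine) :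
    amp A * mulOp p hm.toLp = mulOp p hm.toLp * amp A := by
  ext1 F
  apply Lp.ext
  rw [mul_apply_eq_comp, mul_apply_eq_comp]
  filter_upwards [amp_coeFn A (mulOp p hm.toLp F), mulOp_toLp_coeFn hm F,
    mulOp_toLp_coeFn hm (amp A F), amp_coeFn A F] with x h1 h2 h3 h4
  rw [h1, h2, h3, h4, map_smul]

/-- `A ↦ A ⊗ I` as a linear map. -/
def ampₗ (p : ℕ) : BK p →ₗ[ℂ] BH p where
  toFun := amp
  map_add' A B := ContinuousLinearMap.add_compLpL A B
  map_smul' c A := ContinuousLinearMap.smul_compLpL c A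

theorem ampₗ_apply (A : BK p) : ampₗ p A = amp A := rfl

theorem Lam_apply (A : BK p) : Lam p A = expOp p * amp A := rfl

theorem amp_mul_expOp (A : BK p) : amp A * expOp p = expOp p * amp A := amp_mul_mulOp A _

theorem amp_mul_sqrtOp (A : BK p) : amp A * sqrtOp p = sqrtOp p * amp A := amp_mul_mulOp A _

theorem amp_mul_E (A : BK p) (t : ℝ) : amp A * E p t = E p t * amp A := amp_mul_mulOp A _

theorem star_E (t : ℝ) : star (E p t) = E p t := star_mulOp _ fun x => by
  by_cases hx : x ∈ Set.Ici t <;> simp [hx]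

theorem star_sqrtOp : star (sqrtOp p) = sqrtOp p := star_mulOp _ fun _ => Complex.conj_ofReal _

theorem star_expOp : star (expOp p) = expOp p := star_mulOp _ fun _ => Complex.conj_ofReal _

theorem E_mul_E_of_le {s t : ℝ} (h : t ≤ s) : E p s * E p t = E p s :=
  mulOp_mul_mulOp _ _ _ fun x _ => by
    by_cases hx : x ∈ Set.Ici s
    · have : x ∈ Set.Ici t := h.trans hx
      simp [hx, this]
    · simp [hx]

theorem E_mul_E (t : ℝ) : E p t * E p t = E p t := E_mul_E_of_le le_rfl

theorem E_mul_E_of_le' {s t : ℝ} (h : t ≤ s) : E p t * E p s = E p s := by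
  have := congrArg star (E_mul_E_of_le (p := p) h)
  rwa [star_mul, star_E, star_E] at this

theorem mulOp_comm {m₁ m₂ : ℝ → ℂ} (h₁ : MemLp m₁ ∞ halfLine) (h₂ : MemLp m₂ ∞ halfLine) :
    mulOp p h₁.toLp * mulOp p h₂.toLp = mulOp p h₂.toLp * mulOp p h₁.toLp := by
  ext1 F
  apply Lp.ext
  rw [mul_apply_eq_comp, mul_apply_eq_comp]
  filter_upwards [mulOp_toLp_coeFn h₁ (mulOp p h₂.toLp F), mulOp_toLp_coeFn h₂ F,
    mulOp_toLp_coeFn h₂ (mulOp p h₁.toLp F), mulOp_toLp_coeFn h₁ F] with x e1 e2 e3 e4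
  rw [e1, e2, e3, e4, smul_comm]

theorem E_mul_sqrtOp (t : ℝ) : E p t * sqrtOp p = sqrtOp p * E p t := mulOp_comm _ _

theorem E_mul_expOp (t : ℝ) : E p t * expOp p = expOp p * E p t := mulOp_comm _ _

open Classical in
/-- Multiplication by `(1 - e^{-x})^{-1/2}` on `[t, ∞)`, for `t > 0`. -/
def invSqrtOp (p : ℕ) (t : ℝ) : BH p := if ht : 0 < t then mulOp p (invSqrtFun_memLp ht).toLp else 0

theorem invSqrtOp_coeFn {t : ℝ} (ht : 0 < t) (F : H p) :
    invSqrtOp p t F =ᵐ[halfLine] fun x => (Set.Ici t).indicator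
      (fun x : ℝ => (((Real.sqrt (1 - Real.exp (-x)))⁻¹ : ℝ) : ℂ)) x • F x := by
  rw [invSqrtOp, dif_pos ht]
  exact mulOp_toLp_coeFn _ F

theorem sqrt_one_sub_exp_pos {x : ℝ} (hx : 0 < x) : 0 < Real.sqrt (1 - Real.exp (-x)) := by
  refine Real.sqrt_pos.2 (sub_pos.2 ?_)
  rw [← Real.exp_zero]
  exact Real.exp_lt_exp.2 (by linarith)

theorem sqrtOp_mul_invSqrtOp {t : ℝ} (ht : 0 < t) : sqrtOp p * invSqrtOp p t = E p t := by
  rw [invSqrtOp, dif_pos ht]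
  refine mulOp_mul_mulOp _ _ _ fun x hx => ?_
  by_cases hxt : x ∈ Set.Ici t
  · rw [Set.indicator_of_mem hxt, Set.indicator_of_mem hxt, ← Complex.ofReal_mul,
      mul_inv_cancel₀ (sqrt_one_sub_exp_pos hx).ne', Complex.ofReal_one]
  · rw [Set.indicator_of_notMem hxt, Set.indicator_of_notMem hxt, mul_zero]

theorem star_invSqrtOp (t : ℝ) : star (invSqrtOp p t) = invSqrtOp p t := by
  unfold invSqrtOp
  split_ifs with ht
  · refine star_mulOp _ fun x => ?_
    by_cases hx : x ∈ Set.Ici t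
    · rw [Set.indicator_of_mem hx, Complex.conj_ofReal]
    · rw [Set.indicator_of_notMem hx, map_zero]
  · exact star_zero _

theorem invSqrtOp_mul_sqrtOp {t : ℝ} (ht : 0 < t) : invSqrtOp p t * sqrtOp p = E p t := by
  have := congrArg star (sqrtOp_mul_invSqrtOp (p := p) ht)
  rwa [star_mul, star_E, star_invSqrtOp, star_sqrtOp] at this

theorem coe_toAlg (B : BH p) : (toAlg p B : BH p) = sqrtOp p * (B * sqrtOp p) := rfl

theorem sandwich_apply (S A : BH p) : sandwich S A = S * (A * S) := rfl

theorem coe_cutoff {t : ℝ} (ht : 0 < t) (A : BH p) :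
    (cutoff p t A : BH p) = E p t * (A * E p t) := by
  rw [cutoff, dif_pos ht]
  rfl

/-- Division by (1 - e^{-x})^{1/2} is bounded on [t, ∞). Through this formula normality and complete
positivity of ω pass to ω|_t. -/
theorem cutoff_eq_toAlg {t : ℝ} (ht : 0 < t) (A : BH p) :
    cutoff p t A = toAlg p (invSqrtOp p t * (A * invSqrtOp p t)) := by
  apply Subtype.ext
  rw [coe_cutoff ht, coe_toAlg]
  nth_rw 2 [← invSqrtOp_mul_sqrtOp ht]
  rw [← sqrtOp_mul_invSqrtOp ht]
  simp only [mul_assoc]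

theorem cutoff_toAlg {t : ℝ} (ht : 0 < t) (B : BH p) :
    cutoff p t (toAlg p B : BH p) = toAlg p (E p t * (B * E p t)) := by
  apply Subtype.ext
  rw [coe_cutoff ht, coe_toAlg, coe_toAlg]
  simp only [mul_assoc]
  rw [← E_mul_sqrtOp, ← mul_assoc (E p t) (sqrtOp p), E_mul_sqrtOp]
  simp only [mul_assoc]

/-- Cutting off at a smaller t changes nothing, so ω|_t(A|_s) = ω|_s(A) does not depend on t ≤ s.
The limits t → 0+ with s fixed rely on this. -/
theorem cutoff_sandwich_E {s t : ℝ} (ht : 0 < t) (h : t ≤ s) (A : BH p) :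
    cutoff p t (sandwich (E p s) A) = cutoff p s A := by
  apply Subtype.ext
  rw [coe_cutoff ht, coe_cutoff (ht.trans_le h), sandwich_apply]
  simp only [mul_assoc]
  rw [E_mul_E_of_le h, ← mul_assoc (E p t), E_mul_E_of_le' h]

theorem toAlg_surjective (X : Alg p) : ∃ B, toAlg p B = X := (sandwich (sqrtOp p)).surjective_rangeRestrict X

theorem toAlg_one : toAlg p 1 = oneSubLam p := by
  apply Subtype.ext
  rw [coe_toAlg, one_mul]
  exact one_sub_Lam_eq p

theorem oneSubLam_coe : (oneSubLam p : BH p) = 1 - Lam p 1 := rfl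

theorem norm_mulOp_le_one {m : ℝ → ℂ} (hm : MemLp m ∞ halfLine) (h : ∀ x, 0 < x → ‖m x‖ ≤ 1)
    (F : H p) : ‖mulOp p hm.toLp F‖ ≤ ‖F‖ := by
  refine Lp.norm_le_norm_of_ae_le ?_
  filter_upwards [mulOp_toLp_coeFn hm F, ae_restrict_mem measurableSet_Ioi] with x h1 hx
  rw [h1, norm_smul]
  exact mul_le_of_le_one_left (norm_nonneg _) (h x hx)

theorem norm_E_apply_le (t : ℝ) (F : H p) : ‖E p t F‖ ≤ ‖F‖ :=
  norm_mulOp_le_one _ (fun x _ => by by_cases hx : x ∈ Set.Ici t <;> simp [hx]) F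

theorem norm_E_le (t : ℝ) : ‖E p t‖ ≤ 1 :=
  ContinuousLinearMap.opNorm_le_bound _ zero_le_one fun F => by
    rw [one_mul]
    exact norm_E_apply_le t F

theorem norm_expOp_le : ‖expOp p‖ ≤ 1 :=
  ContinuousLinearMap.opNorm_le_bound _ zero_le_one fun F => by
    rw [one_mul]
    refine norm_mulOp_le_one _ (fun x hx => ?_) F
    rw [Complex.norm_real, Real.norm_eq_abs, abs_of_pos (Real.exp_pos _)]
    exact Real.exp_le_one_iff.2 (by linarith)

theorem E_coeFn (t : ℝ) (F : H p) : E p t F =ᵐ[halfLine] (Set.Ici t).indicator F := by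
  filter_upwards [mulOp_toLp_coeFn (indicatorFun_memLp t) F] with x hx
  rw [E, hx]
  by_cases h : x ∈ Set.Ici t <;> simp [h]

theorem tendsto_E (F : H p) : Tendsto (fun t => E p t F) (𝓝[>] 0) (𝓝 F) := by
  rw [tendsto_iff_norm_sub_tendsto_zero]
  have hint : Integrable (fun x => ‖F x‖ ^ 2) halfLine := (Lp.memLp F).integrable_norm_pow (by simp)
  have h1 : ∀ t, ‖E p t F - F‖ ^ 2 =
      ∫ x, ‖F x‖ ^ 2 ∂halfLine - ∫ x in Set.Ici t, ‖F x‖ ^ 2 ∂halfLine := by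
    intro t
    have hn : ∀ G : H p, ‖G‖ ^ 2 = ∫ x, ‖G x‖ ^ 2 ∂halfLine := by
      intro G
      have h := (inner_self_eq_ofReal G).symm
      rw [L2.inner_def] at h
      simp only [inner_self_eq_ofReal] at h
      rw [integral_complex_ofReal] at h
      exact_mod_cast h
    rw [hn, ← integral_indicator measurableSet_Ici, ← integral_sub hint
      (hint.indicator measurableSet_Ici)]
    refine integral_congr_ae ?_
    filter_upwards [E_coeFn t F, Lp.coeFn_sub (E p t F) F] with x h2 h3
    rw [h3, Pi.sub_apply, h2]
    by_cases h : x ∈ Set.Ici t <;> simp [h]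
  have h2 : Tendsto (fun t => ∫ x in Set.Ici t, ‖F x‖ ^ 2 ∂halfLine) (𝓝[>] 0)
      (𝓝 (∫ x, ‖F x‖ ^ 2 ∂halfLine)) := by
    have hc : AECover halfLine (𝓝[>] (0 : ℝ)) fun t => Set.Ici t :=
      aecover_Ioi_of_Ici (tendsto_id.mono_left nhdsWithin_le_nhds)
    exact hc.integral_tendsto_of_countably_generated hint
  have h3 : Tendsto (fun t => ‖E p t F - F‖ ^ 2) (𝓝[>] 0) (𝓝 0) := by
    simp only [h1]
    have h5 := (tendsto_const_nhds (x := ∫ x, ‖F x‖ ^ 2 ∂halfLine)).sub h2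
    rwa [sub_self] at h5
  have h4 := h3.sqrt
  simpa [Real.sqrt_sq (norm_nonneg _)] using h4

theorem norm_E_conj_le (t : ℝ) (B : BH p) : ‖E p t * (B * E p t)‖ ≤ ‖B‖ := by
  have h := norm_E_le (p := p) t
  calc ‖E p t * (B * E p t)‖ ≤ ‖E p t‖ * (‖B‖ * ‖E p t‖) :=
        (norm_mul_le _ _).trans (by gcongr; exact norm_mul_le _ _)
    _ ≤ 1 * (‖B‖ * 1) := by gcongr
    _ = ‖B‖ := by ring

theorem tendsto_E_conj (B : BH p) (F : H p) :
    Tendsto (fun t => (E p t * (B * E p t)) F) (𝓝[>] 0) (𝓝 (B F)) := by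
  have h1 : Tendsto (fun t => E p t (B (E p t F) - B F)) (𝓝[>] 0) (𝓝 0) := by
    have h2 := ((B.continuous.tendsto F).comp (tendsto_E F)).sub_const (B F)
    rw [sub_self] at h2
    exact squeeze_zero_norm (fun t => norm_E_apply_le t _) (tendsto_zero_iff_norm_tendsto_zero.1 h2)
  have h3 := h1.add (tendsto_E (B F))
  rw [zero_add] at h3
  refine h3.congr fun t => ?_
  rw [map_sub, sub_add_cancel]
  rfl

theorem NormalFun.tendsto_E_conj {η : BH p →ₗ[ℂ] ℂ} (hη : NormalFun η) (B : BH p) :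
    Tendsto (fun t => η (E p t * (B * E p t))) (𝓝[>] 0) (𝓝 (η B)) :=
  hη.tendsto (C := ‖B‖) (Eventually.of_forall fun t => norm_E_conj_le t B)
    (QWeight.tendsto_E_conj B)

theorem expHalfFun_memLp : MemLp (fun x : ℝ => ((Real.exp (-x / 2) : ℝ) : ℂ)) ∞ halfLine := by
  refine memLp_top_of_bound (by fun_prop) 1 ?_
  filter_upwards [ae_restrict_mem measurableSet_Ioi] with x hx
  have hx' : (0 : ℝ) < x := hx
  rw [Complex.norm_real, Real.norm_eq_abs, abs_of_pos (Real.exp_pos _)]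
  exact Real.exp_le_one_iff.2 (by linarith)

/-- The square root of `expOp`. -/
def expHalfOp (p : ℕ) : BH p := mulOp p expHalfFun_memLp.toLp

theorem expHalfOp_mul_self : expHalfOp p * expHalfOp p = expOp p :=
  mulOp_mul_mulOp _ _ _ fun x _ => by
    rw [← Complex.ofReal_mul, ← Real.exp_add]
    congr 2
    ring

theorem star_expHalfOp : star (expHalfOp p) = expHalfOp p :=
  star_mulOp _ fun _ => Complex.conj_ofReal _

theorem Lam_factor (A B : BK p) :
    Lam p (star A * B) = star (expHalfOp p * amp A) * (expHalfOp p * amp B) := by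
  have h1 : star (expHalfOp p * amp A) = amp (star A) * expHalfOp p := by
    rw [star_mul, star_expHalfOp, star_amp]
  have h2 : amp (star A) * expHalfOp p = expHalfOp p * amp (star A) := amp_mul_mulOp _ _
  rw [Lam_apply, amp_mul, h1, h2, mul_assoc, ← mul_assoc (amp (star A)), h2, mul_assoc,
    ← mul_assoc (expHalfOp p), expHalfOp_mul_self]

theorem isCP_Lam : IsCP (Lam p) := isCP_of_factor _ Lam_factor

theorem isCP_sandwich {T : BH p} (hT : star T = T) : IsCP (sandwich T) :=
  isCP_of_factor (fun A => A * T) fun A B => by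
    rw [sandwich_apply, star_mul, hT]
    simp only [mul_assoc]

end Operators

/-! ### Kraus terms and affine multiplication maps. -/

section Generic

variable {V : Type} [NormedAddCommGroup V] [InnerProductSpace ℂ V] [CompleteSpace V]
  {E : Type} [NormedAddCommGroup E] [InnerProductSpace ℂ E] [CompleteSpace E]

theorem hasSum_affineMul {J : Type*} {w : J → ℝ} {Y : J → V →L[ℂ] V} {w₀ : ℝ} {Y₀ : V →L[ℂ] V}
    (hw : HasSum w w₀) (hY : HasSum Y Y₀) (A : V →L[ℂ] V) :
    HasSum (fun k => affineMul (w k) (Y k) A) (affineMul w₀ Y₀ A) := by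
  simp only [affineMul_apply]
  exact (((Complex.hasSum_ofReal.2 hw).smul_const A).add (hY.mul_left A)).add
    (hY.star.mul_right A)

theorem norm_affineMul_le (a : ℝ) (Y A : V →L[ℂ] V) :
    ‖affineMul a Y A‖ ≤ (|a| + 2 * ‖Y‖) * ‖A‖ := by
  rw [affineMul_apply]
  calc _ ≤ ‖(a : ℂ) • A‖ + ‖A * Y‖ + ‖star Y * A‖ := norm_add₃_le
    _ ≤ |a| * ‖A‖ + ‖A‖ * ‖Y‖ + ‖Y‖ * ‖A‖ := by
      gcongr
      · rw [norm_smul, Complex.norm_real, Real.norm_eq_abs]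
      · exact norm_mul_le _ _
      · exact (norm_mul_le _ _).trans (by rw [norm_star])
    _ = _ := by ring

/-- The Kraus term `S^* B S`. -/
def krausTerm (S : V →L[ℂ] E) (B : E →L[ℂ] E) : V →L[ℂ] V :=
  ContinuousLinearMap.adjoint S ∘L B ∘L S

theorem inner_krausTerm (S : V →L[ℂ] E) (B : E →L[ℂ] E) (x y : V) :
    ⟪x, krausTerm S B y⟫_ℂ = ⟪S x, B (S y)⟫_ℂ := by
  rw [krausTerm, ContinuousLinearMap.comp_apply, ContinuousLinearMap.comp_apply,
    ContinuousLinearMap.adjoint_inner_right]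

/-- Expansion of `(G + S)^* L (G + S)`, when `G` intertwines the operator `A` with `L`. -/
theorem krausTerm_add {G S : V →L[ℂ] E} {L D : E →L[ℂ] E} {A : V →L[ℂ] V} {c : ℝ}
    (hD : ∀ x y, ⟪x, D y⟫_ℂ = ⟪D x, y⟫_ℂ) (h₁ : ∀ f x, ⟪G f, L x⟫_ℂ = ⟪G (star A f), D x⟫_ℂ)
    (h₂ : ∀ f, L (G f) = D (G (A f))) (h₃ : ∀ f f', ⟪G f, D (G f')⟫_ℂ = (c : ℂ) * ⟪f, f'⟫_ℂ) :
    krausTerm (G + S) L =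
      affineMul c (ContinuousLinearMap.adjoint G ∘L D ∘L S) A + krausTerm S L := by
  ext1 y
  refine ext_inner_left ℂ fun x => ?_
  have e₁ : ⟪x, (A * (ContinuousLinearMap.adjoint G ∘L D ∘L S)) y⟫_ℂ = ⟪G (star A x), D (S y)⟫_ℂ := by
    rw [mul_apply_eq_comp, ContinuousLinearMap.comp_apply, ContinuousLinearMap.comp_apply,
      ← ContinuousLinearMap.adjoint_inner_left A, ContinuousLinearMap.adjoint_inner_right,
      ContinuousLinearMap.star_eq_adjoint]
  have e₂ : ⟪x, (star (ContinuousLinearMap.adjoint G ∘L D ∘L S) * A) y⟫_ℂ =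
      ⟪S x, D (G (A y))⟫_ℂ := by
    rw [inner_star_mul, ContinuousLinearMap.comp_apply, ContinuousLinearMap.comp_apply,
      ContinuousLinearMap.adjoint_inner_left, hD]
  have e₃ : ⟪G x, L (G y)⟫_ℂ = (c : ℂ) * ⟪x, A y⟫_ℂ := by rw [h₂, h₃]
  rw [add_apply, inner_add_right, inner_krausTerm, inner_krausTerm, affineMul_apply]
  simp only [add_apply, smul_apply, inner_add_left, inner_add_right, inner_smul_right, map_add,
    e₁, e₂, ← e₃, ← h₂, ← h₁]
  ring

theorem krausTerm_comp (S : V →L[ℂ] E) {T : E →L[ℂ] E} (hT : star T = T) (B : E →L[ℂ] E) :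
    krausTerm (T ∘L S) B = krausTerm S (T * (B * T)) := by
  refine ContinuousLinearMap.ext fun y => ext_inner_left ℂ fun x => ?_
  rw [inner_krausTerm, inner_krausTerm, mul_apply_eq_comp, mul_apply_eq_comp,
    ContinuousLinearMap.comp_apply, ContinuousLinearMap.comp_apply]
  rw [← ContinuousLinearMap.adjoint_inner_left T, ← ContinuousLinearMap.star_eq_adjoint, hT]

theorem norm_adjoint_comp_comp_le (G S : V →L[ℂ] E) {D : E →L[ℂ] E} (hD : star D = D) :
    ‖ContinuousLinearMap.adjoint G ∘L D ∘L S‖ ≤ ‖D ∘L G‖ * ‖S‖ := by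
  have h : ContinuousLinearMap.adjoint G ∘L D ∘L S = ContinuousLinearMap.adjoint (D ∘L G) ∘L S := by
    rw [ContinuousLinearMap.adjoint_comp, ← ContinuousLinearMap.star_eq_adjoint D, hD]
    rfl
  rw [h]
  refine (ContinuousLinearMap.opNorm_comp_le _ _).trans ?_
  rw [LinearIsometryEquiv.norm_map]

/-- Weighted arithmetic-geometric mean inequality; the free ε makes the cross terms Y_t negligible
compared with w_t. -/
theorem sqrt_mul_le {w ε : ℝ} (hw : 0 ≤ w) (hε : 0 < ε) (b : ℝ) :
    Real.sqrt w * b ≤ ε * w + (4 * ε)⁻¹ * b ^ 2 := by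
  have h : ε * w + (4 * ε)⁻¹ * b ^ 2 - Real.sqrt w * b =
      ε * (Real.sqrt w - (2 * ε)⁻¹ * b) ^ 2 := by
    rw [sub_sq, Real.sq_sqrt hw]
    field_simp
    ring
  have h' : 0 ≤ ε * (Real.sqrt w - (2 * ε)⁻¹ * b) ^ 2 := by positivity
  linarith

theorem isCP_of_hasSum_krausTerm {J : Type*} {φ : (E →L[ℂ] E) →ₗ[ℂ] (V →L[ℂ] V)}
    {S : J → V →L[ℂ] E} (h : ∀ A, HasSum (fun k => krausTerm (S k) A) (φ A)) : IsCP φ := by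
  let κ : J → (E →L[ℂ] E) →ₗ[ℂ] (V →L[ℂ] V) := fun k =>
    { toFun := fun A => krausTerm (S k) A
      map_add' := fun A B => by
        rw [krausTerm, ContinuousLinearMap.add_comp, ContinuousLinearMap.comp_add]
        rfl
      map_smul' := fun c A => by
        rw [krausTerm, ContinuousLinearMap.smul_comp, ContinuousLinearMap.comp_smul]
        rfl }
  refine isCP_of_tendsto (l := atTop) (φ := fun s : Finset J => ∑ k ∈ s, κ k)
    (Eventually.of_forall fun s => ?_) fun A => ?_
  · refine Finset.sum_induction _ IsCP (fun _ _ => IsCP.add) isCP_zero fun k _ n A f => ?_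
    simp only [κ, LinearMap.coe_mk, AddHom.coe_mk, inner_krausTerm]
    exact blockForm_star_mul_nonneg A fun i => S k (f i)
  · simp only [LinearMap.sum_apply]
    exact h A

end Generic

/-! ### Coordinates in ℂ^p and the tensor vectors f ⊗ g. -/

section Coordinates

variable {p : ℕ}

/-- The standard basis of `ℂ^p`. -/
def stdVec (i : Fin p) : K p := EuclideanSpace.single i 1

theorem inner_stdVec (i : Fin p) (f : K p) : ⟪stdVec i, f⟫_ℂ = f i := by
  rw [stdVec, EuclideanSpace.inner_single_left, map_one, one_mul]

theorem sum_smul_stdVec (f : K p) : ∑ i, f i • stdVec i = f := by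
  ext j
  rw [WithLp.ofLp_sum, Finset.sum_apply, Finset.sum_eq_single j]
  · simp [stdVec]
  · intro i _ hi
    simp [stdVec, hi.symm]
  · simp

/-- The matrix units of `B(ℂ^p)`. -/
def matUnit (i j : Fin p) : BK p := InnerProductSpace.rankOne ℂ (stdVec i) (stdVec j)

theorem matUnit_apply (i j : Fin p) (f : K p) : matUnit i j f = f j • stdVec i := by
  rw [matUnit, InnerProductSpace.rankOne_apply, inner_stdVec]

theorem sum_matUnit (X : BK p) : ∑ i, ∑ j, (X (stdVec j) i) • matUnit i j = X := by
  ext1 f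
  conv_rhs => rw [← sum_smul_stdVec f, map_sum]
  simp only [sum_apply, smul_apply, matUnit_apply, map_smul]
  rw [Finset.sum_comm]
  refine Finset.sum_congr rfl fun j _ => ?_
  conv_rhs => rw [← sum_smul_stdVec (X (stdVec j))]
  rw [Finset.smul_sum]
  exact Finset.sum_congr rfl fun i _ => smul_comm _ _ _

theorem tendsto_of_entries {α : Type*} {l : Filter α} {X : α → BK p} {X₀ : BK p}
    (h : ∀ i j, Tendsto (fun a => X a (stdVec j) i) l (𝓝 (X₀ (stdVec j) i))) :
    Tendsto X l (𝓝 X₀) := by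
  have h1 : Tendsto (fun a => ∑ i, ∑ j, (X a (stdVec j) i) • matUnit i j) l
      (𝓝 (∑ i, ∑ j, (X₀ (stdVec j) i) • matUnit i j)) :=
    tendsto_finsetSum _ fun i _ => tendsto_finsetSum _ fun j _ => (h i j).smul_const _
  rw [sum_matUnit] at h1
  exact h1.congr fun a => sum_matUnit (X a)

theorem hasSum_of_entries {J : Type*} {X : J → BK p} {X₀ : BK p}
    (h : ∀ i j, HasSum (fun a => X a (stdVec j) i) (X₀ (stdVec j) i)) : HasSum X X₀ := by
  refine tendsto_of_entries fun i j => ?_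
  have e : ∀ s : Finset J, (∑ b ∈ s, X b) (stdVec j) i = ∑ b ∈ s, X b (stdVec j) i := by
    intro s
    rw [sum_apply, ← inner_stdVec, inner_sum]
    simp only [inner_stdVec]
  exact Tendsto.congr (fun s => (e s).symm) (h i j)

/-- The operator `ℂ^p → H` with given images of the basis vectors. -/
def vecOp (V : Fin p → H p) : K p →L[ℂ] H p :=
  ∑ i, InnerProductSpace.rankOne ℂ (V i) (stdVec i)

theorem vecOp_apply (V : Fin p → H p) (f : K p) : vecOp V f = ∑ i, f i • V i := by
  simp only [vecOp, sum_apply, InnerProductSpace.rankOne_apply, inner_stdVec]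

theorem vecOp_stdVec (V : Fin p → H p) (i : Fin p) : vecOp V (stdVec i) = V i := by
  rw [vecOp_apply, Finset.sum_eq_single i]
  · simp [stdVec]
  · intro j _ hj
    simp [stdVec, hj]
  · simp

theorem ext_stdVec {W : Type*} [NormedAddCommGroup W] [NormedSpace ℂ W] {S T : K p →L[ℂ] W}
    (h : ∀ i, S (stdVec i) = T (stdVec i)) : S = T := by
  ext1 f
  rw [← sum_smul_stdVec f, map_sum, map_sum]
  simp only [map_smul, h]

theorem norm_vecOp_sq_le (V : Fin p → H p) : ‖vecOp V‖ ^ 2 ≤ p * ∑ i, ‖V i‖ ^ 2 := by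
  have h1 : ‖vecOp V‖ ≤ ∑ i, ‖V i‖ := by
    refine (norm_sum_le _ _).trans (Finset.sum_le_sum fun i _ => ?_)
    rw [InnerProductSpace.norm_rankOne]
    simp [stdVec]
  calc ‖vecOp V‖ ^ 2 ≤ (∑ i, ‖V i‖) ^ 2 := by gcongr
    _ ≤ _ := by
      have := sq_sum_le_card_mul_sum_sq (s := Finset.univ) (f := fun i => ‖V i‖)
      simpa using this

theorem hasSum_krausTerm {J : Type*} {V : J → Fin p → H p} {B : BH p} {X : BK p}
    (h : ∀ i j, HasSum (fun k => ⟪V k i, B (V k j)⟫_ℂ) (X (stdVec j) i)) :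
    HasSum (fun k => krausTerm (vecOp (V k)) B) X := by
  refine hasSum_of_entries fun i j => ?_
  simp only [← inner_stdVec i (krausTerm _ _ _), inner_krausTerm, vecOp_stdVec]
  exact h i j

/-- The operator `f ↦ f ⊗ g` from `ℂ^p` to `H`. -/
def tens (p : ℕ) (g : Lp ℂ 2 halfLine) : K p →L[ℂ] H p :=
  vecOp fun i => (ContinuousLinearMap.toSpanSingleton ℂ (stdVec i)).compLpL 2 halfLine g

theorem tens_coeFn (g : Lp ℂ 2 halfLine) (f : K p) : tens p g f =ᵐ[halfLine] fun x => g x • f := by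
  have h : ∀ i : Fin p, (ContinuousLinearMap.toSpanSingleton ℂ (stdVec i)).compLpL 2 halfLine g
      =ᵐ[halfLine] fun x => g x • stdVec i := fun i => by
    filter_upwards [ContinuousLinearMap.coeFn_compLpL (p := 2) (μ := halfLine)
      (ContinuousLinearMap.toSpanSingleton ℂ (stdVec i)) g] with x hx
    rw [hx, ContinuousLinearMap.toSpanSingleton_apply]
  rw [tens, vecOp_apply]
  refine (Lp.coeFn_finsetSum _ _).trans ?_
  have h2 : ∀ᵐ x ∂halfLine, ∀ i : Fin p, (f i • (ContinuousLinearMap.toSpanSingleton ℂ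
      (stdVec i)).compLpL 2 halfLine g : H p) x = f i • g x • stdVec i := by
    refine ae_all_iff.2 fun i => ?_
    filter_upwards [h i, Lp.coeFn_smul (f i) ((ContinuousLinearMap.toSpanSingleton ℂ
      (stdVec i)).compLpL 2 halfLine g)] with x h1 h2
    rw [h2, Pi.smul_apply, h1]
  filter_upwards [h2] with x hx
  rw [Finset.sum_apply]
  simp only [hx]
  conv_rhs => rw [← sum_smul_stdVec f, Finset.smul_sum]
  exact Finset.sum_congr rfl fun i _ => smul_comm _ _ _

theorem amp_tens (A : BK p) (g : Lp ℂ 2 halfLine) (f : K p) : amp A (tens p g f) = tens p g (A f) := by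
  apply Lp.ext
  filter_upwards [amp_coeFn A (tens p g f), tens_coeFn g f, tens_coeFn g (A f)] with x h1 h2 h3
  rw [h1, h2, h3, map_smul]

theorem inner_tens_Lam (A : BK p) (g : Lp ℂ 2 halfLine) (f : K p) (F : H p) :
    ⟪tens p g f, Lam p A F⟫_ℂ = ⟪tens p g (star A f), expOp p F⟫_ℂ := by
  rw [Lam_apply, ← amp_mul_expOp, mul_apply_eq_comp, ← amp_tens, ← star_amp,
    ContinuousLinearMap.star_eq_adjoint, ContinuousLinearMap.adjoint_inner_left]

theorem Lam_tens (A : BK p) (g : Lp ℂ 2 halfLine) (f : K p) :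
    Lam p A (tens p g f) = expOp p (tens p g (A f)) := by
  rw [Lam_apply, mul_apply_eq_comp, amp_tens]

theorem expOp_coeFn (F : H p) :
    expOp p F =ᵐ[halfLine] fun x => ((Real.exp (-x) : ℝ) : ℂ) • F x := mulOp_toLp_coeFn _ F

theorem inner_tens_expOp_tens (g : Lp ℂ 2 halfLine) (f f' : K p) :
    ⟪tens p g f, expOp p (tens p g f')⟫_ℂ =
      ((∫ x, Real.exp (-x) * ‖g x‖ ^ 2 ∂halfLine : ℝ) : ℂ) * ⟪f, f'⟫_ℂ := by
  rw [L2.inner_def, ← integral_complex_ofReal, ← integral_mul_const]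
  refine integral_congr_ae ?_
  filter_upwards [tens_coeFn g f, tens_coeFn g f', expOp_coeFn (tens p g f')] with x h1 h2 h3
  rw [h3, h1, h2, inner_smul_right, inner_smul_right, inner_smul_left, ← mul_assoc, ← mul_assoc,
    mul_assoc _ (g x), Complex.mul_conj, Complex.normSq_eq_norm_sq]
  push_cast
  ring

theorem integrable_exp_mul_sq (g : Lp ℂ 2 halfLine) :
    Integrable (fun x => Real.exp (-x) * ‖g x‖ ^ 2) halfLine := by
  have h1 : Integrable (fun x => ‖g x‖ ^ 2) halfLine := (Lp.memLp g).integrable_norm_pow (by simp)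
  refine h1.mono' ((Continuous.aestronglyMeasurable (by fun_prop)).mul h1.aestronglyMeasurable) ?_
  filter_upwards [ae_restrict_mem measurableSet_Ioi] with x hx
  have hx' : (0 : ℝ) < x := hx
  rw [norm_mul, Real.norm_of_nonneg (Real.exp_pos _).le, Real.norm_of_nonneg (by positivity)]
  exact mul_le_of_le_one_left (by positivity) (Real.exp_le_one_iff.2 (by linarith))

/-- Since e^{-2x} ≤ e^{-x} on the half line, the norm is controlled by the integral that enters w_t
rather than by ‖g‖. -/
theorem norm_expOp_tens_sq_le (g : Lp ℂ 2 halfLine) (f : K p) :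
    ‖expOp p (tens p g f)‖ ^ 2 ≤ (∫ x, Real.exp (-x) * ‖g x‖ ^ 2 ∂halfLine) * ‖f‖ ^ 2 := by
  have hn : ∀ G : H p, ‖G‖ ^ 2 = ∫ x, ‖G x‖ ^ 2 ∂halfLine := by
    intro G
    have h := (inner_self_eq_ofReal G).symm
    rw [L2.inner_def] at h
    simp only [inner_self_eq_ofReal] at h
    rw [integral_complex_ofReal] at h
    exact_mod_cast h
  rw [hn, ← integral_mul_const]
  refine integral_mono_ae ((Lp.memLp _).integrable_norm_pow (by simp))
    ((integrable_exp_mul_sq g).mul_const _) ?_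
  filter_upwards [expOp_coeFn (tens p g f), tens_coeFn g f, ae_restrict_mem measurableSet_Ioi]
    with x h1 h2 hx
  have hx' : (0 : ℝ) < x := hx
  rw [h1, h2, norm_smul, norm_smul, Complex.norm_real, Real.norm_of_nonneg (Real.exp_pos _).le]
  have : Real.exp (-x) ≤ 1 := Real.exp_le_one_iff.2 (by linarith)
  have h3 := Real.exp_pos (-x)
  have : Real.exp (-x) ^ 2 ≤ Real.exp (-x) := by nlinarith
  calc _ = Real.exp (-x) ^ 2 * (‖g x‖ ^ 2 * ‖f‖ ^ 2) := by ring
    _ ≤ Real.exp (-x) * (‖g x‖ ^ 2 * ‖f‖ ^ 2) := by gcongr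
    _ = _ := by ring

/-- The expansion of `(f ⊗ g + F)^* Λ(A) (f ⊗ g + F)`. -/
theorem krausTerm_tens_add_Lam (g : Lp ℂ 2 halfLine) (S : K p →L[ℂ] H p) (A : BK p) :
    krausTerm (tens p g + S) (Lam p A) =
      affineMul (∫ x, Real.exp (-x) * ‖g x‖ ^ 2 ∂halfLine)
        (ContinuousLinearMap.adjoint (tens p g) ∘L expOp p ∘L S) A + krausTerm S (Lam p A) := by
  refine krausTerm_add (fun F G => ?_) (inner_tens_Lam A g) (Lam_tens A g)
    (inner_tens_expOp_tens g)
  nth_rw 1 [← star_expOp]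
  rw [ContinuousLinearMap.star_eq_adjoint, ContinuousLinearMap.adjoint_inner_right]

end Coordinates

/-! ### The expansion of ϑ|_tΛ for a limiting form. -/

section Limiting

variable {p : ℕ}

/-- Membership in `L²_+(0, ∞)`. -/
def MemL2Plus (g : ℝ → ℂ) : Prop :=
  AEStronglyMeasurable g halfLine ∧
    Integrable (fun x => (1 - Real.exp (-x)) * ‖g x‖ ^ 2) halfLine

/-- The limiting form, without the condition on the weights `w_t`. -/
structure IsPreLimitingForm {J : Type} (g : J → ℝ → ℂ) (h : J → Fin p → H p)
    (ϑ : Alg p →ₗ[ℂ] BK p) (ρ : BH p →ₗ[ℂ] BK p) : Prop where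
  g_mem : ∀ k, MemL2Plus (g k)
  theta_eq : ∀ (B : BH p) (i j : Fin p),
    HasSum (fun k => ⟪weightedVec (g k) (h k) i, B (weightedVec (g k) (h k) j)⟫_ℂ)
      (ϑ (toAlg p B) (EuclideanSpace.single j 1) i)
  rho_eq : ∀ (A : BH p) (i j : Fin p),
    HasSum (fun k => ⟪h k i, A (h k j)⟫_ℂ) (ρ A (EuclideanSpace.single j 1) i)
  h_summable : ∀ i, Summable fun k => ‖h k i‖ ^ 2

theorem IsLimitingForm.pre {J : Type} {g : J → ℝ → ℂ} {h : J → Fin p → H p}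
    {ϑ : Alg p →ₗ[ℂ] BK p} {ρ : BH p →ₗ[ℂ] BK p} (hL : IsLimitingForm g h ϑ ρ) :
    IsPreLimitingForm g h ϑ ρ :=
  ⟨hL.g_mem, hL.theta_eq, hL.rho_eq, hL.h_summable⟩

theorem one_sub_exp_pos {x : ℝ} (hx : 0 < x) : 0 < 1 - Real.exp (-x) :=
  Real.sqrt_pos.1 (sqrt_one_sub_exp_pos hx)

theorem MemL2Plus.memLp_indicator {g : ℝ → ℂ} (hg : MemL2Plus g) {t : ℝ} (ht : 0 < t) :
    MemLp ((Set.Ici t).indicator g) 2 halfLine := by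
  have hm := hg.1.indicator (s := Set.Ici t) measurableSet_Ici
  rw [memLp_two_iff_integrable_sq_norm hm]
  refine (hg.2.const_mul (1 - Real.exp (-t))⁻¹).mono' (hm.norm.pow 2) ?_
  filter_upwards [ae_restrict_mem measurableSet_Ioi] with x hx
  have hx' := one_sub_exp_pos hx
  have ht' := one_sub_exp_pos ht
  rw [Real.norm_of_nonneg (by positivity)]
  by_cases hxt : x ∈ Set.Ici t
  · have hxt' : t ≤ x := hxt
    rw [Set.indicator_of_mem hxt, ← mul_assoc]
    refine le_mul_of_one_le_left (by positivity) ?_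
    rw [inv_mul_eq_div, one_le_div ht']
    have := Real.exp_le_exp.2 (neg_le_neg hxt')
    linarith
  · rw [Set.indicator_of_notMem hxt]
    have : 0 ≤ (1 - Real.exp (-t))⁻¹ * ((1 - Real.exp (-x)) * ‖g x‖ ^ 2) := by positivity
    simpa using this

theorem MemL2Plus.memLp_single {g : ℝ → ℂ} (hg : MemL2Plus g) (i : Fin p) :
    MemLp (fun x => (EuclideanSpace.single i
      (((Real.sqrt (1 - Real.exp (-x)) : ℝ) : ℂ) * g x) : K p)) 2 halfLine := by
  have hm1 : AEStronglyMeasurable (fun x => ((Real.sqrt (1 - Real.exp (-x)) : ℝ) : ℂ) * g x)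
      halfLine := AEStronglyMeasurable.mul (Continuous.aestronglyMeasurable (by fun_prop)) hg.1
  have hm : AEStronglyMeasurable (fun x => (EuclideanSpace.single i
      (((Real.sqrt (1 - Real.exp (-x)) : ℝ) : ℂ) * g x) : K p)) halfLine := by
    have := hm1.smul_const (stdVec i : K p)
    refine this.congr (Eventually.of_forall fun x => ?_)
    ext j
    by_cases hj : j = i <;> simp [stdVec, hj]
  rw [memLp_two_iff_integrable_sq_norm hm]
  refine hg.2.congr ?_
  filter_upwards [ae_restrict_mem measurableSet_Ioi] with x hx
  rw [PiLp.norm_single, norm_mul, mul_pow, Complex.norm_real, Real.norm_eq_abs, sq_abs,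
    Real.sq_sqrt (one_sub_exp_pos hx).le]

open Classical in
/-- The restriction of a scalar function to `[t, ∞)`, as an element of `L²(0, ∞)`. -/
def gcut (g : ℝ → ℂ) (t : ℝ) : Lp ℂ 2 halfLine :=
  if hg : MemLp ((Set.Ici t).indicator g) 2 halfLine then hg.toLp else 0

theorem gcut_coeFn {g : ℝ → ℂ} (hg : MemL2Plus g) {t : ℝ} (ht : 0 < t) :
    gcut g t =ᵐ[halfLine] (Set.Ici t).indicator g := by
  rw [gcut, dif_pos (hg.memLp_indicator ht)]
  exact MemLp.coeFn_toLp _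

/-- On [t, ∞) the weight can be undone, so the Kraus vectors of ϑ|_t are the square integrable
restrictions of g_i + h_i. -/
theorem invSqrtOp_comp_vecOp {g : ℝ → ℂ} (hg : MemL2Plus g) (h : Fin p → H p) {t : ℝ}
    (ht : 0 < t) :
    invSqrtOp p t ∘L vecOp (weightedVec g h) = tens p (gcut g t) + E p t ∘L vecOp h := by
  refine ext_stdVec fun i => ?_
  rw [add_apply, ContinuousLinearMap.comp_apply, ContinuousLinearMap.comp_apply, vecOp_stdVec,
    vecOp_stdVec, weightedVec, map_add]
  have e : invSqrtOp p t (sqrtOp p (h i)) = E p t (h i) := by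
    rw [← invSqrtOp_mul_sqrtOp ht, mul_apply_eq_comp]
  rw [e]
  congr 1
  rw [toH, dif_pos (hg.memLp_single i)]
  apply Lp.ext
  filter_upwards [invSqrtOp_coeFn ht (hg.memLp_single (p := p) i).toLp,
    (hg.memLp_single (p := p) i).coeFn_toLp, tens_coeFn (gcut g t) (stdVec i),
    gcut_coeFn hg ht, ae_restrict_mem measurableSet_Ioi] with x h1 h2 h3 h4 hx
  rw [h1, h2, h3, h4]
  by_cases hxt : x ∈ Set.Ici t
  · have hne : ((Real.sqrt (1 - Real.exp (-x)) : ℝ) : ℂ) ≠ 0 :=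
      Complex.ofReal_ne_zero.2 (sqrt_one_sub_exp_pos hx).ne'
    rw [Set.indicator_of_mem hxt, Set.indicator_of_mem hxt, stdVec]
    ext j
    by_cases hj : j = i
    · subst hj
      simp [hne]
    · simp [hj]
  · rw [Set.indicator_of_notMem hxt, Set.indicator_of_notMem hxt, zero_smul, zero_smul]

theorem integral_gcut {g : ℝ → ℂ} (hg : MemL2Plus g) {t : ℝ} (ht : 0 < t) :
    ∫ x, Real.exp (-x) * ‖gcut g t x‖ ^ 2 ∂halfLine =
      ∫ x in Set.Ici t, Real.exp (-x) * ‖g x‖ ^ 2 := by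
  have h1 : ∫ x, Real.exp (-x) * ‖gcut g t x‖ ^ 2 ∂halfLine =
      ∫ x, (Set.Ici t).indicator (fun x => Real.exp (-x) * ‖g x‖ ^ 2) x ∂halfLine := by
    refine integral_congr_ae ?_
    filter_upwards [gcut_coeFn hg ht] with x hx
    rw [hx]
    by_cases hxt : x ∈ Set.Ici t
    · rw [Set.indicator_of_mem hxt, Set.indicator_of_mem hxt]
    · rw [Set.indicator_of_notMem hxt, Set.indicator_of_notMem hxt]
      simp
  rw [h1, integral_indicator measurableSet_Ici, Measure.restrict_restrict measurableSet_Ici,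
    Set.inter_eq_left.2 (Set.Ici_subset_Ioi.2 ht)]

variable {J : Type} {g : J → ℝ → ℂ} {h : J → Fin p → H p} {ϑ : Alg p →ₗ[ℂ] BK p}
  {ρ : BH p →ₗ[ℂ] BK p}

theorem IsPreLimitingForm.hasSum_theta (hL : IsPreLimitingForm g h ϑ ρ) (B : BH p) :
    HasSum (fun k => krausTerm (vecOp (weightedVec (g k) (h k))) B) (ϑ (toAlg p B)) :=
  hasSum_krausTerm fun i j => hL.theta_eq B i j

theorem IsPreLimitingForm.hasSum_rho (hL : IsPreLimitingForm g h ϑ ρ) (A : BH p) :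
    HasSum (fun k => krausTerm (vecOp (h k)) A) (ρ A) :=
  hasSum_krausTerm fun i j => hL.rho_eq A i j

theorem IsPreLimitingForm.summable_vecOp (hL : IsPreLimitingForm g h ϑ ρ) :
    Summable fun k => ‖vecOp (h k)‖ ^ 2 := by
  refine Summable.of_nonneg_of_le (fun k => by positivity) (fun k => norm_vecOp_sq_le (h k)) ?_
  exact (summable_sum fun i _ => hL.h_summable i).mul_left _

theorem hasSum_restr_aux (hL : IsPreLimitingForm g h ϑ ρ) {t : ℝ} (ht : 0 < t) (B : BH p) :
    HasSum (fun k => krausTerm (tens p (gcut (g k) t) + E p t ∘L vecOp (h k)) B)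
      (restr ϑ t B) := by
  have h1 := hL.hasSum_theta (invSqrtOp p t * (B * invSqrtOp p t))
  rw [← cutoff_eq_toAlg ht] at h1
  refine h1.congr_fun ?_
  intro k
  rw [← invSqrtOp_comp_vecOp (hL.g_mem k) (h k) ht, krausTerm_comp _ (star_invSqrtOp t)]

/-- The weights `(g_k, Λ|_t g_k)`. -/
def wterm (g : J → ℝ → ℂ) (t : ℝ) (k : J) : ℝ := ∫ x in Set.Ici t, Real.exp (-x) * ‖g k x‖ ^ 2

theorem wterm_nonneg (g : J → ℝ → ℂ) (t : ℝ) (k : J) : 0 ≤ wterm g t k :=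
  integral_nonneg fun x => by positivity

/-- A diagonal entry of ϑ(I - Λ) is the sum of the squared norms of the weighted vectors. Removing
the weight costs a constant depending on t, and the contribution of h is itself square summable. -/
theorem IsPreLimitingForm.summable_wterm (hL : IsPreLimitingForm g h ϑ ρ) (hp : 0 < p) {t : ℝ}
    (ht : 0 < t) : Summable (wterm g t) := by
  let i : Fin p := ⟨0, hp⟩
  have hV : Summable fun k => ‖weightedVec (g k) (h k) i‖ ^ 2 := by
    have h1 := (hL.theta_eq 1 i i).summable
    simp only [one_apply_eq_self, inner_self_eq_ofReal] at h1
    exact Complex.summable_ofReal.1 h1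
  refine Summable.of_nonneg_of_le (wterm_nonneg g t) (fun k => ?_)
    ((hV.mul_left (2 * ‖invSqrtOp p t‖ ^ 2)).add ((hL.h_summable i).mul_left 2))
  have h1 : ((wterm g t k : ℝ) : ℂ) = ⟪tens p (gcut (g k) t) (stdVec i),
      expOp p (tens p (gcut (g k) t) (stdVec i))⟫_ℂ := by
    rw [inner_tens_expOp_tens, integral_gcut (hL.g_mem k) ht, inner_self_eq_ofReal]
    simp [stdVec, wterm]
  have h2 : wterm g t k ≤ ‖tens p (gcut (g k) t) (stdVec i)‖ ^ 2 := by
    have h3 := norm_inner_apply_le (expOp p) (tens p (gcut (g k) t) (stdVec i))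
      (tens p (gcut (g k) t) (stdVec i))
    rw [← h1, Complex.norm_real, Real.norm_of_nonneg (wterm_nonneg g t k)] at h3
    refine h3.trans ?_
    rw [← pow_two]
    exact mul_le_of_le_one_left (by positivity) norm_expOp_le
  have h4 : ‖tens p (gcut (g k) t) (stdVec i)‖ ≤
      ‖invSqrtOp p t‖ * ‖weightedVec (g k) (h k) i‖ + ‖h k i‖ := by
    have h5 := congrArg (fun S => S (stdVec i)) (invSqrtOp_comp_vecOp (hL.g_mem k) (h k) ht)
    simp only [add_apply, ContinuousLinearMap.comp_apply, vecOp_stdVec] at h5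
    rw [eq_sub_of_add_eq h5.symm]
    refine (norm_sub_le _ _).trans ?_
    gcongr
    · exact ContinuousLinearMap.le_opNorm _ _
    · exact norm_E_apply_le t _
  refine h2.trans ?_
  set a := ‖invSqrtOp p t‖ * ‖weightedVec (g k) (h k) i‖
  calc _ ≤ (a + ‖h k i‖) ^ 2 := by gcongr
    _ ≤ 2 * a ^ 2 + 2 * ‖h k i‖ ^ 2 := by nlinarith [sq_nonneg (a - ‖h k i‖)]
    _ = _ := by simp only [a]; ring

/-- The terms of the series for `Y_t`. -/
def crossTerm (g : J → ℝ → ℂ) (h : J → Fin p → H p) (t : ℝ) (k : J) : BK p :=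
  ContinuousLinearMap.adjoint (tens p (gcut (g k) t)) ∘L expOp p ∘L (E p t ∘L vecOp (h k))

theorem IsPreLimitingForm.norm_crossTerm_le (hL : IsPreLimitingForm g h ϑ ρ) {t ε : ℝ}
    (ht : 0 < t) (hε : 0 < ε) (k : J) :
    ‖crossTerm g h t k‖ ≤ ε * wterm g t k + (4 * ε)⁻¹ * ‖vecOp (h k)‖ ^ 2 := by
  have hw0 : 0 ≤ wterm g t k := wterm_nonneg g t k
  have h1 : ‖expOp p ∘L tens p (gcut (g k) t)‖ ≤ Real.sqrt (wterm g t k) := by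
    refine ContinuousLinearMap.opNorm_le_bound _ (Real.sqrt_nonneg _) fun f => ?_
    rw [ContinuousLinearMap.comp_apply]
    refine le_of_sq_le_sq ?_ (by positivity)
    have := norm_expOp_tens_sq_le (gcut (g k) t) f
    rw [integral_gcut (hL.g_mem k) ht] at this
    rwa [mul_pow, Real.sq_sqrt hw0]
  have h2 : ‖E p t ∘L vecOp (h k)‖ ≤ ‖vecOp (h k)‖ :=
    (ContinuousLinearMap.opNorm_comp_le _ _).trans
      (mul_le_of_le_one_left (norm_nonneg _) (norm_E_le t))
  exact ((norm_adjoint_comp_comp_le _ _ star_expOp).trans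
    (mul_le_mul h1 h2 (norm_nonneg _) (Real.sqrt_nonneg _))).trans (sqrt_mul_le hw0 hε _)

/-- The operator `Y_t = ∑_k (g_k, Λ|_t h_k)`. -/
def crossOp (g : J → ℝ → ℂ) (h : J → Fin p → H p) (t : ℝ) : BK p := ∑' k, crossTerm g h t k

theorem IsPreLimitingForm.summable_crossTerm (hL : IsPreLimitingForm g h ϑ ρ) (hp : 0 < p) {t : ℝ}
    (ht : 0 < t) : Summable (crossTerm g h t) :=
  Summable.of_norm_bounded (((hL.summable_wterm hp ht).mul_left 1).add
    (hL.summable_vecOp.mul_left _)) fun k => hL.norm_crossTerm_le ht one_pos k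

/-- The constant depends on ε and on ∑ ‖h_k‖² but not on t, so Y_t = o(w_t) whenever w_t → ∞. -/
theorem IsPreLimitingForm.norm_crossOp_le (hL : IsPreLimitingForm g h ϑ ρ) (hp : 0 < p) {ε : ℝ}
    (hε : 0 < ε) : ∃ C : ℝ, ∀ t, 0 < t → ‖crossOp g h t‖ ≤ ε * wt g t + C := by
  refine ⟨(4 * ε)⁻¹ * ∑' k, ‖vecOp (h k)‖ ^ 2, fun t ht => ?_⟩
  exact tsum_of_norm_bounded (((hL.summable_wterm hp ht).hasSum.mul_left ε).add
    (hL.summable_vecOp.hasSum.mul_left _)) fun k => hL.norm_crossTerm_le ht hε k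

theorem Lam_mul_E (A : BK p) (t : ℝ) : Lam p A * E p t = E p t * Lam p A := by
  rw [Lam_apply, mul_assoc, amp_mul_E, ← mul_assoc, ← mul_assoc, E_mul_expOp]

/-- `ϑ|_t Λ(A) = w_t A + A Y_t + Y_t^* A + ρ|_t Λ(A)`. -/
theorem IsPreLimitingForm.restr_Lam (hL : IsPreLimitingForm g h ϑ ρ) (hp : 0 < p) {t : ℝ}
    (ht : 0 < t) (A : BK p) :
    restr ϑ t (Lam p A) = affineMul (wt g t) (crossOp g h t) A +
      ρ (sandwich (E p t) (Lam p A)) := by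
  refine (hasSum_restr_aux hL ht (Lam p A)).unique ?_
  have h1 := (hasSum_affineMul (hL.summable_wterm hp ht).hasSum
    (hL.summable_crossTerm hp ht).hasSum A).add (hL.hasSum_rho (sandwich (E p t) (Lam p A)))
  refine h1.congr_fun ?_
  intro k
  rw [krausTerm_tens_add_Lam, integral_gcut (hL.g_mem k) ht, krausTerm_comp _ (star_E t)]
  rfl

theorem IsPreLimitingForm.isCP_rho (hL : IsPreLimitingForm g h ϑ ρ) : IsCP ρ :=
  isCP_of_hasSum_krausTerm hL.hasSum_rho

theorem IsPreLimitingForm.isCP_theta (hL : IsPreLimitingForm g h ϑ ρ) : IsCP (ϑ ∘ₗ toAlg p) :=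
  isCP_of_hasSum_krausTerm hL.hasSum_theta

end Limiting

/-! ### Pointwise limits and inverses of operators in finite dimension. -/

section FiniteDimensional

variable {M : Type*} [NormedAddCommGroup M] [NormedSpace ℂ M] [FiniteDimensional ℂ M]
  {α : Type*} {l : Filter α}

/-- Evaluation at a basis is an injective linear map between finite dimensional spaces, hence a
closed embedding, so pointwise convergence is norm convergence. -/
theorem tendsto_toContinuousLinearMap {A : α → Module.End ℂ M} {A₀ : Module.End ℂ M}
    (h : ∀ x, Tendsto (fun a => A a x) l (𝓝 (A₀ x))) :
    Tendsto (fun a => Module.End.toContinuousLinearMap M (A a)) l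
      (𝓝 (Module.End.toContinuousLinearMap M A₀)) := by
  let b := Module.finBasis ℂ M
  let f : (M →L[ℂ] M) →ₗ[ℂ] (Fin (Module.finrank ℂ M) → M) :=
    { toFun := fun L i => L (b i)
      map_add' := fun _ _ => rfl
      map_smul' := fun _ _ => rfl }
  have hf : LinearMap.ker f = ⊥ := by
    rw [LinearMap.ker_eq_bot']
    intro L hL
    have : (L : M →ₗ[ℂ] M) = 0 := b.ext fun i => congrFun hL i
    exact ContinuousLinearMap.coe_injective this
  rw [(LinearMap.isClosedEmbedding_of_injective hf).tendsto_nhds_iff]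
  exact tendsto_pi_nhds.2 fun i => h (b i)

theorem eventually_isUnit_of_tendsto {A : α → Module.End ℂ M} {A₀ : Module.End ℂ M}
    (h : ∀ x, Tendsto (fun a => A a x) l (𝓝 (A₀ x))) (h₀ : IsUnit A₀) :
    ∀ᶠ a in l, IsUnit (A a) := by
  have h1 := (tendsto_toContinuousLinearMap h).eventually
    (Units.isOpen.mem_nhds (h₀.map (Module.End.toContinuousLinearMap M)))
  filter_upwards [h1] with a ha
  exact (isUnit_map_iff (Module.End.toContinuousLinearMap M) (A a)).1 ha

theorem tendsto_inverse_apply {A B : α → Module.End ℂ M} {A₀ B₀ : Module.End ℂ M}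
    (hAB : ∀ᶠ a in l, A a * B a = 1 ∧ B a * A a = 1) (h₀ : A₀ * B₀ = 1 ∧ B₀ * A₀ = 1)
    (h : ∀ x, Tendsto (fun a => A a x) l (𝓝 (A₀ x))) {y : α → M} {y₀ : M}
    (hy : Tendsto y l (𝓝 y₀)) : Tendsto (fun a => B a (y a)) l (𝓝 (B₀ y₀)) := by
  let Ψ := Module.End.toContinuousLinearMap (𝕜 := ℂ) M
  have inv : ∀ {X Y : Module.End ℂ M}, X * Y = 1 ∧ Y * X = 1 → Ring.inverse (Ψ X) = Ψ Y := by
    intro X Y hXY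
    have e1 : Ψ X * Ψ Y = 1 := by rw [← map_mul, hXY.1, map_one]
    have e2 : Ψ Y * Ψ X = 1 := by rw [← map_mul, hXY.2, map_one]
    exact Ring.inverse_unit (⟨Ψ X, Ψ Y, e1, e2⟩ : (M →L[ℂ] M)ˣ)
  have hu : IsUnit (Ψ A₀) := (IsUnit.of_mul_eq_one (a := A₀) B₀ h₀.1).map Ψ
  have : CompleteSpace M := FiniteDimensional.complete ℂ M
  have h1 : Tendsto (fun a => Ring.inverse (Ψ (A a))) l (𝓝 (Ring.inverse (Ψ A₀))) := by
    obtain ⟨u, hu⟩ := hu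
    have hc := NormedRing.inverse_continuousAt u
    rw [hu] at hc
    exact hc.tendsto.comp (tendsto_toContinuousLinearMap h)
  rw [inv h₀] at h1
  have h2 : Tendsto (fun a => Ψ (B a)) l (𝓝 (Ψ B₀)) := by
    refine h1.congr' ?_
    filter_upwards [hAB] with a ha
    exact inv ha
  exact (isBoundedBilinearMap_apply.continuous.tendsto (Ψ B₀, y₀)).comp (h2.prodMk_nhds hy)

end FiniteDimensional

theorem tendsto_zero_of_smul {M α : Type*} [NormedAddCommGroup M] [NormedSpace ℂ M]
    {l : Filter α} {w : α → ℝ} (hw : Tendsto w l atTop) {y : α → M} {y₀ : M}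
    (h : Tendsto (fun a => ((w a : ℝ) : ℂ) • y a) l (𝓝 y₀)) : Tendsto y l (𝓝 0) := by
  have h2 : Tendsto (fun t => (((w t)⁻¹ : ℝ) : ℂ)) l (𝓝 ((0 : ℝ) : ℂ)) :=
    (Complex.continuous_ofReal.tendsto 0).comp (tendsto_inv_atTop_zero.comp hw)
  have h3 := h2.smul h
  rw [Complex.ofReal_zero, zero_smul] at h3
  refine h3.congr' ?_
  filter_upwards [hw.eventually_gt_atTop 0] with t hw
  rw [smul_smul, ← Complex.ofReal_mul, inv_mul_cancel₀ hw.ne', Complex.ofReal_one, one_smul]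

/-! ### Strict positivity of surjective completely positive maps. -/

section CPGeneric

variable {E V : Type} [NormedAddCommGroup E] [InnerProductSpace ℂ E] [CompleteSpace E]
  [NormedAddCommGroup V] [InnerProductSpace ℂ V] [CompleteSpace V]

/-- Choose B with θ(B) = 1. If ⟨x, θ(1)x⟩ = 0, the form of the family (1, B) at (sx, x) is affine in
the real parameter s with slope 2‖x‖², so it would be negative for very negative s. -/
theorem IsCP.pos_of_surjective {θ : (E →L[ℂ] E) →ₗ[ℂ] (V →L[ℂ] V)} (hθ : IsCP θ)
    (hs : Function.Surjective θ) (x : V) (hx : x ≠ 0) : 0 < ⟪x, θ 1 x⟫_ℂ := by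
  have h0 := inner_nonneg_of_nonneg (hθ.nonneg zero_le_one) x
  refine lt_of_le_of_ne h0 fun h => hx ?_
  obtain ⟨B, hB⟩ := hs 1
  have key : ∀ s : ℝ, 0 ≤ 2 * s * ‖x‖ ^ 2 + (⟪x, θ (star B * B) x⟫_ℂ).re := by
    intro s
    have h1 := (Complex.nonneg_iff.1 (hθ 2 ![1, B] ![(s : ℂ) • x, x])).1
    simp only [Fin.sum_univ_two, Matrix.cons_val_zero, Matrix.cons_val_one, star_one, one_mul,
      mul_one, hθ.map_star B, hB, one_apply_eq_self, map_smul, inner_smul_left, inner_smul_right,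
      ← h, Complex.add_re, mul_zero, zero_add, Complex.conj_ofReal,
      Complex.re_ofReal_mul, inner_self_eq_ofReal, Complex.ofReal_re] at h1
    linarith
  set c := (⟪x, θ (star B * B) x⟫_ℂ).re
  by_contra hne
  have hpos : 0 < ‖x‖ ^ 2 := by
    have := norm_pos_iff.2 hne
    positivity
  have := key (-(|c| + 1) / (2 * ‖x‖ ^ 2))
  have e : 2 * (-(|c| + 1) / (2 * ‖x‖ ^ 2)) * ‖x‖ ^ 2 = -(|c| + 1) := by field_simp
  rw [e] at this
  linarith [le_abs_self c]

theorem inner_mono {A B : V →L[ℂ] V} (h : A ≤ B) (x : V) : ⟪x, A x⟫_ℂ ≤ ⟪x, B x⟫_ℂ := by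
  have := inner_nonneg_of_nonneg (sub_nonneg.2 h) x
  rwa [sub_apply, inner_sub_right, sub_nonneg] at this

end CPGeneric

/-! ### Normality and complete positivity of weights and their cutoffs. -/

section Weights

variable {p : ℕ}

theorem normalFun_coeff_iff {φ : BH p →ₗ[ℂ] BK p} :
    IsNormalMap φ ↔ ∀ f g : K p, NormalFun (coeffFunctional f g ∘ₗ φ) := by
  simp only [IsNormalMap, isNormalFunctional_iff]

theorem isNormalMap_of_entries {φ : BH p →ₗ[ℂ] BK p}
    (h : ∀ i j : Fin p, NormalFun (coeffFunctional (stdVec i) (stdVec j) ∘ₗ φ))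
    (L : BK p →ₗ[ℂ] BK p) : IsNormalMap (L ∘ₗ φ) := by
  rw [normalFun_coeff_iff]
  intro f g
  have e : coeffFunctional f g ∘ₗ L ∘ₗ φ = ∑ i, ∑ j, ⟪f, L (matUnit i j) g⟫_ℂ •
      (coeffFunctional (stdVec i) (stdVec j) ∘ₗ φ) := by
    refine LinearMap.ext fun A => ?_
    have h1 : L (φ A) = ∑ i, ∑ j, (φ A (stdVec j) i) • L (matUnit i j) := by
      conv_lhs => rw [← sum_matUnit (φ A)]
      simp only [map_sum, map_smul]
    simp only [LinearMap.sum_apply, LinearMap.comp_apply, LinearMap.smul_apply]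
    rw [h1]
    simp only [coeffFunctional, LinearMap.coe_mk, AddHom.coe_mk, sum_apply, inner_sum,
      inner_stdVec, smul_apply, inner_smul_right, smul_eq_mul]
    exact Finset.sum_congr rfl fun i _ => Finset.sum_congr rfl fun j _ => mul_comm _ _
  rw [e]
  exact normalFun_sum _ fun i _ => normalFun_sum _ fun j _ => (h i j).smul _

theorem isNormalMap_of_hasSum {φ : BH p →ₗ[ℂ] BK p} {J : Type} {V : J → Fin p → H p}
    (hV : ∀ i, Summable fun k => ‖V k i‖ ^ 2)
    (h : ∀ A i j, HasSum (fun k => ⟪V k i, A (V k j)⟫_ℂ) (φ A (EuclideanSpace.single j 1) i)) :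
    IsNormalMap φ := by
  have h1 := isNormalMap_of_entries (φ := φ) (fun i j => ⟨J, fun k => V k i, fun k => V k j, hV i,
    hV j, fun A => by
      have h2 := h A i j
      rwa [← inner_stdVec] at h2⟩) LinearMap.id
  rwa [LinearMap.id_comp] at h1

theorem IsNormalMap.comp_left {φ : BH p →ₗ[ℂ] BK p} (hφ : IsNormalMap φ)
    (L : BK p →ₗ[ℂ] BK p) : IsNormalMap (L ∘ₗ φ) :=
  isNormalMap_of_entries (fun _ _ => normalFun_coeff_iff.1 hφ _ _) L

theorem restr_apply {ω : Alg p →ₗ[ℂ] BK p} {t : ℝ} (ht : 0 < t) (B : BH p) :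
    restr ω t B = ω (toAlg p (invSqrtOp p t * (B * invSqrtOp p t))) := by
  rw [← cutoff_eq_toAlg ht]
  rfl

theorem restr_toAlg {ω : Alg p →ₗ[ℂ] BK p} {t : ℝ} (ht : 0 < t) (B : BH p) :
    restr ω t (toAlg p B : BH p) = ω (toAlg p (E p t * (B * E p t))) := by
  rw [← cutoff_toAlg ht]
  rfl

theorem restr_sandwich_E {ω : Alg p →ₗ[ℂ] BK p} {s t : ℝ} (ht : 0 < t) (h : t ≤ s) (A : BH p) :
    restr ω t (sandwich (E p s) A) = restr ω s A :=
  congrArg ω (cutoff_sandwich_E ht h A)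

theorem restr_eq_comp {ω : Alg p →ₗ[ℂ] BK p} {t : ℝ} (ht : 0 < t) :
    restr ω t = (ω ∘ₗ toAlg p) ∘ₗ sandwich (invSqrtOp p t) :=
  LinearMap.ext fun B => restr_apply ht B

theorem isCP_restr {ω : Alg p →ₗ[ℂ] BK p} (hω : IsCP (ω ∘ₗ toAlg p)) {t : ℝ} (ht : 0 < t) :
    IsCP (restr ω t) := by
  rw [restr_eq_comp ht]
  exact hω.comp (isCP_sandwich (star_invSqrtOp t))

theorem isNormalMap_restr {ω : Alg p →ₗ[ℂ] BK p} (hω : IsNormalMap (ω ∘ₗ toAlg p)) {t : ℝ}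
    (ht : 0 < t) : IsNormalMap (restr ω t) := by
  rw [normalFun_coeff_iff] at hω ⊢
  intro f g
  refine (hω f g).compress (invSqrtOp p t) (invSqrtOp p t) fun A => ?_
  rw [LinearMap.comp_apply, restr_apply ht]
  rfl

theorem sqrtOp_invSqrtOp_apply {t : ℝ} (ht : 0 < t) (x : H p) :
    sqrtOp p (invSqrtOp p t x) = E p t x := by
  rw [← sqrtOp_mul_invSqrtOp ht, mul_apply_eq_comp]

/-- Complete positivity on `𝔄(ℂ^p)` follows from complete positivity of the pull back to `B(H)`. -/
theorem isCPWeight_of_isCP {ω : Alg p →ₗ[ℂ] BK p} (hω : IsCP (ω ∘ₗ toAlg p)) : IsCPWeight ω := by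
  intro n A hA f
  choose B hB using fun i j => toAlg_surjective (A i j)
  -- Positivity of S B S with S = (I - Λ)^{1/2} gives positivity of B on vectors supported in [s,
  -- ∞), since these lie in the range of S. The limit s → 0+ gives all vectors.
  have hpos : ∀ x, 0 ≤ blockForm B x := by
    intro x
    have hlim : Tendsto (fun s => blockForm B fun i => E p s (x i)) (𝓝[>] 0)
        (𝓝 (blockForm B x)) := by
      refine tendsto_finsetSum _ fun i _ => tendsto_finsetSum _ fun j _ => ?_
      exact (tendsto_E (x i)).inner (((B i j).continuous.tendsto _).comp (tendsto_E (x j)))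
    have : OrderClosedTopology ℂ := Complex.orderClosedTopology
    refine ge_of_tendsto hlim ?_
    filter_upwards [self_mem_nhdsWithin] with s hs
    have hs' : 0 < s := hs
    have h1 := hA fun i => invSqrtOp p s (x i)
    refine h1.trans_eq (Finset.sum_congr rfl fun i _ => Finset.sum_congr rfl fun j _ => ?_)
    rw [← hB, coe_toAlg, mul_apply_eq_comp, mul_apply_eq_comp, sqrtOp_invSqrtOp_apply hs',
      ← ContinuousLinearMap.adjoint_inner_left, ← ContinuousLinearMap.star_eq_adjoint,
      star_sqrtOp, sqrtOp_invSqrtOp_apply hs']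
  have h2 := hω.blockForm_nonneg hpos f
  simp only [LinearMap.comp_apply, hB] at h2
  exact h2

theorem star_one_sub_E (t : ℝ) : star (1 - E p t) = 1 - E p t := by
  rw [star_sub, star_one, star_E]

theorem E_le_one (t : ℝ) : E p t ≤ 1 := by
  rw [← sub_nonneg]
  have : 1 - E p t = star (1 - E p t) * (1 - E p t) := by
    rw [star_one_sub_E, mul_sub, mul_one, sub_mul, one_mul, E_mul_E, sub_self, sub_zero]
  rw [this]
  exact star_mul_self_nonneg _

theorem sandwich_one_sub_E {t : ℝ} {B : BH p} (hB : B * E p t = E p t * B) :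
    sandwich (1 - E p t) B = B - sandwich (E p t) B := by
  have h : E p t * (B * E p t) = E p t * B := by rw [hB, ← mul_assoc, E_mul_E]
  rw [sandwich_apply, sandwich_apply, mul_sub, mul_one, sub_mul, one_mul, mul_sub, h, sub_self,
    sub_zero, hB]

/-- Since L(A) commutes with E(t, ∞), its off-diagonal corners vanish and the difference is
compression to the complementary projection. -/
theorem isCP_comp_tail {V : Type} [NormedAddCommGroup V] [InnerProductSpace ℂ V] [CompleteSpace V]
    {φ : BH p →ₗ[ℂ] (V →L[ℂ] V)} (hφ : IsCP φ) {L : BK p →ₗ[ℂ] BH p} (hL : IsCP L) {t : ℝ}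
    (hc : ∀ A, L A * E p t = E p t * L A) : IsCP (φ ∘ₗ L - φ ∘ₗ sandwich (E p t) ∘ₗ L) := by
  have h := (hφ.comp (isCP_sandwich (star_one_sub_E (p := p) t))).comp hL
  have e : φ ∘ₗ L - φ ∘ₗ sandwich (E p t) ∘ₗ L = (φ ∘ₗ sandwich (1 - E p t)) ∘ₗ L := by
    refine LinearMap.ext fun A => ?_
    simp only [LinearMap.sub_apply, LinearMap.comp_apply, sandwich_one_sub_E (hc A), map_sub]
  rw [e]
  exact h

theorem IsNormalMap.tendsto_sandwich_E {φ : BH p →ₗ[ℂ] BK p} (hφ : IsNormalMap φ) (B : BH p) :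
    Tendsto (fun s => φ (sandwich (E p s) B)) (𝓝[>] 0) (𝓝 (φ B)) := by
  rw [normalFun_coeff_iff] at hφ
  refine tendsto_of_entries fun i j => ?_
  have h := (hφ (stdVec i) (stdVec j)).tendsto_E_conj B
  simp only [coeffFunctional, LinearMap.comp_apply, LinearMap.coe_mk, AddHom.coe_mk,
    inner_stdVec] at h
  exact h

theorem tendsto_restr_toAlg {ω : Alg p →ₗ[ℂ] BK p} (hω : IsNormalMap (ω ∘ₗ toAlg p)) (B : BH p) :
    Tendsto (fun s => restr ω s (toAlg p B : BH p)) (𝓝[>] 0) (𝓝 (ω (toAlg p B))) := by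
  refine (hω.tendsto_sandwich_E B).congr' ?_
  filter_upwards [self_mem_nhdsWithin] with s hs
  rw [restr_toAlg hs]
  rfl

end Weights

/-! ### From limiting forms to q-weight maps of index zero; subordination. -/

section Converse

variable {p : ℕ} {J : Type} {g : J → ℝ → ℂ} {h : J → Fin p → H p} {ϑ : Alg p →ₗ[ℂ] BK p}
  {ρ : BH p →ₗ[ℂ] BK p}

theorem IsPreLimitingForm.isNormalMap_theta (hL : IsPreLimitingForm g h ϑ ρ) :
    IsNormalMap (ϑ ∘ₗ toAlg p) := by
  have hV : ∀ i, Summable fun k => ‖weightedVec (g k) (h k) i‖ ^ 2 := fun i => by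
    have h1 := (hL.theta_eq 1 i i).summable
    simp only [one_apply_eq_self, inner_self_eq_ofReal] at h1
    exact Complex.summable_ofReal.1 h1
  exact isNormalMap_of_hasSum hV fun A i j => hL.theta_eq A i j

/-- `ψ + ϑ|_t Λ`. -/
def coeffRestr (ψ : BK p →ₗ[ℂ] BK p) (ϑ : Alg p →ₗ[ℂ] BK p) (t : ℝ) : BK p →ₗ[ℂ] BK p :=
  ψ + restr ϑ t ∘ₗ Lam p

theorem norm_sandwich_E_le (t : ℝ) (A : BH p) : ‖sandwich (E p t) A‖ ≤ ‖A‖ := norm_E_conj_le t A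

/-- `w_t⁻¹ (ψ + ϑ|_t Λ) → ι` when `w_t → ∞`. -/
theorem IsPreLimitingForm.tendsto_coeffRestr (hL : IsPreLimitingForm g h ϑ ρ) (hp : 0 < p)
    {l : Filter ℝ} (hl : ∀ᶠ t in l, 0 < t) (hw : Tendsto (wt g) l atTop)
    (hρ : ∃ C : ℝ, ∀ A, ‖ρ A‖ ≤ C * ‖A‖) (ψ : BK p →ₗ[ℂ] BK p) (A : BK p) :
    Tendsto (fun t => (((wt g t)⁻¹ : ℝ) : ℂ) • coeffRestr ψ ϑ t A) l (𝓝 A) := by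
  have hinv : Tendsto (fun t => (wt g t)⁻¹) l (𝓝 0) := tendsto_inv_atTop_zero.comp hw
  have hY : Tendsto (fun t => (wt g t)⁻¹ * ‖crossOp g h t‖) l (𝓝 0) := by
    rw [Metric.tendsto_nhds]
    intro ε hε
    obtain ⟨C, hC⟩ := hL.norm_crossOp_le hp (half_pos hε)
    have h1 : Tendsto (fun t => (wt g t)⁻¹ * C) l (𝓝 0) := by
      simpa using hinv.mul_const C
    filter_upwards [hl, hw.eventually_gt_atTop 0, h1.eventually_lt_const (half_pos hε)]
      with t ht hwt hCt
    rw [dist_zero_right, Real.norm_of_nonneg (by positivity)]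
    calc (wt g t)⁻¹ * ‖crossOp g h t‖ ≤ (wt g t)⁻¹ * (ε / 2 * wt g t + C) := by
          gcongr
          exact hC t ht
      _ = ε / 2 + (wt g t)⁻¹ * C := by field_simp
      _ < ε := by linarith
  obtain ⟨C, hC⟩ := hρ
  have hbound : ∀ t, ‖ρ (sandwich (E p t) (Lam p A))‖ ≤ |C| * ‖Lam p A‖ := fun t =>
    calc ‖ρ (sandwich (E p t) (Lam p A))‖ ≤ C * ‖sandwich (E p t) (Lam p A)‖ := hC _
      _ ≤ |C| * ‖sandwich (E p t) (Lam p A)‖ := by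
        gcongr
        exact le_abs_self C
      _ ≤ |C| * ‖Lam p A‖ := by
        gcongr
        exact norm_sandwich_E_le t _
  rw [tendsto_iff_norm_sub_tendsto_zero]
  have hup : Tendsto (fun t => (wt g t)⁻¹ * (‖ψ A‖ + |C| * ‖Lam p A‖) +
      2 * ((wt g t)⁻¹ * ‖crossOp g h t‖) * ‖A‖) l (𝓝 0) := by
    simpa using (hinv.mul_const (‖ψ A‖ + |C| * ‖Lam p A‖)).add ((hY.const_mul 2).mul_const ‖A‖)
  refine tendsto_of_tendsto_of_tendsto_of_le_of_le' tendsto_const_nhds hup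
    (Eventually.of_forall fun _ => norm_nonneg _) ?_
  filter_upwards [hl, hw.eventually_gt_atTop 0] with t ht hwt
  have e : (((wt g t)⁻¹ : ℝ) : ℂ) • coeffRestr ψ ϑ t A - A = (((wt g t)⁻¹ : ℝ) : ℂ) •
      (ψ A + affineMul 0 (crossOp g h t) A + ρ (sandwich (E p t) (Lam p A))) := by
    have h1 : (((wt g t)⁻¹ : ℝ) : ℂ) • (((wt g t : ℝ) : ℂ) • A) = A := by
      rw [smul_smul, ← Complex.ofReal_mul, inv_mul_cancel₀ hwt.ne', Complex.ofReal_one, one_smul]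
    have h3 : coeffRestr ψ ϑ t A = ψ A + affineMul 0 (crossOp g h t) A +
        ρ (sandwich (E p t) (Lam p A)) + ((wt g t : ℝ) : ℂ) • A := by
      rw [coeffRestr, LinearMap.add_apply, LinearMap.comp_apply, hL.restr_Lam hp ht,
        affineMul_apply, affineMul_apply, Complex.ofReal_zero, zero_smul, zero_add]
      abel
    rw [h3, smul_add, h1, add_sub_cancel_right]
  rw [e, norm_smul, Complex.norm_real, Real.norm_of_nonneg (by positivity)]
  have h2 := norm_affineMul_le 0 (crossOp g h t) A
  rw [abs_zero, zero_add] at h2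
  calc _ ≤ (wt g t)⁻¹ * (‖ψ A‖ + 2 * ‖crossOp g h t‖ * ‖A‖ + |C| * ‖Lam p A‖) := by
        gcongr
        exact norm_add₃_le.trans (add_le_add (add_le_add le_rfl h2) (hbound t))
    _ = _ := by ring

theorem eventually_pos_nhdsGT : ∀ᶠ t : ℝ in 𝓝[>] 0, 0 < t := self_mem_nhdsWithin

/-- By the expansion, ψ + ϑ|_tΛ is ψ + ρΛ minus the completely positive tail of ρΛ plus a neutral
affine map. -/
theorem IsPreLimitingForm.condNeg_coeffRestr (hL : IsPreLimitingForm g h ϑ ρ) (hp : 0 < p)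
    {ψ : BK p →ₗ[ℂ] BK p} (hψ : CondNeg (ψ + ρ ∘ₗ Lam p)) {t : ℝ} (ht : 0 < t) :
    CondNeg (coeffRestr ψ ϑ t) := by
  have h1 := (hψ.sub_isCP (isCP_comp_tail hL.isCP_rho isCP_Lam fun A => Lam_mul_E A t)).add
    (condNeg_affineMul (wt g t) (crossOp g h t))
  have e : coeffRestr ψ ϑ t = ψ + ρ ∘ₗ Lam p - (ρ ∘ₗ Lam p - ρ ∘ₗ sandwich (E p t) ∘ₗ Lam p) +
      affineMul (wt g t) (crossOp g h t) := by
    refine LinearMap.ext fun A => ?_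
    simp only [coeffRestr, LinearMap.add_apply, LinearMap.sub_apply, LinearMap.comp_apply,
      hL.restr_Lam hp ht]
    abel
  rw [e]
  exact h1

theorem inner_self_pos_of_ne_zero {x : K p} (hx : x ≠ 0) : 0 < ⟪x, x⟫_ℂ := by
  rw [inner_self_eq_ofReal]
  have := norm_pos_iff.2 hx
  exact Complex.zero_lt_real.2 (by positivity)

/-- The minimum principle is used at X = ψ⁻¹(I), which is strictly positive because ψ⁻¹ is
completely positive and onto; there ψ + ϑ|_tΛ takes the value I + ϑ|_tΛ(X) ≥ I. -/
theorem IsPreLimitingForm.exists_equiv (hL : IsPreLimitingForm g h ϑ ρ) (hp : 0 < p)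
    {ψ : BK p ≃ₗ[ℂ] BK p} (hψ : IsCoefficientMap ϑ ρ ψ) {t : ℝ} (ht : 0 < t) :
    ∃ e : BK p ≃ₗ[ℂ] BK p, (e : BK p →ₗ[ℂ] BK p) = coeffRestr ψ ϑ t ∧
      IsCP (e.symm : BK p →ₗ[ℂ] BK p) := by
  have hX := hψ.inv_cp.pos_of_surjective ψ.symm.surjective
  refine (hL.condNeg_coeffRestr hp (isCondNeg_iff.1 hψ.condNeg_add) ht).exists_equiv hX ?_
  intro x hx
  have h1 : coeffRestr ψ ϑ t (ψ.symm 1) = 1 + restr ϑ t (Lam p (ψ.symm 1)) := by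
    simp [coeffRestr]
  have h2 : 0 ≤ restr ϑ t (Lam p (ψ.symm 1)) :=
    (isCP_restr hL.isCP_theta ht).nonneg (isCP_Lam.nonneg (hψ.inv_cp.nonneg zero_le_one))
  have h3 := inner_self_pos_of_ne_zero hx
  have h4 := inner_nonneg_of_nonneg h2 x
  have h5 : ⟪x, coeffRestr ψ ϑ t (ψ.symm 1) x⟫_ℂ = ⟪x, x⟫_ℂ +
      ⟪x, restr ϑ t (Lam p (ψ.symm 1)) x⟫_ℂ := by
    rw [h1, add_apply, inner_add_right, one_apply_eq_self]
  exact h5 ▸ add_pos_of_pos_of_nonneg h3 h4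

/-- The factorization ι + ψ⁻¹ϑ|_tΛ = ψ⁻¹(ψ + ϑ|_tΛ) transfers all questions about π_t^# to the
inverse of ψ + ϑ|_tΛ. -/
theorem onePlus_invComp_unit {ψ e : BK p ≃ₗ[ℂ] BK p} {t : ℝ}
    (he : (e : BK p →ₗ[ℂ] BK p) = coeffRestr ψ ϑ t) :
    IsUnit (onePlus (invComp ψ ϑ) t) ∧
      bdryRep (invComp ψ ϑ) t = (e.symm : BK p →ₗ[ℂ] BK p) ∘ₗ restr ϑ t := by
  have h1 : onePlus (invComp ψ ϑ) t = (ψ.symm : BK p →ₗ[ℂ] BK p) ∘ₗ (e : BK p →ₗ[ℂ] BK p) := by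
    refine LinearMap.ext fun A => ?_
    rw [he]
    simp [onePlus, coeffRestr, invComp, restr]
  let u : (Module.End ℂ (BK p))ˣ :=
    { val := (ψ.symm : BK p →ₗ[ℂ] BK p) ∘ₗ (e : BK p →ₗ[ℂ] BK p)
      inv := (e.symm : BK p →ₗ[ℂ] BK p) ∘ₗ (ψ : BK p →ₗ[ℂ] BK p)
      val_inv := by
        refine LinearMap.ext fun A => ?_
        simp
      inv_val := by
        refine LinearMap.ext fun A => ?_
        simp }
  have hu : onePlus (invComp ψ ϑ) t = u := h1
  refine ⟨hu ▸ u.isUnit, ?_⟩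
  rw [bdryRep, hu, Ring.inverse_unit]
  refine LinearMap.ext fun A => ?_
  simp [u, restr, invComp]

theorem restr_oneSubLam {ω : Alg p →ₗ[ℂ] BK p} {t : ℝ} (ht : 0 < t) :
    restr ω t (1 - Lam p 1) = ω (toAlg p (E p t)) := by
  rw [← oneSubLam_coe, ← toAlg_one, restr_toAlg ht, one_mul, E_mul_E]

theorem IsPreLimitingForm.isQWeightMap (hL : IsPreLimitingForm g h ϑ ρ) (hp : 0 < p)
    {ψ : BK p ≃ₗ[ℂ] BK p} (hψ : IsCoefficientMap ϑ ρ ψ) : IsQWeightMap (invComp ψ ϑ) := by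
  have e : invComp ψ ϑ ∘ₗ toAlg p = (ψ.symm : BK p →ₗ[ℂ] BK p) ∘ₗ (ϑ ∘ₗ toAlg p) :=
    LinearMap.comp_assoc _ _ _
  have hcp : IsCP (invComp ψ ϑ ∘ₗ toAlg p) := by
    rw [e]
    exact hψ.inv_cp.comp hL.isCP_theta
  have hrep : ∀ t : ℝ, 0 < t → IsCP (bdryRep (invComp ψ ϑ) t) := by
    intro t ht
    obtain ⟨e, he, hecp⟩ := hL.exists_equiv hp hψ ht
    rw [(onePlus_invComp_unit he).2]
    exact hecp.comp (isCP_restr hL.isCP_theta ht)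
  refine ⟨by rw [IsBWeightMap, e]; exact hL.isNormalMap_theta.comp_left _, isCPWeight_of_isCP hcp, fun t ht => ?_, hrep,
    fun t ht => (hrep t ht).norm_le ?_, fun t ht => ?_⟩
  · obtain ⟨e, he, -⟩ := hL.exists_equiv hp hψ ht
    exact (onePlus_invComp_unit he).1
  · obtain ⟨e, he, hecp⟩ := hL.exists_equiv hp hψ ht
    rw [(onePlus_invComp_unit he).2, LinearMap.comp_apply, ← sub_nonneg]
    have h1 : (1 : BK p) - e.symm (restr ϑ t 1) = e.symm (e 1 - restr ϑ t 1) := by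
      rw [map_sub, LinearEquiv.symm_apply_apply]
    have h2 : e 1 = ψ 1 + restr ϑ t (Lam p 1) := LinearMap.congr_fun he 1
    -- Contractivity thus amounts to ψ(I) ≥ ϑ|_t(I - Λ), which follows from the hypothesis at t = 0
    -- by monotonicity in t.
    have h3 : e 1 - restr ϑ t 1 = ψ 1 - restr ϑ t (1 - Lam p 1) := by
      rw [h2, map_sub]
      abel
    have h4 : restr ϑ t (1 - Lam p 1) ≤ ψ 1 := by
      rw [restr_oneSubLam ht]
      refine le_trans ?_ hψ.le_one
      rw [← toAlg_one]
      exact hL.isCP_theta.mono (E_le_one t)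
    refine le_of_le_of_eq ?_ h1.symm
    rw [h3]
    exact hecp.nonneg (sub_nonneg.2 h4)
  · obtain ⟨e, he, -⟩ := hL.exists_equiv hp hψ ht
    rw [(onePlus_invComp_unit he).2]
    exact (isNormalMap_restr hL.isNormalMap_theta ht).comp_left _

theorem isUnital_invComp_iff (ψ : BK p ≃ₗ[ℂ] BK p) (ϑ : Alg p →ₗ[ℂ] BK p) :
    IsUnital (invComp ψ ϑ) ↔ ψ 1 = ϑ (oneSubLam p) := by
  rw [IsUnital, invComp, LinearMap.comp_apply]
  exact (ψ.symm_apply_eq).trans eq_comm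

/-- `w_t (ψ + ϑ|_t Λ)⁻¹ → ι`. -/
theorem IsLimitingForm.tendsto_symm (hL : IsLimitingForm g h ϑ ρ) (hp : 0 < p)
    {ψ : BK p →ₗ[ℂ] BK p} {e : ℝ → BK p ≃ₗ[ℂ] BK p}
    (he : ∀ t, 0 < t → (e t : BK p →ₗ[ℂ] BK p) = coeffRestr ψ ϑ t) {y : ℝ → BK p} {y₀ : BK p}
    (hy : Tendsto y (𝓝[>] 0) (𝓝 y₀)) :
    Tendsto (fun t => ((wt g t : ℝ) : ℂ) • (e t).symm (y t)) (𝓝[>] 0) (𝓝 y₀) := by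
  have h1 := hL.pre.tendsto_coeffRestr hp eventually_pos_nhdsGT hL.wt_tendsto hL.rho_bdd ψ
  refine tendsto_inverse_apply
    (A := fun t => (((wt g t)⁻¹ : ℝ) : ℂ) • coeffRestr ψ ϑ t)
    (B := fun t => ((wt g t : ℝ) : ℂ) • ((e t).symm : BK p →ₗ[ℂ] BK p)) (A₀ := 1) (B₀ := 1)
    ?_ ⟨one_mul 1, one_mul 1⟩ h1 hy
  filter_upwards [eventually_pos_nhdsGT, hL.wt_tendsto.eventually_gt_atTop 0] with t ht hw
  rw [← he t ht, smul_mul_smul_comm, smul_mul_smul_comm, ← Complex.ofReal_mul,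
    ← Complex.ofReal_mul, inv_mul_cancel₀ hw.ne', mul_inv_cancel₀ hw.ne', Complex.ofReal_one,
    one_smul, one_smul]
  exact ⟨LinearMap.ext fun A => (e t).apply_symm_apply A,
    LinearMap.ext fun A => (e t).symm_apply_apply A⟩

theorem IsLimitingForm.tendsto_symm_zero (hL : IsLimitingForm g h ϑ ρ) (hp : 0 < p)
    {ψ : BK p →ₗ[ℂ] BK p} {e : ℝ → BK p ≃ₗ[ℂ] BK p}
    (he : ∀ t, 0 < t → (e t : BK p →ₗ[ℂ] BK p) = coeffRestr ψ ϑ t) (y : BK p) :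
    Tendsto (fun t => (e t).symm y) (𝓝[>] 0) (𝓝 0) :=
  tendsto_zero_of_smul hL.wt_tendsto (hL.tendsto_symm hp he (tendsto_const_nhds (x := y)))

theorem IsLimitingForm.exists_family (hL : IsLimitingForm g h ϑ ρ) (hp : 0 < p)
    {ψ : BK p ≃ₗ[ℂ] BK p} (hψ : IsCoefficientMap ϑ ρ ψ) :
    ∃ e : ℝ → BK p ≃ₗ[ℂ] BK p, ∀ t, 0 < t →
      (e t : BK p →ₗ[ℂ] BK p) = coeffRestr ψ ϑ t ∧ IsCP ((e t).symm : BK p →ₗ[ℂ] BK p) := by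
  have : ∀ t : ℝ, ∃ e : BK p ≃ₗ[ℂ] BK p, 0 < t →
      (e : BK p →ₗ[ℂ] BK p) = coeffRestr ψ ϑ t ∧ IsCP (e.symm : BK p →ₗ[ℂ] BK p) := by
    intro t
    by_cases ht : 0 < t
    · obtain ⟨e, he⟩ := hL.pre.exists_equiv hp hψ ht
      exact ⟨e, fun _ => he⟩
    · exact ⟨LinearEquiv.refl ℂ _, fun h => absurd h ht⟩
  choose e he using this
  exact ⟨e, he⟩

theorem isNormalFunctional_zero : IsNormalFunctional (0 : BH p →ₗ[ℂ] ℂ) :=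
  normalFun_zero.isNormalFunctional

/-- For t ≤ s, π_t^#(A|_s) is (ψ + ϑ|_tΛ)⁻¹ applied to the fixed element ϑ|_s(A), and these inverses
tend to zero like 1/w_t. -/
theorem IsLimitingForm.isIndexZero (hL : IsLimitingForm g h ϑ ρ) (hp : 0 < p)
    {ψ : BK p ≃ₗ[ℂ] BK p} (hψ : IsCoefficientMap ϑ ρ ψ) : IsIndexZero (invComp ψ ϑ) := by
  obtain ⟨e, he⟩ := hL.exists_family hp hψ
  refine ⟨isCP_zero, fun f g => ?_, fun s hs A => ?_⟩
  · rw [LinearMap.comp_zero]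
    exact isNormalFunctional_zero
  · rw [LinearMap.zero_apply]
    refine (hL.tendsto_symm_zero hp (fun t ht => (he t ht).1) (restr ϑ s A)).congr' ?_
    filter_upwards [eventually_pos_nhdsGT, Ioc_mem_nhdsGT hs] with t ht hts
    rw [(onePlus_invComp_unit (he t ht).1).2, LinearMap.comp_apply,
      restr_sandwich_E ht hts.2]
    rfl

theorem IsLimitingForm.range_eq_top (hL : IsLimitingForm g h ϑ ρ) (hp : 0 < p)
    (ψ : BK p ≃ₗ[ℂ] BK p) : LinearMap.range (invComp ψ ϑ) = ⊤ := by
  -- With coefficient map 0 the limit says w_t⁻¹ϑ|_tΛ → ι, so ϑ|_tΛ is invertible for some t and ϑ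
  -- is onto.
  have h1 := hL.pre.tendsto_coeffRestr hp eventually_pos_nhdsGT hL.wt_tendsto hL.rho_bdd 0
  have h2 := eventually_isUnit_of_tendsto (A₀ := 1)
    (A := fun t => (((wt g t)⁻¹ : ℝ) : ℂ) • coeffRestr 0 ϑ t) h1 isUnit_one
  obtain ⟨t, ht⟩ := h2.exists
  have hs := ((Module.End.isUnit_iff _).1 ht).2
  rw [LinearMap.range_eq_top]
  intro A
  obtain ⟨B, hB⟩ := hs (ψ A)
  refine ⟨(((wt g t)⁻¹ : ℝ) : ℂ) • cutoff p t (Lam p B), ?_⟩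
  rw [invComp, LinearMap.comp_apply, map_smul]
  rw [coeffRestr, zero_add] at hB
  have h3 : (((wt g t)⁻¹ : ℝ) : ℂ) • ϑ (cutoff p t (Lam p B)) = ψ A := hB
  rw [h3]
  exact ψ.symm_apply_apply A

/-- With e = ψ + ϑ|_tΛ and e' = ψ' + ϑ|_tΛ, the resolvent identity reads π_t^# - π_t'^# = e⁻¹(ψ' -
ψ)e'⁻¹ϑ|_t, a composition of completely positive maps when ψ ≤ ψ'. -/
theorem IsLimitingForm.isQSubordinate_iff (hL : IsLimitingForm g h ϑ ρ) (hp : 0 < p)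
    {ψ ψ' : BK p ≃ₗ[ℂ] BK p} (hψ : IsCoefficientMap ϑ ρ ψ) (hψ' : IsCoefficientMap ϑ ρ ψ') :
    IsQSubordinate (invComp ψ' ϑ) (invComp ψ ϑ) ↔
      IsCP ((ψ' : BK p →ₗ[ℂ] BK p) - (ψ : BK p →ₗ[ℂ] BK p)) := by
  obtain ⟨e, he⟩ := hL.exists_family hp hψ
  obtain ⟨e', he'⟩ := hL.exists_family hp hψ'
  set D : BK p →ₗ[ℂ] BK p := (ψ' : BK p →ₗ[ℂ] BK p) - (ψ : BK p →ₗ[ℂ] BK p) with hD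
  have hee : ∀ t, 0 < t → ∀ A, e' t A = e t A + D A := by
    intro t ht A
    have h1 : e t A = ψ A + restr ϑ t (Lam p A) := LinearMap.congr_fun (he t ht).1 A
    have h2 : e' t A = ψ' A + restr ϑ t (Lam p A) := LinearMap.congr_fun (he' t ht).1 A
    have h3 : D A = ψ' A - ψ A := rfl
    rw [h1, h2, h3]
    abel
  have hdiff : ∀ t, 0 < t → bdryRep (invComp ψ ϑ) t - bdryRep (invComp ψ' ϑ) t =
      ((e t).symm : BK p →ₗ[ℂ] BK p) ∘ₗ D ∘ₗ ((e' t).symm : BK p →ₗ[ℂ] BK p) ∘ₗ restr ϑ t := by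
    intro t ht
    rw [(onePlus_invComp_unit (he t ht).1).2, (onePlus_invComp_unit (he' t ht).1).2]
    refine LinearMap.ext fun A => (e t).injective ?_
    have h1 := hee t ht ((e' t).symm (restr ϑ t A))
    rw [LinearEquiv.apply_symm_apply] at h1
    simp only [LinearMap.sub_apply, LinearMap.comp_apply, LinearEquiv.coe_coe, map_sub,
      LinearEquiv.apply_symm_apply]
    rw [sub_eq_iff_eq_add, add_comm]
    exact h1
  refine ⟨fun hsub => ?_, fun hcp => ⟨hL.pre.isQWeightMap hp hψ', hL.pre.isQWeightMap hp hψ,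
    fun t ht => ?_⟩⟩
  -- After multiplication by w_t the outer factor w_t e⁻¹ tends to ι. The inner one e'⁻¹ϑ|_tΛ = ι -
  -- e'⁻¹ψ' also tends to ι, so the limit is ψ' - ψ.
  · refine isCP_of_tendsto (l := 𝓝[>] (0 : ℝ)) (φ := fun t => ((wt g t : ℝ) : ℂ) •
      ((bdryRep (invComp ψ ϑ) t - bdryRep (invComp ψ' ϑ) t) ∘ₗ Lam p)) ?_ fun A => ?_
    · filter_upwards [eventually_pos_nhdsGT, hL.wt_tendsto.eventually_gt_atTop 0] with t ht hw
      exact ((hsub.cp t ht).comp isCP_Lam).smul hw.le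
    · have h1 : Tendsto (fun t => D ((e' t).symm (restr ϑ t (Lam p A)))) (𝓝[>] 0) (𝓝 (D A)) := by
        have h2 : Tendsto (fun t => A - (e' t).symm (ψ' A)) (𝓝[>] 0) (𝓝 A) := by
          simpa using (tendsto_const_nhds (x := A)).sub
            (hL.tendsto_symm_zero hp (fun t ht => (he' t ht).1) (ψ' A))
        have h3 : Continuous D := D.continuous_of_finiteDimensional
        refine ((h3.tendsto A).comp h2).congr' ?_
        filter_upwards [eventually_pos_nhdsGT] with t ht
        refine congrArg D ?_
        have h4 : e' t A = ψ' A + restr ϑ t (Lam p A) := LinearMap.congr_fun (he' t ht).1 A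
        apply (e' t).injective
        rw [map_sub, LinearEquiv.apply_symm_apply, LinearEquiv.apply_symm_apply, h4,
          add_sub_cancel_left]
      refine (hL.tendsto_symm hp (fun t ht => (he t ht).1) h1).congr' ?_
      filter_upwards [eventually_pos_nhdsGT] with t ht
      rw [hdiff t ht]
      rfl
  · rw [hdiff t ht]
    exact (he t ht).2.comp (hcp.comp ((he' t ht).2.comp (isCP_restr hL.pre.isCP_theta ht)))

end Converse

/-! ### The projection p⁻¹[U_ij] of a system of matrix units. -/

section Center

set_option linter.unusedSectionVars false

variable {W : Type} [NormedAddCommGroup W] [InnerProductSpace ℂ W] [CompleteSpace W] {p : ℕ}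

/-- The relations satisfied by an (unnormalized) system of `p × p` matrix units in `B(W)`. -/
structure IsMatrixUnits (U : Fin p → Fin p → W →L[ℂ] W) : Prop where
  star_eq : ∀ i j, star (U i j) = U j i
  mul_eq : ∀ i j k, U i j * U j k = U i k

/-- The image of `x ∈ W^p` under the projection `p⁻¹ [U_ij]`. -/
def center (U : Fin p → Fin p → W →L[ℂ] W) (x : Fin p → W) (i : Fin p) : W :=
  (p : ℂ)⁻¹ • ∑ j, U i j (x j)

/-- The quadratic form of the projection `p⁻¹ [U_ij]`. -/
def centerForm (U : Fin p → Fin p → W →L[ℂ] W) (x : Fin p → W) : ℂ :=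
  (p : ℂ)⁻¹ * ∑ i, ∑ j, ⟪x i, U i j (x j)⟫_ℂ

variable {U : Fin p → Fin p → W →L[ℂ] W}

theorem IsMatrixUnits.inner_left (hU : IsMatrixUnits U) (i j : Fin p) (x y : W) :
    ⟪U i j x, y⟫_ℂ = ⟪x, U j i y⟫_ℂ := by
  rw [← hU.star_eq i j, ContinuousLinearMap.star_eq_adjoint,
    ContinuousLinearMap.adjoint_inner_right]

theorem sum_inner_center (x : Fin p → W) : ∑ i, ⟪x i, center U x i⟫_ℂ = centerForm U x := by
  simp only [center, centerForm, inner_smul_right, inner_sum, Finset.mul_sum]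

theorem IsMatrixUnits.sum_center_inner (hU : IsMatrixUnits U) (x : Fin p → W) :
    ∑ i, ⟪center U x i, x i⟫_ℂ = centerForm U x := by
  simp only [center, centerForm, inner_smul_left, sum_inner, Finset.mul_sum, hU.inner_left,
    map_inv₀, Complex.conj_natCast]
  exact Finset.sum_comm

theorem IsMatrixUnits.sum_apply_center (hU : IsMatrixUnits U) (hp : 0 < p) (x : Fin p → W)
    (j : Fin p) : ∑ i, U j i (center U x i) = ∑ l, U j l (x l) := by
  have hp' : (p : ℂ) ≠ 0 := Nat.cast_ne_zero.2 hp.ne'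
  have h1 : ∀ i, U j i (center U x i) = (p : ℂ)⁻¹ • ∑ l, U j l (x l) := by
    intro i
    rw [center, map_smul, map_sum]
    congr 1
    refine Finset.sum_congr rfl fun l _ => ?_
    rw [← mul_apply_eq_comp, hU.mul_eq]
  rw [Finset.sum_congr rfl fun i _ => h1 i, Finset.sum_const, Finset.card_univ, Fintype.card_fin,
    ← Nat.cast_smul_eq_nsmul ℂ, smul_smul, mul_inv_cancel₀ hp', one_smul]

/-- Idempotence of the projection: U_ji U_il = U_jl, and the p equal terms cancel the factor p⁻¹.
The Pythagorean identity for x and its centre follows. -/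
theorem IsMatrixUnits.sum_center_center (hU : IsMatrixUnits U) (hp : 0 < p) (x : Fin p → W) :
    ∑ i, ⟪center U x i, center U x i⟫_ℂ = centerForm U x := by
  have h1 : ∀ i, ⟪center U x i, center U x i⟫_ℂ =
      (p : ℂ)⁻¹ * ∑ j, ⟪x j, U j i (center U x i)⟫_ℂ := by
    intro i
    have h2 : ∀ y, ⟪center U x i, y⟫_ℂ = (p : ℂ)⁻¹ * ∑ j, ⟪x j, U j i y⟫_ℂ := fun y => by
      simp only [center, inner_smul_left, sum_inner, hU.inner_left, map_inv₀, Complex.conj_natCast]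
    exact h2 _
  rw [Finset.sum_congr rfl fun i _ => h1 i, ← Finset.mul_sum, Finset.sum_comm, centerForm]
  congr 1
  refine Finset.sum_congr rfl fun j _ => ?_
  rw [← inner_sum, hU.sum_apply_center hp, inner_sum]

theorem IsMatrixUnits.sum_norm_center (hU : IsMatrixUnits U) (hp : 0 < p) (x : Fin p → W) :
    ((∑ i, ‖center U x i‖ ^ 2 : ℝ) : ℂ) = centerForm U x := by
  rw [← hU.sum_center_center hp, Complex.ofReal_sum]
  exact Finset.sum_congr rfl fun i _ => (inner_self_eq_ofReal _).symm

theorem IsMatrixUnits.sum_norm_sub_center (hU : IsMatrixUnits U) (hp : 0 < p) (x : Fin p → W) :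
    ((∑ i, ‖x i - center U x i‖ ^ 2 : ℝ) : ℂ) = ∑ i, ⟪x i, x i⟫_ℂ - centerForm U x := by
  rw [Complex.ofReal_sum]
  simp only [← inner_self_eq_ofReal, inner_sub_left, inner_sub_right, Finset.sum_sub_distrib,
    sum_inner_center, hU.sum_center_inner, hU.sum_center_center hp]
  ring

/-- This relation for the complementary part is the source of the condition ∑_i (h_ik)_i = 0. -/
theorem IsMatrixUnits.sum_apply_sub_center (hU : IsMatrixUnits U) (hp : 0 < p) (x : Fin p → W)
    (j : Fin p) : ∑ i, U j i (x i - center U x i) = 0 := by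
  simp only [map_sub, Finset.sum_sub_distrib, hU.sum_apply_center hp, sub_self]

theorem center_map {S : W →L[ℂ] W} (hS : ∀ i j, U i j * S = S * U i j) (x : Fin p → W)
    (i : Fin p) : center U (fun i => S (x i)) i = S (center U x i) := by
  simp only [center, map_smul, map_sum, ← mul_apply_eq_comp, hS]

end Center

/-! ### The defect functional and its bound for boundary representations. -/

section MatrixUnits

variable {p : ℕ}

theorem isMatrixUnits_matUnit : IsMatrixUnits (matUnit : Fin p → Fin p → BK p) where
  star_eq i j := by
    rw [matUnit, matUnit, ContinuousLinearMap.star_eq_adjoint,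
      InnerProductSpace.adjoint_rankOne]
  mul_eq i j k := by
    refine ContinuousLinearMap.ext fun f => ?_
    rw [mul_apply_eq_comp, matUnit_apply, matUnit_apply, matUnit_apply]
    simp [stdVec]

theorem isMatrixUnits_amp : IsMatrixUnits (fun i j : Fin p => amp (matUnit i j)) where
  star_eq i j := by rw [star_amp, isMatrixUnits_matUnit.star_eq]
  mul_eq i j k := by rw [← amp_mul, isMatrixUnits_matUnit.mul_eq]

/-- `∑_i (e_i, φ(I) e_i)`. -/
def diagSum (φ : BK p →ₗ[ℂ] BK p) : ℂ := ∑ i, ⟪stdVec i, φ 1 (stdVec i)⟫_ℂ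

/-- `p⁻¹ ∑_ij (e_i, φ(e_ij) e_j)`. -/
def unitSum (φ : BK p →ₗ[ℂ] BK p) : ℂ :=
  (p : ℂ)⁻¹ * ∑ i, ∑ j, ⟪stdVec i, φ (matUnit i j) (stdVec j)⟫_ℂ

/-- The defect functional; it vanishes on the identity map and is positive on completely positive
maps. -/
def defect (φ : BK p →ₗ[ℂ] BK p) : ℂ := diagSum φ - unitSum φ

theorem diagSum_sub (φ ψ : BK p →ₗ[ℂ] BK p) : diagSum (φ - ψ) = diagSum φ - diagSum ψ := by
  simp only [diagSum, LinearMap.sub_apply, sub_apply, inner_sub_right, Finset.sum_sub_distrib]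

theorem unitSum_sub (φ ψ : BK p →ₗ[ℂ] BK p) : unitSum (φ - ψ) = unitSum φ - unitSum ψ := by
  simp only [unitSum, LinearMap.sub_apply, sub_apply, inner_sub_right, Finset.sum_sub_distrib,
    mul_sub]

theorem defect_sub (φ ψ : BK p →ₗ[ℂ] BK p) : defect (φ - ψ) = defect φ - defect ψ := by
  rw [defect, defect, defect, diagSum_sub, unitSum_sub]
  ring

theorem diagSum_smul (c : ℂ) (φ : BK p →ₗ[ℂ] BK p) : diagSum (c • φ) = c * diagSum φ := by
  simp only [diagSum, LinearMap.smul_apply, smul_apply, inner_smul_right, Finset.mul_sum]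

theorem unitSum_smul (c : ℂ) (φ : BK p →ₗ[ℂ] BK p) : unitSum (c • φ) = c * unitSum φ := by
  simp only [unitSum, LinearMap.smul_apply, smul_apply, inner_smul_right, ← Finset.mul_sum]
  ring

theorem defect_smul (c : ℂ) (φ : BK p →ₗ[ℂ] BK p) : defect (c • φ) = c * defect φ := by
  rw [defect, defect, diagSum_smul, unitSum_smul, mul_sub]

/-- Both sums equal p: the diagonal one has p unit terms, the other is p⁻¹ times p² unit terms. -/
theorem defect_id (hp : 0 < p) : defect (LinearMap.id : BK p →ₗ[ℂ] BK p) = 0 := by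
  have hp' : (p : ℂ) ≠ 0 := Nat.cast_ne_zero.2 hp.ne'
  simp [defect, diagSum, unitSum, matUnit_apply, stdVec, hp']

section Limits

variable {α : Type*} {l : Filter α} {φ : α → BK p →ₗ[ℂ] BK p} {φ₀ : BK p →ₗ[ℂ] BK p}

theorem tendsto_inner_apply {X : α → BK p} {X₀ : BK p} (h : Tendsto X l (𝓝 X₀)) (x y : K p) :
    Tendsto (fun a => ⟪x, X a y⟫_ℂ) l (𝓝 ⟪x, X₀ y⟫_ℂ) :=
  tendsto_const_nhds.inner
    (((ContinuousLinearMap.apply ℂ (K p) y).continuous.tendsto X₀).comp h)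

theorem tendsto_diagSum (h : ∀ A, Tendsto (fun a => φ a A) l (𝓝 (φ₀ A))) :
    Tendsto (fun a => diagSum (φ a)) l (𝓝 (diagSum φ₀)) :=
  tendsto_finsetSum _ fun _ _ => tendsto_inner_apply (h _) _ _

theorem tendsto_unitSum (h : ∀ A, Tendsto (fun a => φ a A) l (𝓝 (φ₀ A))) :
    Tendsto (fun a => unitSum (φ a)) l (𝓝 (unitSum φ₀)) :=
  (tendsto_finsetSum _ fun _ _ => tendsto_finsetSum _ fun _ _ =>
    tendsto_inner_apply (h _) _ _).const_mul _

theorem tendsto_defect (h : ∀ A, Tendsto (fun a => φ a A) l (𝓝 (φ₀ A))) :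
    Tendsto (fun a => defect (φ a)) l (𝓝 (defect φ₀)) :=
  (tendsto_diagSum h).sub (tendsto_unitSum h)

end Limits

theorem inv_natCast_nonneg (n : ℕ) : (0 : ℂ) ≤ (n : ℂ)⁻¹ := by
  rw [← Complex.ofReal_natCast, ← Complex.ofReal_inv]
  exact Complex.zero_le_real.2 (by positivity)

theorem IsCP.unitSum_nonneg (hp : 0 < p) {φ : BK p →ₗ[ℂ] BK p} (hφ : IsCP φ) :
    0 ≤ unitSum φ := by
  have hp' : (p : ℂ) ≠ 0 := Nat.cast_ne_zero.2 hp.ne'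
  refine mul_nonneg (inv_natCast_nonneg p) ?_
  refine hφ.blockForm_nonneg (m := matUnit) (fun x => ?_) stdVec
  have h1 := isMatrixUnits_matUnit.sum_norm_center hp x
  have h2 : blockForm matUnit x = (p : ℂ) * ((∑ i, ‖center matUnit x i‖ ^ 2 : ℝ) : ℂ) := by
    rw [h1, centerForm, mul_inv_cancel_left₀ hp', blockForm]
  rw [h2]
  exact mul_nonneg (Nat.cast_nonneg p) (Complex.zero_le_real.2 (by positivity))

theorem blockForm_unit_defect (x : Fin p → K p) :
    blockForm (fun i j => (if i = j then (1 : BK p) else 0) - (p : ℂ)⁻¹ • matUnit i j) x =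
      ∑ i, ⟪x i, x i⟫_ℂ - centerForm matUnit x := by
  rw [blockForm_sub, blockForm_diag, centerForm]
  congr 1
  simp only [blockForm, smul_apply, inner_smul_right, Finset.mul_sum]

/-- The defect evaluates φ on the operator matrix δ_ij I - p⁻¹e_ij, which is a projection and so
positive. -/
theorem IsCP.defect_nonneg (hp : 0 < p) {φ : BK p →ₗ[ℂ] BK p} (hφ : IsCP φ) : 0 ≤ defect φ := by
  have h := hφ.blockForm_nonneg
    (m := fun i j => (if i = j then (1 : BK p) else 0) - (p : ℂ)⁻¹ • matUnit i j) (fun x => by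
      rw [blockForm_unit_defect, ← isMatrixUnits_matUnit.sum_norm_sub_center hp]
      exact Complex.zero_le_real.2 (by positivity)) stdVec
  refine h.trans_eq ?_
  have e : ∀ i j : Fin p, φ ((if i = j then (1 : BK p) else 0) - (p : ℂ)⁻¹ • matUnit i j) =
      (if i = j then φ 1 else 0) - (p : ℂ)⁻¹ • φ (matUnit i j) := by
    intro i j
    rw [map_sub, map_smul, apply_ite φ, map_zero]
  simp only [e]
  rw [blockForm_sub, blockForm_diag]
  rw [defect, diagSum, unitSum]
  congr 1
  simp only [blockForm, smul_apply, inner_smul_right, Finset.mul_sum]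

theorem sandwich_sqrtOp_amp (A : BK p) : sandwich (sqrtOp p) (amp A) = amp A - Lam p A := by
  have h1 : sqrtOp p * sqrtOp p = 1 - expOp p := by
    rw [← Lam_one]
    exact one_sub_Lam_eq p
  rw [sandwich_apply, amp_mul_sqrtOp, ← mul_assoc, h1, sub_mul, one_mul, Lam_apply]

theorem isCP_ampₗ : IsCP (ampₗ p) :=
  isCP_of_factor amp fun A B => by rw [ampₗ_apply, amp_mul, star_amp]

/-- Bound for the defect of the cut off of a boundary representation. -/
theorem IsCP.defect_cutoff_le (hp : 0 < p) {π : BH p →ₗ[ℂ] BK p} (hπ : IsCP π) (h1 : π 1 ≤ 1)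
    {T : BK p →ₗ[ℂ] BK p} (hT : T = LinearMap.id - π ∘ₗ Lam p) (s : ℝ) :
    defect (π ∘ₗ sandwich (E p s) ∘ₗ ampₗ p) ≤ unitSum T := by
  -- Removing the cutoff only increases the defect, because the discarded tail is completely
  -- positive.
  have a1 : 0 ≤ defect (π ∘ₗ ampₗ p) - defect (π ∘ₗ sandwich (E p s) ∘ₗ ampₗ p) := by
    rw [← defect_sub]
    exact (isCP_comp_tail hπ isCP_ampₗ fun A => amp_mul_E A s).defect_nonneg hp
  have hS : IsCP (π ∘ₗ sandwich (sqrtOp p) ∘ₗ ampₗ p) :=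
    hπ.comp ((isCP_sandwich star_sqrtOp).comp isCP_ampₗ)
  -- This uses A ⊗ I = (I - Λ)^{1/2}(A ⊗ I)(I - Λ)^{1/2} + Λ(A). The defect of πΛ is that of -T,
  -- since the identity map has none.
  have a2 : defect (π ∘ₗ sandwich (sqrtOp p) ∘ₗ ampₗ p) =
      defect (π ∘ₗ ampₗ p) - defect (π ∘ₗ Lam p) := by
    rw [← defect_sub]
    congr 1
    refine LinearMap.ext fun A => ?_
    simp only [LinearMap.comp_apply, LinearMap.sub_apply, ampₗ_apply, sandwich_sqrtOp_amp, map_sub]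
  have a3 : defect (π ∘ₗ Lam p) = - defect T := by
    rw [hT, defect_sub, defect_id hp, zero_sub, neg_neg]
  -- Contractivity enters here: π(I - Λ) ≤ I - πΛ(I) = T(I).
  have a4 : diagSum (π ∘ₗ sandwich (sqrtOp p) ∘ₗ ampₗ p) ≤ diagSum T := by
    refine Finset.sum_le_sum fun i _ => inner_mono ?_ _
    have e : (π ∘ₗ sandwich (sqrtOp p) ∘ₗ ampₗ p) 1 = π 1 - π (Lam p 1) := by
      rw [LinearMap.comp_apply, LinearMap.comp_apply, ampₗ_apply, sandwich_sqrtOp_amp, map_sub,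
        amp_one]
    have e' : T 1 = 1 - π (Lam p 1) := by rw [hT]; rfl
    rw [e, e']
    exact sub_le_sub_right h1 _
  have a5 := hS.unitSum_nonneg hp
  have e1 : defect (π ∘ₗ sandwich (sqrtOp p) ∘ₗ ampₗ p) =
    diagSum (π ∘ₗ sandwich (sqrtOp p) ∘ₗ ampₗ p) -
      unitSum (π ∘ₗ sandwich (sqrtOp p) ∘ₗ ampₗ p) := rfl
  have e2 : defect T = diagSum T - unitSum T := rfl
  calc defect (π ∘ₗ sandwich (E p s) ∘ₗ ampₗ p) ≤ defect (π ∘ₗ ampₗ p) := sub_nonneg.1 a1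
    _ = diagSum (π ∘ₗ sandwich (sqrtOp p) ∘ₗ ampₗ p) -
      unitSum (π ∘ₗ sandwich (sqrtOp p) ∘ₗ ampₗ p) - defect T := by
        rw [← e1, a2, a3]
        ring
    _ ≤ diagSum T - 0 - defect T := by gcongr
    _ = unitSum T := by
        rw [e2]
        ring

end MatrixUnits

/-! ### Solving (I - Λ)^{1/2}F = Z. -/

section Unweighting

variable {p : ℕ}

theorem E_invSqrtOp {s t : ℝ} (ht : 0 < t) (h : t ≤ s) :
    E p s * invSqrtOp p t = invSqrtOp p s := by
  have hs := ht.trans_le h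
  rw [invSqrtOp, dif_pos ht, invSqrtOp, dif_pos hs]
  refine mulOp_mul_mulOp _ _ _ fun x _ => ?_
  by_cases hx : s ≤ x
  · rw [Set.indicator_of_mem (Set.mem_Ici.2 hx), Set.indicator_of_mem (Set.mem_Ici.2 (h.trans hx)),
      Set.indicator_of_mem (Set.mem_Ici.2 hx), one_mul]
  · rw [Set.indicator_of_notMem (s := Set.Ici s) (by simpa using hx), zero_mul,
      Set.indicator_of_notMem (s := Set.Ici s) (by simpa using hx)]

theorem norm_sub_E_sq (s : ℝ) (F : H p) : ‖F - E p s F‖ ^ 2 = ‖F‖ ^ 2 - ‖E p s F‖ ^ 2 := by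
  have h1 : ⟪F, E p s F⟫_ℂ = ((‖E p s F‖ ^ 2 : ℝ) : ℂ) := by
    rw [← inner_self_eq_ofReal, ← inner_star_mul, star_E, E_mul_E]
  rw [@norm_sub_sq ℂ, h1]
  simp only [RCLike.re_to_complex, Complex.ofReal_re]
  ring

/-- The truncated solutions on [s, ∞) extend one another, so their norms increase as s decreases.
Boundedness and the Pythagorean identity make them Cauchy, and their limit is F. -/
theorem exists_sqrtOp_eq {Z : H p} {C : ℝ} (hC : ∀ s, 0 < s → ‖invSqrtOp p s Z‖ ^ 2 ≤ C) :
    ∃ F : H p, sqrtOp p F = Z := by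
  let s : ℕ → ℝ := fun n => 1 / ((n : ℝ) + 1)
  have hs0 : ∀ n, 0 < s n := fun n => Nat.one_div_pos_of_nat
  have hs : ∀ {m n : ℕ}, m ≤ n → s n ≤ s m := fun h => Nat.one_div_le_one_div h
  have hst : Tendsto s atTop (𝓝[>] 0) := tendsto_nhdsWithin_iff.2
    ⟨tendsto_one_div_add_atTop_nhds_zero_nat, Eventually.of_forall hs0⟩
  let u : ℕ → H p := fun n => invSqrtOp p (s n) Z
  have huE : ∀ {m n : ℕ}, m ≤ n → u m = E p (s m) (u n) := fun {m n} h => by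
    change _ = E p (s m) (invSqrtOp p (s n) Z)
    rw [← mul_apply_eq_comp, E_invSqrtOp (hs0 n) (hs h)]
  have hmono : Monotone fun n => ‖u n‖ ^ 2 := fun m n h => by
    change ‖u m‖ ^ 2 ≤ ‖u n‖ ^ 2
    rw [huE h]
    have := norm_E_apply_le (s m) (u n)
    gcongr
  have hbdd : BddAbove (Set.range fun n => ‖u n‖ ^ 2) :=
    ⟨C, by
      rintro _ ⟨n, rfl⟩
      exact hC _ (hs0 n)⟩
  have hcau := (tendsto_atTop_ciSup hmono hbdd).cauchySeq
  have hu : CauchySeq u := by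
    rw [Metric.cauchySeq_iff'] at hcau ⊢
    intro ε hε
    obtain ⟨N, hN⟩ := hcau (ε ^ 2) (by positivity)
    refine ⟨N, fun n hn => ?_⟩
    have h1 := hN n hn
    rw [Real.dist_eq] at h1
    have h2 : dist (u n) (u N) ^ 2 = ‖u n‖ ^ 2 - ‖u N‖ ^ 2 := by
      rw [dist_eq_norm, huE hn, norm_sub_E_sq]
    exact lt_of_pow_lt_pow_left₀ 2 hε.le (h2 ▸ (le_abs_self _).trans_lt h1)
  obtain ⟨F, hF⟩ := cauchySeq_tendsto_of_complete hu
  refine ⟨F, tendsto_nhds_unique (((sqrtOp p).continuous.tendsto F).comp hF) ?_⟩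
  refine ((tendsto_E Z).comp hst).congr fun n => ?_
  exact (sqrtOp_invSqrtOp_apply (hs0 n) Z).symm

theorem invSqrtOp_sqrtOp_apply {t : ℝ} (ht : 0 < t) (x : H p) :
    invSqrtOp p t (sqrtOp p x) = E p t x := by
  rw [← invSqrtOp_mul_sqrtOp ht, mul_apply_eq_comp]

theorem sqrtOp_injective : Function.Injective (sqrtOp p) := by
  refine (injective_iff_map_eq_zero _).2 fun F hF => ?_
  refine tendsto_nhds_unique (tendsto_E F) (tendsto_const_nhds.congr' ?_)
  filter_upwards [self_mem_nhdsWithin] with t ht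
  rw [← invSqrtOp_sqrtOp_apply ht, hF, map_zero]

end Unweighting

/-! ### Completely positive maps given by square summable Kraus families. -/

section KrausSum

set_option linter.unusedSectionVars false

variable {E V : Type} [NormedAddCommGroup E] [InnerProductSpace ℂ E] [CompleteSpace E]
  [NormedAddCommGroup V] [InnerProductSpace ℂ V] [CompleteSpace V] {J : Type} {S : J → V →L[ℂ] E}

theorem norm_krausTerm_le (S : V →L[ℂ] E) (A : E →L[ℂ] E) : ‖krausTerm S A‖ ≤ ‖S‖ ^ 2 * ‖A‖ :=
  calc ‖krausTerm S A‖ ≤ ‖ContinuousLinearMap.adjoint S‖ * ‖A ∘L S‖ :=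
        ContinuousLinearMap.opNorm_comp_le _ _
    _ ≤ ‖S‖ * (‖A‖ * ‖S‖) := by
        gcongr
        · exact (ContinuousLinearMap.adjoint.norm_map S).le
        · exact ContinuousLinearMap.opNorm_comp_le _ _
    _ = ‖S‖ ^ 2 * ‖A‖ := by ring

theorem summable_krausTerm (hS : Summable fun k => ‖S k‖ ^ 2) (A : E →L[ℂ] E) :
    Summable fun k => krausTerm (S k) A :=
  .of_norm_bounded (hS.mul_right ‖A‖) fun k => norm_krausTerm_le (S k) A

/-- The map `A ↦ ∑_k S_k^* A S_k`. -/
def krausSum (hS : Summable fun k => ‖S k‖ ^ 2) : (E →L[ℂ] E) →ₗ[ℂ] (V →L[ℂ] V) where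
  toFun A := ∑' k, krausTerm (S k) A
  map_add' A B := by
    rw [← (summable_krausTerm hS A).tsum_add (summable_krausTerm hS B)]
    refine tsum_congr fun k => ?_
    simp only [krausTerm, ContinuousLinearMap.add_comp, ContinuousLinearMap.comp_add]
  map_smul' c A := by
    rw [RingHom.id_apply, ← (summable_krausTerm hS A).tsum_const_smul c]
    refine tsum_congr fun k => ?_
    simp only [krausTerm, ContinuousLinearMap.smul_comp, ContinuousLinearMap.comp_smul]

theorem hasSum_krausSum (hS : Summable fun k => ‖S k‖ ^ 2) (A : E →L[ℂ] E) :
    HasSum (fun k => krausTerm (S k) A) (krausSum hS A) :=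
  (summable_krausTerm hS A).hasSum

theorem norm_krausSum_le (hS : Summable fun k => ‖S k‖ ^ 2) (A : E →L[ℂ] E) :
    ‖krausSum hS A‖ ≤ (∑' k, ‖S k‖ ^ 2) * ‖A‖ :=
  tsum_of_norm_bounded (hS.hasSum.mul_right ‖A‖) fun k => norm_krausTerm_le (S k) A

theorem hasSum_inner_krausSum (hS : Summable fun k => ‖S k‖ ^ 2) (A : E →L[ℂ] E) (x y : V) :
    HasSum (fun k => ⟪S k x, A (S k y)⟫_ℂ) ⟪x, krausSum hS A y⟫_ℂ := by
  have h := (hasSum_krausSum hS A).mapL (innerSL ℂ x ∘L ContinuousLinearMap.apply ℂ V y)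
  exact h.congr_fun fun k => (inner_krausTerm (S k) A x y).symm

end KrausSum

/-! ### Splitting a family of vectors into a scalar part and a traceless part. -/

section Coordinates

variable {p : ℕ}

theorem sum_amp_matUnit_coeFn (x : Fin p → H p) (i : Fin p) :
    (∑ j, amp (matUnit i j) (x j) : H p) =ᵐ[halfLine] fun t => (∑ j, x j t j) • stdVec i := by
  have h1 : ∀ᵐ t ∂halfLine, ∀ j, amp (matUnit i j) (x j) t = matUnit i j (x j t) :=
    ae_all_iff.2 fun j => amp_coeFn _ _
  filter_upwards [Lp.coeFn_finsetSum Finset.univ fun j => amp (matUnit i j) (x j), h1] with t h2 h3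
  rw [h2, Finset.sum_apply, Finset.sum_smul]
  exact Finset.sum_congr rfl fun j _ => by rw [h3, matUnit_apply]

/-- The center of a vector, with respect to the canonical matrix units in `B(H)`. -/
def ampCenter (x : Fin p → H p) (i : Fin p) : H p := center (fun i j => amp (matUnit i j)) x i

/-- The shape g_ik = g_k e_i comes from here: after centring, all components share one scalar
function, which is p⁻¹ times the trace of the family. -/
theorem ampCenter_coeFn (x : Fin p → H p) (i : Fin p) :
    ampCenter x i =ᵐ[halfLine] fun t => ((p : ℂ)⁻¹ * ∑ j, x j t j) • stdVec i := by
  filter_upwards [Lp.coeFn_smul (p : ℂ)⁻¹ (∑ j, amp (matUnit i j) (x j)),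
    sum_amp_matUnit_coeFn x i] with t h1 h2
  rw [ampCenter, center, h1, Pi.smul_apply, h2, smul_smul]

theorem norm_sq_eq_integral (F : H p) : ‖F‖ ^ 2 = ∫ x, ‖F x‖ ^ 2 ∂halfLine := by
  have h1 : ((‖F‖ ^ 2 : ℝ) : ℂ) = ((∫ x, ‖F x‖ ^ 2 ∂halfLine : ℝ) : ℂ) := by
    rw [← inner_self_eq_ofReal, L2.inner_def, ← integral_complex_ofReal]
    simp only [inner_self_eq_ofReal]
  exact Complex.ofReal_injective h1

theorem toH_eq {F : ℝ → K p} {G : H p} (h : F =ᵐ[halfLine] G) : toH p F = G := by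
  have hF : MemLp F 2 halfLine := (memLp_congr_ae h).2 (Lp.memLp G)
  rw [toH, dif_pos hF]
  exact Lp.ext (hF.coeFn_toLp.trans h)

/-- The scalar part of the unweighted form of a family of vectors. -/
def scalarPart (x : Fin p → H p) (t : ℝ) : ℂ :=
  (((Real.sqrt (1 - Real.exp (-t)))⁻¹ : ℝ) : ℂ) * ((p : ℂ)⁻¹ * ∑ j, x j t j)

theorem sqrt_mul_scalarPart (x : Fin p → H p) {t : ℝ} (ht : 0 < t) :
    ((Real.sqrt (1 - Real.exp (-t)) : ℝ) : ℂ) * scalarPart x t = (p : ℂ)⁻¹ * ∑ j, x j t j := by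
  rw [scalarPart, ← mul_assoc, ← Complex.ofReal_mul,
    mul_inv_cancel₀ (sqrt_one_sub_exp_pos ht).ne', Complex.ofReal_one, one_mul]

theorem weightedVec_scalarPart {x h : Fin p → H p}
    (hh : ∀ i, sqrtOp p (h i) = x i - ampCenter x i) (i : Fin p) :
    weightedVec (scalarPart x) h i = x i := by
  rw [weightedVec, hh, toH_eq (G := ampCenter x i), add_sub_cancel]
  filter_upwards [ampCenter_coeFn x i, ae_restrict_mem measurableSet_Ioi] with t h1 ht
  rw [h1, sqrt_mul_scalarPart x ht]
  ext j
  by_cases hj : j = i <;> simp [stdVec, hj]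

theorem aestronglyMeasurable_scalarPart (x : Fin p → H p) :
    AEStronglyMeasurable (scalarPart x) halfLine := by
  refine AEStronglyMeasurable.mul (Measurable.aestronglyMeasurable (by fun_prop)) ?_
  refine AEStronglyMeasurable.const_mul ?_ _
  refine Finset.aestronglyMeasurable_fun_sum _ fun j _ => ?_
  have hc : Continuous fun f : K p => f j := by fun_prop
  exact hc.comp_aestronglyMeasurable (Lp.aestronglyMeasurable (x j))

theorem scalarPart_ae (x : Fin p → H p) (i : Fin p) :
    (fun t => ‖ampCenter x i t‖ ^ 2) =ᵐ[halfLine]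
      fun t => (1 - Real.exp (-t)) * ‖scalarPart x t‖ ^ 2 := by
  filter_upwards [ampCenter_coeFn x i, ae_restrict_mem measurableSet_Ioi] with t h1 ht
  have h2 : ‖(stdVec i : K p)‖ = 1 := by rw [stdVec, PiLp.norm_single, norm_one]
  rw [h1, norm_smul, h2, mul_one, ← sqrt_mul_scalarPart x ht, norm_mul, mul_pow,
    Complex.norm_real, Real.norm_eq_abs, sq_abs, Real.sq_sqrt (one_sub_exp_pos ht).le]

theorem memL2Plus_scalarPart (hp : 0 < p) (x : Fin p → H p) : MemL2Plus (scalarPart x) :=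
  ⟨aestronglyMeasurable_scalarPart x, ((Lp.memLp (ampCenter x ⟨0, hp⟩)).integrable_norm_pow
    (by simp)).congr (scalarPart_ae x ⟨0, hp⟩)⟩

theorem integral_scalarPart_le (hp : 0 < p) (x : Fin p → H p) :
    ∫ t, (1 - Real.exp (-t)) * ‖scalarPart x t‖ ^ 2 ∂halfLine ≤ ∑ i, ‖x i‖ ^ 2 := by
  rw [← integral_congr_ae (scalarPart_ae x ⟨0, hp⟩), ← norm_sq_eq_integral]
  have h1 := isMatrixUnits_amp.sum_norm_center hp x
  have h2 := isMatrixUnits_amp.sum_norm_sub_center hp x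
  have h3 : ∑ i, ⟪x i, x i⟫_ℂ = ((∑ i, ‖x i‖ ^ 2 : ℝ) : ℂ) := by
    simp only [Complex.ofReal_sum, inner_self_eq_ofReal]
  rw [← h1, h3, ← Complex.ofReal_sub] at h2
  have h4 := Complex.ofReal_injective h2
  have h5 : 0 ≤ ∑ i, ‖x i - center (fun i j => amp (matUnit i j)) x i‖ ^ 2 := by positivity
  have h6 : ‖ampCenter x ⟨0, hp⟩‖ ^ 2 ≤ ∑ i, ‖ampCenter x i‖ ^ 2 :=
    Finset.single_le_sum (f := fun i => ‖ampCenter x i‖ ^ 2) (fun i _ => by positivity)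
      (Finset.mem_univ _)
  refine h6.trans ?_
  rw [h4, sub_nonneg] at h5
  exact h5

/-- The complementary part has zero trace. The factor (I - Λ)^{1/2} can be cancelled because it is
injective and commutes with amplifications. -/
theorem sum_coord_eq_zero (hp : 0 < p) {x h : Fin p → H p}
    (hh : ∀ i, sqrtOp p (h i) = x i - ampCenter x i) :
    ∀ᵐ t ∂halfLine, ∑ i, h i t i = 0 := by
  let j : Fin p := ⟨0, hp⟩
  have h1 : ∑ i, amp (matUnit j i) (h i) = 0 := by
    apply sqrtOp_injective
    rw [map_zero, map_sum, ← isMatrixUnits_amp.sum_apply_sub_center hp x j]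
    refine Finset.sum_congr rfl fun i _ => ?_
    rw [← mul_apply_eq_comp, ← amp_mul_sqrtOp, mul_apply_eq_comp, hh]
    rfl
  have h2 := sum_amp_matUnit_coeFn h j
  rw [h1] at h2
  filter_upwards [h2, Lp.coeFn_zero (K p) 2 halfLine] with t h3 h4
  rw [h4] at h3
  have h5 := congrArg (fun f : K p => f j) h3
  simpa [stdVec] using h5.symm

end Coordinates

/-! ### The limiting form of a map with bounded defect. -/

section Structure

variable {p : ℕ} {J : Type} {ϑ : Alg p →ₗ[ℂ] BK p} {V : J → Fin p → H p}

theorem invSqrtOp_mul_amp (A : BK p) (s : ℝ) : amp A * invSqrtOp p s = invSqrtOp p s * amp A := by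
  rw [invSqrtOp]
  split_ifs with hs
  · exact amp_mul_mulOp A _
  · rw [mul_zero, zero_mul]

/-- Evaluating the complementary projection δ_ij I - p⁻¹e_ij on the Kraus vectors of ϑ|_s gives the
squared norms of their off-centre parts. -/
theorem hasSum_defect (hp : 0 < p) (hV : ∀ (A : BH p) (i j : Fin p),
      HasSum (fun k => ⟪V k i, A (V k j)⟫_ℂ) ⟪stdVec i, ϑ (toAlg p A) (stdVec j)⟫_ℂ) {s : ℝ}
    (hs : 0 < s) :
    HasSum (fun k => ∑ i, ‖invSqrtOp p s (V k i - ampCenter (V k) i)‖ ^ 2)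
      (defect (restr ϑ s ∘ₗ ampₗ p)).re := by
  have h1 : ∀ (A : BH p) (i j : Fin p),
      HasSum (fun k => ⟪invSqrtOp p s (V k i), A (invSqrtOp p s (V k j))⟫_ℂ)
        ⟪stdVec i, restr ϑ s A (stdVec j)⟫_ℂ := by
    intro A i j
    rw [restr_apply hs]
    refine (hV _ i j).congr_fun fun k => ?_
    have h2 := inner_star_mul (invSqrtOp p s) (A * invSqrtOp p s) (V k i) (V k j)
    rw [star_invSqrtOp] at h2
    exact h2.symm
  have h2 : HasSum (fun k => ∑ i, ⟪invSqrtOp p s (V k i), invSqrtOp p s (V k i)⟫_ℂ -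
      centerForm (fun i j => amp (matUnit i j)) fun i => invSqrtOp p s (V k i))
      (defect (restr ϑ s ∘ₗ ampₗ p)) := by
    refine HasSum.sub (hasSum_sum fun i _ => ?_)
      ((hasSum_sum fun i _ => hasSum_sum fun j _ => h1 (amp (matUnit i j)) i j).mul_left _)
    have h3 := h1 1 i i
    rw [LinearMap.comp_apply, ampₗ_apply, amp_one]
    exact h3
  have h3 := Complex.hasSum_re h2
  refine h3.congr_fun fun k => ?_
  rw [← isMatrixUnits_amp.sum_norm_sub_center hp, Complex.ofReal_re]
  refine Finset.sum_congr rfl fun i _ => ?_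
  rw [center_map (fun i j => invSqrtOp_mul_amp (matUnit i j) s), map_sub]
  rfl

/-- The bound C on the defect bounds each unweighted off-centre part uniformly in s, so its weight
can be removed. Letting s → 0+ in finite sums shows that the results are square summable. -/
theorem exists_unweighted (hp : 0 < p) (hV : ∀ (A : BH p) (i j : Fin p),
      HasSum (fun k => ⟪V k i, A (V k j)⟫_ℂ) ⟪stdVec i, ϑ (toAlg p A) (stdVec j)⟫_ℂ) {C : ℝ}
    (hC : ∀ s, 0 < s → (defect (restr ϑ s ∘ₗ ampₗ p)).re ≤ C) :
    ∃ h : J → Fin p → H p, (∀ k i, sqrtOp p (h k i) = V k i - ampCenter (V k) i) ∧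
      Summable fun k => ∑ i, ‖h k i‖ ^ 2 := by
  have h1 : ∀ s, 0 < s → ∀ S : Finset J,
      ∑ k ∈ S, ∑ i, ‖invSqrtOp p s (V k i - ampCenter (V k) i)‖ ^ 2 ≤ C := fun s hs S =>
    (sum_le_hasSum S (fun k _ => by positivity) (hasSum_defect hp hV hs)).trans (hC s hs)
  have h2 : ∀ k i, ∃ F, sqrtOp p F = V k i - ampCenter (V k) i := fun k i =>
    exists_sqrtOp_eq (C := C) fun s hs => by
      have h3 := h1 s hs {k}
      rw [Finset.sum_singleton] at h3
      exact (Finset.single_le_sum (f := fun i =>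
        ‖invSqrtOp p s (V k i - ampCenter (V k) i)‖ ^ 2) (fun i _ => by positivity)
        (Finset.mem_univ i)).trans h3
  choose h hh using h2
  refine ⟨h, hh, summable_of_sum_le (c := C) (fun k => by positivity) fun S => ?_⟩
  have h4 : Tendsto (fun s => ∑ k ∈ S, ∑ i, ‖E p s (h k i)‖ ^ 2) (𝓝[>] 0)
      (𝓝 (∑ k ∈ S, ∑ i, ‖h k i‖ ^ 2)) :=
    tendsto_finsetSum _ fun k _ => tendsto_finsetSum _ fun i _ => (tendsto_E (h k i)).norm.pow 2
  refine le_of_tendsto h4 ?_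
  filter_upwards [eventually_pos_nhdsGT] with s hs
  have h5 := h1 s hs S
  simp only [← hh, invSqrtOp_sqrtOp_apply hs] at h5
  exact h5

/-- A completely positive normal map on `𝔄(ℂ^p)`, the cut offs of which have bounded defect, has
the limiting form. -/
theorem exists_preLimitingForm (hp : 0 < p) (hcp : IsCP (ϑ ∘ₗ toAlg p))
    (hn : IsNormalMap (ϑ ∘ₗ toAlg p)) {C : ℝ}
    (hC : ∀ s, 0 < s → (defect (restr ϑ s ∘ₗ ampₗ p)).re ≤ C) :
    ∃ (J : Type) (_ : Countable J) (g : J → ℝ → ℂ) (h : J → Fin p → H p) (ρ : BH p →ₗ[ℂ] BK p),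
      IsPreLimitingForm g h ϑ ρ ∧ (∀ k, ∀ᵐ x ∂halfLine, ∑ i, h k i x i = 0) ∧
      (∃ D : ℝ, ∀ A, ‖ρ A‖ ≤ D * ‖A‖) ∧
      Summable fun k => ∫ x, (1 - Real.exp (-x)) * ‖g k x‖ ^ 2 ∂halfLine := by
  obtain ⟨J, hJ, V, hVs, hV⟩ := hcp.exists_kraus fun i j => normalFun_coeff_iff.1 hn _ _
  obtain ⟨h, hh, hs⟩ := exists_unweighted hp hV hC
  have hsi : ∀ i, Summable fun k => ‖h k i‖ ^ 2 := fun i =>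
    hs.of_nonneg_of_le (fun k => by positivity) fun k =>
      Finset.single_le_sum (f := fun i => ‖h k i‖ ^ 2) (fun i _ => by positivity)
        (Finset.mem_univ i)
  have hS : Summable fun k => ‖vecOp (h k)‖ ^ 2 :=
    (hs.mul_left (p : ℝ)).of_nonneg_of_le (fun k => by positivity) fun k => norm_vecOp_sq_le (h k)
  refine ⟨J, hJ, fun k => scalarPart (V k), h, krausSum hS,
    ⟨fun k => memL2Plus_scalarPart hp (V k), fun B i j => ?_, fun A i j => ?_, hsi⟩,
    fun k => sum_coord_eq_zero hp (hh k), ⟨_, norm_krausSum_le hS⟩, ?_⟩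
  · have h1 : HasSum _ ⟪stdVec i, ϑ (toAlg p B) (stdVec j)⟫_ℂ := hV B i j
    rw [inner_stdVec] at h1
    refine h1.congr_fun fun k => ?_
    rw [weightedVec_scalarPart (hh k), weightedVec_scalarPart (hh k)]
  · have h1 := hasSum_inner_krausSum hS A (stdVec i) (stdVec j)
    rw [inner_stdVec] at h1
    refine h1.congr_fun fun k => ?_
    rw [vecOp_stdVec, vecOp_stdVec]
  · refine (summable_sum fun i (_ : i ∈ Finset.univ) => hVs i).of_nonneg_of_le
      (fun k => ?_) fun k => integral_scalarPart_le hp (V k)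
    refine integral_nonneg_of_ae ?_
    filter_upwards [ae_restrict_mem measurableSet_Ioi] with t ht
    have := one_sub_exp_pos ht
    exact mul_nonneg this.le (by positivity)

end Structure

/-! ### Nonzero limits of normalized operators. -/

section Normalization

variable {M : Type*} [NormedAddCommGroup M] [NormedSpace ℂ M] [FiniteDimensional ℂ M]
  {α : Type*} {l : Filter α} [l.NeBot]

/-- A family of nonzero operators has a nonzero limit along an ultrafilter, after a
normalization. -/
theorem exists_normalized_limit {T : α → Module.End ℂ M} (hT : ∀ᶠ a in l, T a ≠ 0) :
    ∃ (U : Ultrafilter α) (c : α → ℝ) (ψ : Module.End ℂ M), ↑U ≤ l ∧ (∀ᶠ a in U, 0 < c a) ∧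
      ψ ≠ 0 ∧ ∀ x, Tendsto (fun a => ((c a : ℝ) : ℂ) • T a x) U (𝓝 (ψ x)) := by
  let Ψ := Module.End.toContinuousLinearMap (𝕜 := ℂ) M
  let U := Ultrafilter.of l
  have hU : ↑U ≤ l := Ultrafilter.of_le l
  have hT' : ∀ᶠ a in U, 0 < ‖Ψ (T a)‖ := by
    filter_upwards [hU hT] with a ha
    exact norm_pos_iff.2 ((map_ne_zero_iff Ψ Ψ.injective).2 ha)
  have : ProperSpace (M →L[ℂ] M) := FiniteDimensional.proper ℂ _
  -- Division by the operator norm puts the family on the compact unit sphere, so the ultrafilter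
  -- limit has norm one.
  let f : α → (M →L[ℂ] M) := fun a => ((‖Ψ (T a)‖⁻¹ : ℝ) : ℂ) • Ψ (T a)
  have hf : ↑(U.map f) ≤ 𝓟 (Metric.sphere (0 : M →L[ℂ] M) 1) := by
    rw [le_principal_iff]
    change ∀ᶠ a in (U : Filter α), f a ∈ Metric.sphere (0 : M →L[ℂ] M) 1
    filter_upwards [hT'] with a ha
    rw [mem_sphere_zero_iff_norm, norm_smul, Complex.norm_real, Real.norm_of_nonneg (by positivity),
      inv_mul_cancel₀ ha.ne']
  obtain ⟨L, hL, hLf⟩ := (isCompact_sphere (0 : M →L[ℂ] M) 1).ultrafilter_le_nhds _ hf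
  have hLf' : Tendsto f U (𝓝 L) := hLf
  refine ⟨U, fun a => ‖Ψ (T a)‖⁻¹, L, hU, ?_, ?_, fun x => ?_⟩
  · filter_upwards [hT'] with a ha
    exact inv_pos.2 ha
  · intro h0
    have h1 : L = 0 := ContinuousLinearMap.coe_injective h0
    rw [h1, mem_sphere_zero_iff_norm, norm_zero] at hL
    exact zero_ne_one hL
  · exact ((ContinuousLinearMap.apply ℂ M x).continuous.tendsto L).comp hLf'

end Normalization

/-! ### Limits and scalings in the operator order. -/

section Order

variable {V : Type} [NormedAddCommGroup V] [InnerProductSpace ℂ V] [CompleteSpace V]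

theorem le_of_tendsto_op {α : Type*} {l : Filter α} [l.NeBot] {X Y : α → V →L[ℂ] V}
    {X₀ Y₀ : V →L[ℂ] V} (hX : Tendsto X l (𝓝 X₀)) (hY : Tendsto Y l (𝓝 Y₀))
    (h : ∀ᶠ a in l, X a ≤ Y a) : X₀ ≤ Y₀ := by
  rw [← sub_nonneg]
  refine nonneg_of_inner_nonneg fun x => ?_
  have : OrderClosedTopology ℂ := Complex.orderClosedTopology
  have h1 : Tendsto (fun a => ⟪x, (Y a - X a) x⟫_ℂ) l (𝓝 ⟪x, (Y₀ - X₀) x⟫_ℂ) :=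
    tendsto_const_nhds.inner
      (((ContinuousLinearMap.apply ℂ V x).continuous.tendsto _).comp (hY.sub hX))
  refine ge_of_tendsto h1 ?_
  filter_upwards [h] with a ha
  exact inner_nonneg_of_nonneg (sub_nonneg.2 ha) x

theorem smul_le_smul_op {X Y : V →L[ℂ] V} (h : X ≤ Y) {c : ℝ} (hc : 0 ≤ c) :
    (c : ℂ) • X ≤ (c : ℂ) • Y := by
  rw [← sub_nonneg, ← smul_sub]
  refine nonneg_of_inner_nonneg fun x => ?_
  rw [smul_apply, inner_smul_right]
  exact mul_nonneg (Complex.zero_le_real.2 hc) (inner_nonneg_of_nonneg (sub_nonneg.2 h) x)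

theorem le_one_of_norm_le_one {X : V →L[ℂ] V} (hX : 0 ≤ X) (h : ‖X‖ ≤ 1) : X ≤ 1 :=
  (CStarAlgebra.norm_le_one_iff_of_nonneg X hX).1 h

theorem affineMul_neg (a : ℝ) (Y : V →L[ℂ] V) : affineMul (-a) (-Y) = -affineMul a Y := by
  refine LinearMap.ext fun A => ?_
  rw [LinearMap.neg_apply, affineMul_apply, affineMul_apply, star_neg, Complex.ofReal_neg,
    neg_smul, mul_neg, neg_mul]
  abel

end Order

/-! ### Properties of ψ and ψω inherited from the boundary representations. -/

section Direct

variable {p : ℕ} {ω : Alg p →ₗ[ℂ] BK p}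

theorem IsCPWeight.isCP (hω : IsCPWeight ω) : IsCP (ω ∘ₗ toAlg p) := by
  intro n A f
  refine hω n (fun i j => toAlg p (star (A i) * A j)) (fun x => ?_) f
  have h := blockForm_star_mul_nonneg A fun i => sqrtOp p (x i)
  refine h.trans_eq (Finset.sum_congr rfl fun i _ => Finset.sum_congr rfl fun j _ => ?_)
  have h2 := inner_star_mul (sqrtOp p) (star (A i) * A j * sqrtOp p) (x i) (x j)
  rw [star_sqrtOp] at h2
  exact h2.symm

/-- The operator `(ι + ω|_t Λ)⁻¹`. -/
def invOnePlus (ω : Alg p →ₗ[ℂ] BK p) (t : ℝ) : Module.End ℂ (BK p) := Ring.inverse (onePlus ω t)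

theorem bdryRep_apply (t : ℝ) (A : BH p) : bdryRep ω t A = invOnePlus ω t (restr ω t A) := rfl

theorem IsQWeightMap.invOnePlus_mul (hω : IsQWeightMap ω) {t : ℝ} (ht : 0 < t) :
    invOnePlus ω t * onePlus ω t = 1 ∧ onePlus ω t * invOnePlus ω t = 1 :=
  ⟨Ring.inverse_mul_cancel _ (hω.invertible t ht), Ring.mul_inverse_cancel _ (hω.invertible t ht)⟩

/-- The identity (ι + X)⁻¹ = ι - (ι + X)⁻¹X with X = ω|_tΛ. It exhibits the inverse as the identity
minus a completely positive map, hence as conditionally negative. -/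
theorem IsQWeightMap.invOnePlus_eq (hω : IsQWeightMap ω) {t : ℝ} (ht : 0 < t) :
    invOnePlus ω t = LinearMap.id - bdryRep ω t ∘ₗ Lam p := by
  refine LinearMap.ext fun A => ?_
  have h1 := LinearMap.congr_fun (hω.invOnePlus_mul ht).1 A
  have h2 : (invOnePlus ω t * onePlus ω t) A =
      invOnePlus ω t A + invOnePlus ω t (restr ω t (Lam p A)) := by
    rw [← map_add]
    rfl
  rw [h2] at h1
  exact eq_sub_of_add_eq h1

theorem IsQWeightMap.bdryRep_one_le (hω : IsQWeightMap ω) {t : ℝ} (ht : 0 < t) :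
    bdryRep ω t 1 ≤ 1 :=
  le_one_of_norm_le_one ((hω.rep_cp t ht).nonneg zero_le_one)
    ((hω.rep_contractive t ht 1).trans ContinuousLinearMap.norm_id_le)

theorem eventually_le_nhdsGT {s : ℝ} (hs : 0 < s) : ∀ᶠ t : ℝ in 𝓝[>] 0, t ≤ s := by
  filter_upwards [Ioc_mem_nhdsGT hs] with t ht using ht.2

/-- Composing with a right inverse of ω on the finite dimensional target, ω|_s tends to ι as s → 0+,
so it is invertible for some s. -/
theorem IsBWeightMap.exists_restr_surjective (hω : IsBWeightMap ω) (hr : LinearMap.range ω = ⊤) :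
    ∃ s, 0 < s ∧ Function.Surjective (restr ω s) := by
  have hs : LinearMap.range (ω ∘ₗ toAlg p) = ⊤ := by
    rw [LinearMap.range_eq_top] at hr ⊢
    exact hr.comp fun X => toAlg_surjective X
  obtain ⟨r, hr⟩ := (ω ∘ₗ toAlg p).exists_rightInverse_of_surjective hs
  have h1 : ∀ x, Tendsto (fun s => (restr ω s ∘ₗ (Alg p).subtype ∘ₗ toAlg p ∘ₗ r) x) (𝓝[>] 0)
      (𝓝 ((1 : Module.End ℂ (BK p)) x)) := by
    intro x
    have h2 := tendsto_restr_toAlg hω (r x)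
    have h3 : ω (toAlg p (r x)) = x := LinearMap.congr_fun hr x
    rw [h3] at h2
    exact h2
  obtain ⟨s, hs, hu⟩ := (eventually_pos_nhdsGT.and
    (eventually_isUnit_of_tendsto h1 isUnit_one)).exists
  refine ⟨s, hs, fun y => ?_⟩
  obtain ⟨x, hx⟩ := ((Module.End.isUnit_iff _).1 hu).2 y
  exact ⟨_, hx⟩

/-- Every y is ω|_s(A) for one fixed s, and then (ι + ω|_tΛ)⁻¹y = π_t^#(A|_s), which tends to zero
by index zero. -/
theorem IsQWeightMap.tendsto_invOnePlus (hω : IsQWeightMap ω) (h0 : IsIndexZero ω)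
    (hr : LinearMap.range ω = ⊤) (y : BK p) :
    Tendsto (fun t => invOnePlus ω t y) (𝓝[>] 0) (𝓝 0) := by
  obtain ⟨s, hs, hsurj⟩ := IsBWeightMap.exists_restr_surjective hω.bWeight hr
  obtain ⟨A, rfl⟩ := hsurj y
  refine (h0.tendsto s hs A).congr' ?_
  filter_upwards [eventually_pos_nhdsGT, eventually_le_nhdsGT hs] with t ht hts
  rw [bdryRep_apply, restr_sandwich_E ht hts]

theorem IsQWeightMap.invOnePlus_ne_zero (hω : IsQWeightMap ω) (hp : 0 < p) {t : ℝ} (ht : 0 < t) :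
    invOnePlus ω t ≠ 0 := by
  intro h
  have h1 := (hω.invOnePlus_mul ht).1
  rw [h, zero_mul] at h1
  have h2 : (0 : BK p) (stdVec ⟨0, hp⟩) = (1 : BK p) (stdVec ⟨0, hp⟩) :=
    congrArg (fun X : BK p => X (stdVec ⟨0, hp⟩)) (LinearMap.congr_fun h1 1)
  have h3 := congrArg (fun f : K p => f ⟨0, hp⟩) h2
  simp [stdVec] at h3

/-- The data of a limit of the normalized operators `(ι + ω|_t Λ)⁻¹` as `t → 0+`. -/
structure IsNormalizedLimit (ω : Alg p →ₗ[ℂ] BK p) (l : Filter ℝ) (c : ℝ → ℝ)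
    (ψ : BK p →ₗ[ℂ] BK p) : Prop where
  le : l ≤ 𝓝[>] 0
  pos : ∀ᶠ t in l, 0 < c t
  ne_zero : ψ ≠ 0
  tendsto : ∀ x, Tendsto (fun t => ((c t : ℝ) : ℂ) • invOnePlus ω t x) l (𝓝 (ψ x))

variable {l : Filter ℝ} {c : ℝ → ℝ} {ψ : BK p →ₗ[ℂ] BK p}

namespace IsNormalizedLimit

theorem eventually_pos (hl : IsNormalizedLimit ω l c ψ) : ∀ᶠ t in l, 0 < t :=
  hl.le eventually_pos_nhdsGT

/-- For t ≤ s, π_t^#(A|_s) = (ι + ω|_tΛ)⁻¹ω|_s(A), with an argument independent of t. This transfers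
positivity from π_t^# to (ψω)|_s. -/
theorem tendsto_rep (hl : IsNormalizedLimit ω l c ψ) {s : ℝ} (hs : 0 < s) (A : BH p) :
    Tendsto (fun t => ((c t : ℝ) : ℂ) • bdryRep ω t (sandwich (E p s) A)) l
      (𝓝 (restr (ψ ∘ₗ ω) s A)) := by
  refine (hl.tendsto (restr ω s A)).congr' ?_
  filter_upwards [hl.eventually_pos, hl.le (eventually_le_nhdsGT hs)] with t ht hts
  rw [bdryRep_apply, restr_sandwich_E ht hts]

theorem condNeg_invOnePlus (hω : IsQWeightMap ω) {t : ℝ} (ht : 0 < t) :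
    CondNeg (invOnePlus ω t) := by
  rw [hω.invOnePlus_eq ht]
  exact condNeg_one.sub_isCP ((hω.rep_cp t ht).comp isCP_Lam)

theorem condNeg [l.NeBot] (hl : IsNormalizedLimit ω l c ψ) (hω : IsQWeightMap ω) : CondNeg ψ := by
  refine condNeg_of_tendsto (φ := fun t => ((c t : ℝ) : ℂ) • invOnePlus ω t) ?_ hl.tendsto
  filter_upwards [hl.eventually_pos, hl.pos] with t ht hc
  exact (condNeg_invOnePlus hω ht).smul hc.le

theorem isCP_restr [l.NeBot] (hl : IsNormalizedLimit ω l c ψ) (hω : IsQWeightMap ω) {s : ℝ} (hs : 0 < s) :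
    IsCP (restr (ψ ∘ₗ ω) s) := by
  refine isCP_of_tendsto (φ := fun t => ((c t : ℝ) : ℂ) • (bdryRep ω t ∘ₗ sandwich (E p s))) ?_
    fun A => hl.tendsto_rep hs A
  filter_upwards [hl.eventually_pos, hl.pos] with t ht hc
  exact ((hω.rep_cp t ht).comp (isCP_sandwich (star_E s))).smul hc.le

theorem isNormalMap (hω : IsQWeightMap ω) (ψ : BK p →ₗ[ℂ] BK p) :
    IsNormalMap ((ψ ∘ₗ ω) ∘ₗ toAlg p) := by
  rw [LinearMap.comp_assoc]
  exact IsNormalMap.comp_left hω.bWeight ψ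

theorem isCP [l.NeBot] (hl : IsNormalizedLimit ω l c ψ) (hω : IsQWeightMap ω) :
    IsCP ((ψ ∘ₗ ω) ∘ₗ toAlg p) := by
  refine isCP_of_tendsto (l := 𝓝[>] 0)
    (φ := fun s => restr (ψ ∘ₗ ω) s ∘ₗ sandwich (sqrtOp p)) ?_
    fun B => tendsto_restr_toAlg (isNormalMap hω ψ) B
  filter_upwards [eventually_pos_nhdsGT] with s hs
  exact (hl.isCP_restr hω hs).comp (isCP_sandwich star_sqrtOp)

/-- Before the limit, π_t^#((I - Λ)|_s) ≤ π_t^#(I - Λ) ≤ I - π_t^#Λ(I) = (ι + ω|_tΛ)⁻¹(I). Scale by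
c_t, let t run along the filter, then s → 0+. -/
theorem le_one [l.NeBot] (hl : IsNormalizedLimit ω l c ψ) (hω : IsQWeightMap ω) :
    (ψ ∘ₗ ω) (oneSubLam p) ≤ ψ 1 := by
  have h1 := tendsto_restr_toAlg (isNormalMap hω ψ) 1
  rw [toAlg_one] at h1
  refine le_of_tendsto_op h1 tendsto_const_nhds ?_
  filter_upwards [eventually_pos_nhdsGT] with s hs
  refine le_of_tendsto_op (hl.tendsto_rep hs _) (hl.tendsto 1) ?_
  filter_upwards [hl.eventually_pos, hl.pos] with t ht hc
  refine smul_le_smul_op ?_ hc.le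
  have h2 : sandwich (E p s) (oneSubLam p : BH p) ≤ oneSubLam p := by
    have h3 : (oneSubLam p : BH p) * E p s = E p s * oneSubLam p := by
      rw [oneSubLam_coe, sub_mul, mul_sub, Lam_mul_E, one_mul, mul_one]
    have h4 : (0 : BH p) ≤ (oneSubLam p : BH p) := by
      rw [oneSubLam_coe, ← one_sub_Lam_eq]
      have h5 := star_mul_self_nonneg (sqrtOp p)
      rw [star_sqrtOp] at h5
      exact h5
    rw [← sub_nonneg, ← sandwich_one_sub_E h3]
    exact (isCP_sandwich (star_one_sub_E s)).nonneg h4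
  refine ((hω.rep_cp t ht).mono h2).trans ?_
  have e : invOnePlus ω t 1 = 1 - bdryRep ω t (Lam p 1) :=
    LinearMap.congr_fun (hω.invOnePlus_eq ht) 1
  rw [e, oneSubLam_coe, map_sub]
  exact sub_le_sub_right (hω.bdryRep_one_le ht) _

/-- The map is the limit of c_t times ι - (π_t^#Λ - π_t^#|_sΛ), the identity minus a completely
positive tail. -/
theorem condNeg_coeffRestr [l.NeBot] (hl : IsNormalizedLimit ω l c ψ) (hω : IsQWeightMap ω) {s : ℝ}
    (hs : 0 < s) : CondNeg (coeffRestr ψ (ψ ∘ₗ ω) s) := by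
  refine condNeg_of_tendsto (l := l) (φ := fun t => ((c t : ℝ) : ℂ) •
    (LinearMap.id - (bdryRep ω t ∘ₗ Lam p - bdryRep ω t ∘ₗ sandwich (E p s) ∘ₗ Lam p))) ?_
    fun A => ?_
  · filter_upwards [hl.eventually_pos, hl.pos] with t ht hc
    exact (condNeg_one.sub_isCP
      (isCP_comp_tail (hω.rep_cp t ht) isCP_Lam fun A => Lam_mul_E A s)).smul hc.le
  · refine ((hl.tendsto A).add (hl.tendsto_rep hs (Lam p A))).congr' ?_
    filter_upwards [hl.eventually_pos] with t ht
    rw [hω.invOnePlus_eq ht]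
    refine (smul_add _ _ _).symm.trans ?_
    rw [LinearMap.smul_apply]
    congr 1
    simp only [LinearMap.sub_apply, LinearMap.comp_apply, LinearMap.id_apply]
    abel

/-- The right side does not depend on s, which gives the uniform bound needed to remove the weight
from the off-centre parts. -/
theorem defect_le [l.NeBot] (hl : IsNormalizedLimit ω l c ψ) (hω : IsQWeightMap ω) (hp : 0 < p) {s : ℝ}
    (hs : 0 < s) : (defect (restr (ψ ∘ₗ ω) s ∘ₗ ampₗ p)).re ≤ (unitSum ψ).re := by
  have h1 := tendsto_defect (l := l)
    (φ := fun t => ((c t : ℝ) : ℂ) • (bdryRep ω t ∘ₗ sandwich (E p s) ∘ₗ ampₗ p))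
    (φ₀ := restr (ψ ∘ₗ ω) s ∘ₗ ampₗ p) fun A => hl.tendsto_rep hs (ampₗ p A)
  have h2 := tendsto_unitSum (l := l) (φ := fun t => ((c t : ℝ) : ℂ) • invOnePlus ω t)
    (φ₀ := ψ) hl.tendsto
  refine le_of_tendsto_of_tendsto ((Complex.continuous_re.tendsto _).comp h1)
    ((Complex.continuous_re.tendsto _).comp h2) ?_
  filter_upwards [hl.eventually_pos, hl.pos] with t ht hc
  have h3 := (hω.rep_cp t ht).defect_cutoff_le hp (hω.bdryRep_one_le ht) (hω.invOnePlus_eq ht) s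
  have h4 := mul_le_mul_of_nonneg_left h3 (Complex.zero_le_real.2 hc.le)
  rw [← defect_smul, ← unitSum_smul] at h4
  exact (Complex.le_def.1 h4).1

theorem coeffRestr_eq (t : ℝ) : coeffRestr ψ (ψ ∘ₗ ω) t = ψ ∘ₗ onePlus ω t := by
  refine LinearMap.ext fun A => ?_
  change _ = ψ (A + _)
  rw [map_add]
  rfl

end IsNormalizedLimit

end Direct

/-! ### Divergence of w_t and the construction of ψ, ϑ and ρ. -/

section Weights

variable {p : ℕ} {J : Type} {g : J → ℝ → ℂ} {h : J → Fin p → H p} {ϑ : Alg p →ₗ[ℂ] BK p}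
  {ρ : BH p →ₗ[ℂ] BK p} {ω : Alg p →ₗ[ℂ] BK p} {l : Filter ℝ} {c : ℝ → ℝ}
  {ψ : BK p →ₗ[ℂ] BK p}

theorem integrableOn_exp_mul_sq {f : ℝ → ℂ} (hf : MemL2Plus f) {t : ℝ} (ht : 0 < t) :
    IntegrableOn (fun x => Real.exp (-x) * ‖f x‖ ^ 2) (Set.Ici t) := by
  have h1 : Integrable ((Set.Ici t).indicator fun x => Real.exp (-x) * ‖f x‖ ^ 2) halfLine := by
    refine (integrable_exp_mul_sq (gcut f t)).congr ?_
    filter_upwards [gcut_coeFn hf ht] with x hx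
    rw [hx]
    by_cases hxt : x ∈ Set.Ici t
    · rw [Set.indicator_of_mem hxt, Set.indicator_of_mem hxt]
    · rw [Set.indicator_of_notMem hxt, Set.indicator_of_notMem hxt]
      simp
  rw [integrable_indicator_iff measurableSet_Ici, IntegrableOn,
    Measure.restrict_restrict measurableSet_Ici,
    Set.inter_eq_left.2 (Set.Ici_subset_Ioi.2 ht)] at h1
  exact h1

theorem IsPreLimitingForm.wt_anti (hL : IsPreLimitingForm g h ϑ ρ) (hp : 0 < p) {s t : ℝ}
    (hs : 0 < s) (h : s ≤ t) : wt g t ≤ wt g s := by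
  refine (hL.summable_wterm hp (hs.trans_le h)).tsum_le_tsum (fun k => ?_) (hL.summable_wterm hp hs)
  refine setIntegral_mono_set ?_ (Eventually.of_forall fun x => by positivity)
    (Set.Ici_subset_Ici.2 h).eventuallyLE
  exact integrableOn_exp_mul_sq (hL.g_mem k) hs

theorem IsPreLimitingForm.exists_bound_coeffRestr (hL : IsPreLimitingForm g h ϑ ρ) (hp : 0 < p)
    (hρ : ∃ C : ℝ, ∀ A, ‖ρ A‖ ≤ C * ‖A‖) (ψ : BK p →ₗ[ℂ] BK p) {b : ℝ}
    (hb : ∀ t, 0 < t → wt g t ≤ b) :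
    ∃ C : ℝ, ∀ t, 0 < t → ∀ A, ‖coeffRestr ψ ϑ t A‖ ≤ C * ‖A‖ := by
  obtain ⟨C, hC⟩ := hρ
  obtain ⟨D, hD⟩ := hL.norm_crossOp_le hp one_pos
  let Ψ := LinearMap.toContinuousLinearMap ψ
  let L := LinearMap.toContinuousLinearMap (Lam p)
  refine ⟨‖Ψ‖ + (b + 2 * (b + D)) + |C| * ‖L‖, fun t ht A => ?_⟩
  have hw0 : 0 ≤ wt g t := tsum_nonneg fun k => wterm_nonneg g t k
  have h1 : ‖ψ A‖ ≤ ‖Ψ‖ * ‖A‖ := Ψ.le_opNorm A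
  have h2 : ‖affineMul (wt g t) (crossOp g h t) A‖ ≤ (b + 2 * (b + D)) * ‖A‖ := by
    refine (norm_affineMul_le _ _ A).trans ?_
    rw [abs_of_nonneg hw0]
    have := hD t ht
    have := hb t ht
    gcongr
    linarith
  have h3 : ‖ρ (sandwich (E p t) (Lam p A))‖ ≤ |C| * ‖L‖ * ‖A‖ :=
    calc ‖ρ (sandwich (E p t) (Lam p A))‖ ≤ C * ‖sandwich (E p t) (Lam p A)‖ := hC _
      _ ≤ |C| * ‖sandwich (E p t) (Lam p A)‖ := by
        gcongr
        exact le_abs_self C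
      _ ≤ |C| * ‖Lam p A‖ := by
        gcongr
        exact norm_sandwich_E_le t _
      _ ≤ |C| * (‖L‖ * ‖A‖) := by
        gcongr
        exact L.le_opNorm A
      _ = |C| * ‖L‖ * ‖A‖ := by ring
  have e : coeffRestr ψ ϑ t A = ψ A + affineMul (wt g t) (crossOp g h t) A +
      ρ (sandwich (E p t) (Lam p A)) := by
    rw [coeffRestr, LinearMap.add_apply, LinearMap.comp_apply, hL.restr_Lam hp ht]
    exact (add_assoc _ _ _).symm
  rw [e, add_mul, add_mul]
  exact norm_add₃_le.trans (add_le_add (add_le_add h1 h2) h3)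

theorem IsNormalizedLimit.wt_tendsto (hl : IsNormalizedLimit ω l c ψ) (hω : IsQWeightMap ω)
    (h0 : IsIndexZero ω) (hr : LinearMap.range ω = ⊤) (hL : IsPreLimitingForm g h (ψ ∘ₗ ω) ρ)
    (hp : 0 < p) (hρ : ∃ C : ℝ, ∀ A, ‖ρ A‖ ≤ C * ‖A‖) : Tendsto (wt g) (𝓝[>] 0) atTop := by
  by_contra hw
  -- Since w_t increases as t decreases, failure to diverge means boundedness.
  have h1 : ∃ b, ∀ t, 0 < t → wt g t ≤ b := by
    by_contra! hcon
    refine hw (tendsto_atTop.2 fun b => ?_)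
    obtain ⟨t, ht, hbt⟩ := hcon b
    filter_upwards [eventually_pos_nhdsGT, eventually_le_nhdsGT ht] with s hs hst
    exact hbt.le.trans (hL.wt_anti hp hs hst)
  obtain ⟨b, hb⟩ := h1
  obtain ⟨C, hC⟩ := hL.exists_bound_coeffRestr hp hρ ψ hb
  -- Then ψ(ι + ω|_tΛ) is uniformly bounded; applied to (ι + ω|_tΛ)⁻¹x → 0 it always returns ψ(x),
  -- forcing ψ = 0.
  refine hl.ne_zero (LinearMap.ext fun x => ?_)
  have h2 : Tendsto (fun t => C * ‖invOnePlus ω t x‖) (𝓝[>] 0) (𝓝 (C * 0)) :=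
    (tendsto_zero_iff_norm_tendsto_zero.1 (hω.tendsto_invOnePlus h0 hr x)).const_mul C
  rw [mul_zero] at h2
  have h3 : ‖ψ x‖ ≤ 0 := by
    refine ge_of_tendsto h2 ?_
    filter_upwards [eventually_pos_nhdsGT] with t ht
    have h4 := hC t ht (invOnePlus ω t x)
    have h5 : onePlus ω t (invOnePlus ω t x) = x :=
      LinearMap.congr_fun (hω.invOnePlus_mul ht).2 x
    rwa [IsNormalizedLimit.coeffRestr_eq, LinearMap.comp_apply, h5] at h4
  exact norm_le_zero_iff.1 h3

/-- Index zero `q`-weight maps with full range are obtained from a limiting form. -/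
theorem IsQWeightMap.exists_limitingForm (hω : IsQWeightMap ω) (hp : 0 < p) (h0 : IsIndexZero ω)
    (hr : LinearMap.range ω = ⊤) :
    ∃ (J : Type) (_ : Countable J) (g : J → ℝ → ℂ) (h : J → Fin p → H p)
      (ϑ : Alg p →ₗ[ℂ] BK p) (ρ : BH p →ₗ[ℂ] BK p) (ψ : BK p ≃ₗ[ℂ] BK p),
      IsLimitingForm g h ϑ ρ ∧ IsCoefficientMap ϑ ρ ψ ∧ ω = invComp ψ ϑ := by
  obtain ⟨U, c, ψ, hU, hc, hne, hlim⟩ := exists_normalized_limit (l := 𝓝[>] (0 : ℝ))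
    (T := invOnePlus ω) (by
      filter_upwards [eventually_pos_nhdsGT] with t ht using hω.invOnePlus_ne_zero hp ht)
  have hl : IsNormalizedLimit ω U c ψ := ⟨hU, hc, hne, hlim⟩
  obtain ⟨J, hJ, g, h, ρ, hL, htr, hρ, hg⟩ := exists_preLimitingForm hp (hl.isCP hω)
    (IsNormalizedLimit.isNormalMap hω ψ) fun s hs => hl.defect_le hω hp hs
  have hw := hl.wt_tendsto hω h0 hr hL hp hρ
  have hLim : IsLimitingForm g h (ψ ∘ₗ ω) ρ :=
    ⟨hL.g_mem, htr, hL.theta_eq, hL.rho_eq, hρ, hL.h_summable, hg, hw⟩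
  -- Since w_t⁻¹ψ(ι + ω|_tΛ) → ι, this composition is invertible for some t, so ψ is onto and, in
  -- finite dimension, bijective.
  have hsurj : Function.Surjective ψ := by
    have h2 := eventually_isUnit_of_tendsto (A₀ := 1)
      (A := fun t => (((wt g t)⁻¹ : ℝ) : ℂ) • coeffRestr ψ (ψ ∘ₗ ω) t)
      (hL.tendsto_coeffRestr hp eventually_pos_nhdsGT hw hρ ψ) isUnit_one
    obtain ⟨t, ht⟩ := h2.exists
    intro y
    obtain ⟨x, hx⟩ := ((Module.End.isUnit_iff _).1 ht).2 y
    refine ⟨(((wt g t)⁻¹ : ℝ) : ℂ) • onePlus ω t x, ?_⟩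
    rw [IsNormalizedLimit.coeffRestr_eq] at hx
    rw [map_smul]
    exact hx
  let e : BK p ≃ₗ[ℂ] BK p :=
    LinearEquiv.ofBijective ψ ⟨LinearMap.injective_iff_surjective.2 hsurj, hsurj⟩
  refine ⟨J, hJ, g, h, ψ ∘ₗ ω, ρ, e, hLim, ⟨isCondNeg_iff.2 (hl.condNeg hω), ?_, hl.le_one hω,
    isCondNeg_iff.2 ?_⟩, ?_⟩
  -- Inverting the convergence to ψ, c_t⁻¹(ι + ω|_tΛ) → ψ⁻¹, and these maps are visibly completely
  -- positive.
  · refine isCP_of_tendsto (l := (U : Filter ℝ))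
      (φ := fun t => (((c t)⁻¹ : ℝ) : ℂ) • onePlus ω t) ?_ fun y => ?_
    · filter_upwards [hl.eventually_pos, hl.pos] with t ht hc
      exact (isCP_one.add ((isCP_restr hω.cp.isCP ht).comp isCP_Lam)).smul (inv_pos.2 hc).le
    · refine tendsto_inverse_apply (A := fun t => ((c t : ℝ) : ℂ) • invOnePlus ω t)
        (B := fun t => (((c t)⁻¹ : ℝ) : ℂ) • onePlus ω t) (A₀ := ψ)
        (B₀ := (e.symm : BK p →ₗ[ℂ] BK p)) ?_ ?_ hl.tendsto tendsto_const_nhds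
      · filter_upwards [hl.eventually_pos, hl.pos] with t ht hc
        rw [smul_mul_smul_comm, smul_mul_smul_comm, ← Complex.ofReal_mul, ← Complex.ofReal_mul,
          inv_mul_cancel₀ hc.ne', mul_inv_cancel₀ hc.ne', Complex.ofReal_one, one_smul, one_smul]
        exact hω.invOnePlus_mul ht
      · exact ⟨LinearMap.ext fun A => e.apply_symm_apply A,
          LinearMap.ext fun A => e.symm_apply_apply A⟩
  -- Subtracting the neutral affine part from ψ + ϑ|_sΛ leaves ψ + ρ|_sΛ, still conditionally
  -- negative; normality of ρ gives the limit s → 0+.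
  · refine condNeg_of_tendsto (l := 𝓝[>] (0 : ℝ))
      (φ := fun s => ψ + ρ ∘ₗ sandwich (E p s) ∘ₗ Lam p) ?_ fun A => ?_
    · filter_upwards [eventually_pos_nhdsGT] with s hs
      have h1 := (hl.condNeg_coeffRestr hω hs).add
        (condNeg_affineMul (-(wt g s)) (-(crossOp g h s)))
      have e : ψ + ρ ∘ₗ sandwich (E p s) ∘ₗ Lam p = coeffRestr ψ (ψ ∘ₗ ω) s +
          affineMul (-(wt g s)) (-(crossOp g h s)) := by
        refine LinearMap.ext fun A => ?_
        rw [affineMul_neg]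
        simp only [coeffRestr, LinearMap.add_apply, LinearMap.neg_apply, LinearMap.comp_apply]
        rw [hL.restr_Lam hp hs]
        abel
      rw [e]
      exact h1
    · have h1 : IsNormalMap ρ := isNormalMap_of_hasSum hL.h_summable hL.rho_eq
      exact tendsto_const_nhds.add (h1.tendsto_sandwich_E (Lam p A))
  · exact LinearMap.ext fun A => (e.symm_apply_apply (ω A)).symm

end Weights

end QWeight

end

/-! ### Both directions together. -/

theorem theorem4p7 (p : ℕ) (hp : 0 < p) :
    (∀ ω : QWeight.Alg p →ₗ[ℂ] QWeight.BK p,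
      QWeight.IsQWeightMap ω → QWeight.IsIndexZero ω → LinearMap.range ω = ⊤ →
      ∃ (J : Type) (_ : Countable J) (g : J → ℝ → ℂ) (h : J → Fin p → QWeight.H p)
        (ϑ : QWeight.Alg p →ₗ[ℂ] QWeight.BK p) (ρ : QWeight.BH p →ₗ[ℂ] QWeight.BK p)
        (ψ : QWeight.BK p ≃ₗ[ℂ] QWeight.BK p),
        QWeight.IsLimitingForm g h ϑ ρ ∧ QWeight.IsCoefficientMap ϑ ρ ψ ∧
        ω = QWeight.invComp ψ ϑ ∧
        (QWeight.IsUnital ω ↔ ψ 1 = ϑ (QWeight.oneSubLam p))) ∧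
    (∀ (J : Type) (_ : Countable J) (g : J → ℝ → ℂ) (h : J → Fin p → QWeight.H p)
        (ϑ : QWeight.Alg p →ₗ[ℂ] QWeight.BK p) (ρ : QWeight.BH p →ₗ[ℂ] QWeight.BK p)
        (ψ : QWeight.BK p ≃ₗ[ℂ] QWeight.BK p),
      QWeight.IsLimitingForm g h ϑ ρ → QWeight.IsCoefficientMap ϑ ρ ψ →
      (QWeight.IsQWeightMap (QWeight.invComp ψ ϑ) ∧
        QWeight.IsIndexZero (QWeight.invComp ψ ϑ) ∧
        LinearMap.range (QWeight.invComp ψ ϑ) = ⊤ ∧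
        (QWeight.IsUnital (QWeight.invComp ψ ϑ) ↔ ψ 1 = ϑ (QWeight.oneSubLam p))) ∧
      ∀ ψ' : QWeight.BK p ≃ₗ[ℂ] QWeight.BK p, QWeight.IsCoefficientMap ϑ ρ ψ' →
        (QWeight.IsQSubordinate (QWeight.invComp ψ' ϑ) (QWeight.invComp ψ ϑ) ↔
          QWeight.IsCP ((ψ' : QWeight.BK p →ₗ[ℂ] QWeight.BK p) -
            (ψ : QWeight.BK p →ₗ[ℂ] QWeight.BK p)))) := by
  refine ⟨fun ω hω h0 hr => ?_, fun J _ g h ϑ ρ ψ hL hψ =>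
    ⟨⟨hL.pre.isQWeightMap hp hψ, hL.isIndexZero hp hψ, hL.range_eq_top hp ψ,
      QWeight.isUnital_invComp_iff ψ ϑ⟩, fun ψ' hψ' => hL.isQSubordinate_iff hp hψ hψ'⟩⟩
  obtain ⟨J, hJ, g, h, ϑ, ρ, ψ, hL, hψ, rfl⟩ := hω.exists_limitingForm hp h0 hr
  exact ⟨J, hJ, g, h, ϑ, ρ, ψ, hL, hψ, rfl, QWeight.isUnital_invComp_iff ψ ϑ⟩
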